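/- **Local stable manifold theorem for fractional systems.** Let $0<p<1$ and let $A$ be a real $n\times n$ matrix that is hyperbolic in the fractional sense: every complex eigenvalue $\mu$ of $A$ satisfies $\mu\ne 0$ and $|\arg\mu|\ne p\pi/2$. Let $E^s$ (resp. $E^u$) be the real subspace of $\mathbb{R}^n$ consisting of the real vectors in the sum of the complex generalized eigenspaces of $A$ for the eigenvalues with $|\arg\mu|>p\pi/2$ (resp. $|\arg\mu|<p\pi/2$). For $f:\mathbb{R}^n\to\mathbb{R}^n$, a solution of the Caputo system $D^p x=Ax+f(x)$ is a function $x:[0,\infty)\to\mathbb{R}^n$ that is continuous and satisfies $D^px(t)=Ax(t)+f(x(t))$ for all $t>0$, where $$D^px(t)=\frac{d}{dt}\,\frac{1}{\Gamma(1-p)}\int_0^t(t-\tau)^{-p}\,(x(\tau)-x(0))\,d\tau .$$ For $r>0$ let $B_r=\{x\in\mathbb{R}^n:\|x\|<r\}$ (Euclidean norm) and let $W_r$ be the set of all $x(0)$, where $x$ is a solution with $x(t)\in B_r$ for all $t\ge0$ and $x(t)\to0$ as $t\to\infty$. Then $\mathbb{R}^n=E^s\oplus E^u$, and there is $\varepsilon_0>0$,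 depending only on $p$ and $A$, such that the following holds for every $r>0$ and every $f:\mathbb{R}^n\to\mathbb{R}^n$ with $f(0)=0$ and $\|f(x)-f(y)\|\le\varepsilon_0\|x-y\|$ for all $x,y\in B_r$. There are $\delta>0$ and a map $h:E^s\to E^u$, Lipschitz on $\{\sigma\in E^s:\|\sigma\|<\delta\}$, with $h(0)=0$, such that for every $\sigma\in E^s$ with $\|\sigma\|<\delta$: 1. for every $\upsilon\in E^u$, $\sigma+\upsilon\in W_r$ if and only if $\upsilon=h(\sigma)$; that is, over the $\delta$-ball of $E^s$ the local stable manifold is the graph of $h$; 2. there is exactly one solution $x$ with $x(0)=\sigma+h(\sigma)$; it satisfies $x(t)\in B_r$ for all $t\ge 0$ and $x(t)\to0$ as $t\to\infty$; 3. if a solution $y$ satisfies $y(0)=\sigma+\upsilon$ with $\upsilon\in E^u$ and $y(t)\in B_r$ for all $t\ge0$, then $\upsilon=h(\sigma)$. If moreover for every $\varepsilon>0$ there is $\rho>0$ such that $f$ is Lipschitz with constant $\varepsilon$ on $B_\rho$, then $h$ is differentiable at $0$ with derivative $0$, so the local stable manifold is tangent to $E^s$ at the origin. -/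

import Mathlib

open Set Filter Topology
open scoped NNReal

namespace FracStable

noncomputable section

/-- Riemann-Liouville fractional integral of order `q > 0` with base point `0`:
`(I^q g)(t) = (1 / Γ(q)) ∫_0^t (t - τ)^(q - 1) g(τ) dτ`. -/
def rlIntegral {n : ℕ} (q : ℝ) (g : ℝ → EuclideanSpace ℝ (Fin n)) (t : ℝ) :
    EuclideanSpace ℝ (Fin n) :=
  (1 / Real.Gamma q) • ∫ τ in (0 : ℝ)..t, (t - τ) ^ (q - 1) • g τ

/-- `x` has at time `t` the Caputo derivative `v` of order `p ∈ (0, 1)`: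
`d/dt I^(1 - p) (x - x(0)) (t) = v`. -/
def HasCaputoDerivAt {n : ℕ} (p : ℝ) (x : ℝ → EuclideanSpace ℝ (Fin n))
    (v : EuclideanSpace ℝ (Fin n)) (t : ℝ) : Prop :=
  HasDerivAt (rlIntegral (1 - p) (fun τ => x τ - x 0)) v t

/-- `x` is a solution on `[0, ∞)` of `D^p x = A x + f(x)`. Only the values of `x` on `[0, ∞)`
matter; the initial value is `x 0`. -/
def IsSolution {n : ℕ} (p : ℝ) (A : Matrix (Fin n) (Fin n) ℝ)
    (f : EuclideanSpace ℝ (Fin n) → EuclideanSpace ℝ (Fin n))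
    (x : ℝ → EuclideanSpace ℝ (Fin n)) : Prop :=
  ContinuousOn x (Ici 0) ∧
    ∀ t : ℝ, 0 < t → HasCaputoDerivAt p x (Matrix.toEuclideanLin A (x t) + f (x t)) t

/-- The complex matrix with the same (real) entries as `A`. -/
def complexMatrix {n : ℕ} (A : Matrix (Fin n) (Fin n) ℝ) : Matrix (Fin n) (Fin n) ℂ :=
  A.map (fun a : ℝ => (a : ℂ))

/-- The inclusion of `ℝⁿ` in `ℂⁿ`. -/
def complexify (n : ℕ) : EuclideanSpace ℝ (Fin n) →ₗ[ℝ] (Fin n → ℂ) where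
  toFun v i := (v i : ℂ)
  map_add' v w := by ext i; simp
  map_smul' c v := by ext i; simp

/-- The real vectors in the sum of the complex generalized eigenspaces of `A` for the eigenvalues
in `S`. For `S` closed under conjugation, this is the real span of the real and imaginary parts of
those generalized eigenvectors. -/
def spectralSubspace {n : ℕ} (A : Matrix (Fin n) (Fin n) ℝ) (S : Set ℂ) :
    Submodule ℝ (EuclideanSpace ℝ (Fin n)) :=
  ((⨆ μ ∈ S, Module.End.maxGenEigenspace (Matrix.toLin' (complexMatrix A)) μ).restrictScalars
    ℝ).comap (complexify n)

/-- `E^s`: the eigenvalues `μ` with `|arg μ| > p π / 2`. -/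
def stableSubspace {n : ℕ} (p : ℝ) (A : Matrix (Fin n) (Fin n) ℝ) :
    Submodule ℝ (EuclideanSpace ℝ (Fin n)) :=
  spectralSubspace A {μ : ℂ | p * Real.pi / 2 < |Complex.arg μ|}

/-- `E^u`: the eigenvalues `μ` with `|arg μ| < p π / 2`. -/
def unstableSubspace {n : ℕ} (p : ℝ) (A : Matrix (Fin n) (Fin n) ℝ) :
    Submodule ℝ (EuclideanSpace ℝ (Fin n)) :=
  spectralSubspace A {μ : ℂ | |Complex.arg μ| < p * Real.pi / 2}

/-- No complex eigenvalue of `A` is `0` or on the rays `|arg μ| = p π / 2`. -/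
def IsHyperbolic {n : ℕ} (p : ℝ) (A : Matrix (Fin n) (Fin n) ℝ) : Prop :=
  ∀ μ ∈ spectrum ℂ (complexMatrix A), μ ≠ 0 ∧ |Complex.arg μ| ≠ p * Real.pi / 2

/-- The local stable set of the origin relative to `U`: the initial values of the solutions that
stay in `U` for all time and tend to `0`. -/
def localStableSet {n : ℕ} (p : ℝ) (A : Matrix (Fin n) (Fin n) ℝ)
    (f : EuclideanSpace ℝ (Fin n) → EuclideanSpace ℝ (Fin n))
    (U : Set (EuclideanSpace ℝ (Fin n))) : Set (EuclideanSpace ℝ (Fin n)) :=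
  {x₀ | ∃ x : ℝ → EuclideanSpace ℝ (Fin n), IsSolution p A f x ∧ x 0 = x₀ ∧
    (∀ t : ℝ, 0 ≤ t → x t ∈ U) ∧ Tendsto x atTop (𝓝 0)}

end

end FracStable

/-! ### Euler and Stieltjes integrals for complex powers. -/

namespace FracStable

open MeasureTheory

/-! The nonlinear part is the Lyapunov-Perron method. Suppose that for every bounded forcing `g` the
linear equation `D^p x = A x + g` has exactly one bounded solution whose initial value has a
prescribed `E^s`-component `σ`, and that it depends boundedly on `σ` and `g` and decays when `g`
does. Then the solutions of the nonlinear equation that stay in the ball are fixed points of `x ↦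
hom σ + forced (f ∘ x)`. This map is a contraction once the Lipschitz constant of `f` is small
against the norm of `forced`, and `h σ` is the value at time `0` of the forced part. `Dichotomy`
collects the linear facts, `Dichotomy.exists_fixedPoint` gives existence and
`Dichotomy.eq_of_isSolution` uniqueness.

The linear facts reduce, through generalized eigenvectors and real parts, to the scalar equation
`D^p x = μ x + γ`, which is solved by Gelfand theory. Let `D` be differentiation with zero initial
value on bounded functions on the half-line. Its resolvents `(r + D)⁻¹` are convolutions with
`e^(-rs)`, have norm at most `1 / r`, and generate a commutative Banach algebra. A character of this
algebra is evaluation of the symbol at some `s` with `Re s ≥ 0`, or at infinity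
(`character_dichotomy`). The operators `(1 + D)^(-p)` and `(D / (1 + D))^p` are integrals of
resolvents. With `x = (1 + D)^(-p) v` the scalar equation becomes `M v = γ`, where `M` has symbol
`(s^p - μ) (1 + s)^(-p)`.

If `|arg μ| > p π / 2`, the symbol has no zero, because `s^p` stays in the sector `|arg| ≤ p π / 2`;
so `M` is invertible (`isUnit_powDeriv_sub`). If `|arg μ| < p π / 2`, there is exactly one zero `w`,
it is simple, and `M` is `(D - w) / (1 + D)` times an invertible factor (`powDeriv_sub_eq_mul_quot`,
`isUnit_quot`). The only obstruction to solving is then that the Laplace transform of the right side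
vanish at `w`, and this fixes the initial value (`scalarSolvable_of_unstable`). The same transform
at `w` shows that the homogeneous unstable equation has no bounded nonzero solution
(`eq_zero_of_bounded`).

Since inverses are taken inside the closed algebra, and every element of it preserves decay at
infinity (`tendsto_resolventAlgebra`), decay needs no separate kernel estimates. -/

theorem norm_rpow_mul_cexp {q t : ℝ} (ht : 0 < t) (a : ℂ) :
    ‖((t ^ q : ℝ) : ℂ) * Complex.exp (-(a * t))‖ = t ^ q * Real.exp (-(a.re * t)) := by
  rw [norm_mul, Complex.norm_exp, Complex.norm_real, Real.norm_of_nonneg (Real.rpow_nonneg ht.le _)]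
  simp

theorem measurable_rpow_mul_cexp (q : ℝ) (a : ℂ) :
    Measurable fun t : ℝ => ((t ^ q : ℝ) : ℂ) * Complex.exp (-(a * t)) := by
  fun_prop

theorem integrableOn_rpow_mul_exp {q r : ℝ} (hq : -1 < q) (hr : 0 < r) :
    IntegrableOn (fun t : ℝ => t ^ q * Real.exp (-(r * t))) (Ioi 0) := by
  simpa [neg_mul] using integrableOn_rpow_mul_exp_neg_mul_rpow hq zero_lt_one hr

theorem integrableOn_rpow_mul_cexp {q : ℝ} (hq : -1 < q) {a : ℂ} (ha : 0 < a.re) :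
    IntegrableOn (fun t : ℝ => ((t ^ q : ℝ) : ℂ) * Complex.exp (-(a * t))) (Ioi 0) := by
  refine Integrable.mono' (integrableOn_rpow_mul_exp hq ha)
    (measurable_rpow_mul_cexp q a).aestronglyMeasurable ?_
  refine (ae_restrict_iff' measurableSet_Ioi).2 (Eventually.of_forall fun t ht => ?_)
  rw [norm_rpow_mul_cexp ht]

/-- Euler's integral `∫_0^∞ t^(q-1) e^(-at) dt = Γ(q) a^(-q)` for complex `a` with `Re a > 0`. -/
theorem integral_rpow_mul_cexp {q : ℝ} (hq : 0 < q) {a : ℂ} (ha : 0 < a.re) :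
    ∫ t in Ioi (0 : ℝ), ((t ^ (q - 1) : ℝ) : ℂ) * Complex.exp (-(a * t)) =
      Real.Gamma q * a ^ (-(q : ℂ)) := by
  set U : Set ℂ := {z | 0 < z.re} with hU
  have hUo : IsOpen U := isOpen_lt continuous_const Complex.continuous_re
  have hd1 : DifferentiableOn ℂ (fun a : ℂ => ∫ t in Ioi (0 : ℝ),
      ((t ^ (q - 1) : ℝ) : ℂ) * Complex.exp (-(a * t))) U := by
    intro b hb
    have hb' : 0 < b.re := hb
    have hs : {z : ℂ | b.re / 2 < z.re} ∈ 𝓝 b :=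
      (isOpen_lt continuous_const Complex.continuous_re).mem_nhds (by change b.re / 2 < b.re; linarith)
    have key := hasDerivAt_integral_of_dominated_loc_of_deriv_le (𝕜 := ℂ)
      (μ := volume.restrict (Ioi (0 : ℝ)))
      (F := fun (z : ℂ) (t : ℝ) => ((t ^ (q - 1) : ℝ) : ℂ) * Complex.exp (-(z * t)))
      (F' := fun (z : ℂ) (t : ℝ) => ((t ^ (q - 1) : ℝ) : ℂ) * (Complex.exp (-(z * t)) * (-t)))
      (bound := fun t => t ^ q * Real.exp (-(b.re / 2 * t))) hs
      (Eventually.of_forall fun z => (measurable_rpow_mul_cexp _ z).aestronglyMeasurable)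
      (integrableOn_rpow_mul_cexp (by linarith) hb')
      (by
        refine Measurable.aestronglyMeasurable ?_
        fun_prop)
      (by
        refine (ae_restrict_iff' measurableSet_Ioi).2 (Eventually.of_forall fun t ht z hz => ?_)
        have ht : 0 < t := ht
        rw [← mul_assoc, norm_mul, norm_rpow_mul_cexp ht]
        have h1 : ‖(-(t : ℂ))‖ = t := by simp [abs_of_pos ht]
        rw [h1]
        have h2 : t ^ q = t ^ (q - 1) * t := by
          rw [Real.rpow_sub_one ht.ne']; field_simp
        rw [h2, mul_right_comm]
        have hz : b.re / 2 < z.re := hz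
        gcongr)
      (integrableOn_rpow_mul_exp (by linarith) (by linarith))
      (by
        refine Eventually.of_forall fun t z _ => ?_
        have h1 : HasDerivAt (fun z : ℂ => -(z * (t : ℂ))) (-(t : ℂ)) z := by
          simpa using ((hasDerivAt_id z).mul_const (t : ℂ)).fun_neg
        exact (h1.cexp).const_mul _)
    exact key.2.differentiableAt.differentiableWithinAt
  have hd2 : DifferentiableOn ℂ (fun a : ℂ => (Real.Gamma q : ℂ) * a ^ (-(q : ℂ))) U := by
    intro b hb
    have hb' : b ∈ Complex.slitPlane := Or.inl hb
    exact ((differentiableAt_id.cpow_const hb').const_mul _).differentiableWithinAt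
  have hpre : IsPreconnected U := (convex_halfSpace_re_gt 0).isPreconnected
  have h1U : (1 : ℂ) ∈ U := by simp [hU]
  -- Both sides are holomorphic on the right half-plane, so it is enough that they agree at positive
  -- reals accumulating at `1`.
  refine AnalyticOnNhd.eqOn_of_preconnected_of_frequently_eq (hd1.analyticOnNhd hUo)
    (hd2.analyticOnNhd hUo) hpre h1U ?_ ha
  have hreal : ∀ r : ℝ, 0 < r → ∫ t in Ioi (0 : ℝ), ((t ^ (q - 1) : ℝ) : ℂ) *
      Complex.exp (-((r : ℂ) * t)) = (Real.Gamma q : ℂ) * (r : ℂ) ^ (-(q : ℂ)) := by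
    intro r hr
    have := Real.integral_rpow_mul_exp_neg_mul_Ioi hq hr
    have h2 : ∫ t in Ioi (0 : ℝ), ((t ^ (q - 1) : ℝ) : ℂ) * Complex.exp (-((r : ℂ) * t)) =
        ((∫ t in Ioi (0 : ℝ), t ^ (q - 1) * Real.exp (-(r * t)) : ℝ) : ℂ) := by
      rw [← integral_complex_ofReal]
      congr 1; ext t; push_cast; ring_nf
    rw [h2, this, one_div, Real.inv_rpow hr.le, ← Real.rpow_neg hr.le, mul_comm]
    push_cast
    rw [Complex.ofReal_cpow hr.le]; push_cast; rfl
  have hseq : Tendsto (fun n : ℕ => ((1 + 1 / ((n : ℝ) + 1) : ℝ) : ℂ)) atTop (𝓝[≠] 1) := by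
    refine tendsto_nhdsWithin_iff.2 ⟨?_, Eventually.of_forall fun n => ?_⟩
    · have := (tendsto_one_div_add_atTop_nhds_zero_nat (𝕜 := ℝ)).const_add 1
      rw [add_zero] at this
      simpa [Function.comp_def] using (Complex.continuous_ofReal.tendsto 1).comp this
    · simp only [mem_compl_iff, mem_singleton_iff]
      rw [← Complex.ofReal_one, Complex.ofReal_inj]
      have : 0 < 1 / ((n : ℝ) + 1) := by positivity
      linarith
  exact hseq.frequently (Frequently.of_forall fun n => hreal _ (by positivity))

theorem integral_cexp_neg_mul {a : ℂ} (ha : 0 < a.re) :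
    ∫ t in Ioi (0 : ℝ), Complex.exp (-(a * t)) = a⁻¹ := by
  have := integral_rpow_mul_cexp one_pos ha
  simpa [Complex.cpow_neg_one] using this

/-- A Stieltjes integral for powers. -/
theorem integral_rpow_mul_cpow_add {p q : ℝ} (hp0 : 0 < p) (hp1 : p < 1) (hq : 1 ≤ q)
    {a : ℂ} (ha : 0 < a.re) :
    (Real.Gamma q : ℂ) * ∫ y in Ioi (0 : ℝ), ((y ^ (-p) : ℝ) : ℂ) * (a + y) ^ (-(q : ℂ)) =
      Real.Gamma (1 - p) * Real.Gamma (q + p - 1) * a ^ (-((q + p - 1 : ℝ) : ℂ)) := by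
  have hq0 : 0 < q := by linarith
  -- Euler's integral writes `Γ(q) (a + y)^(-q)` as an integral over `t`. After Fubini the
  -- `y`-integral is again Euler's, with value `Γ(1 - p) t^(p - 1)`, and the `t`-integral is a third
  -- one.
  have hint : Integrable (Function.uncurry fun (y t : ℝ) => ((y ^ (-p) : ℝ) : ℂ) *
      (((t ^ (q - 1) : ℝ) : ℂ) * Complex.exp (-((a + y) * t))))
      ((volume.restrict (Ioi (0 : ℝ))).prod (volume.restrict (Ioi (0 : ℝ)))) := by
    rw [integrable_prod_iff' (by
      refine Measurable.aestronglyMeasurable ?_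
      unfold Function.uncurry
      fun_prop)]
    have hn : ∀ t ∈ Ioi (0 : ℝ), ∀ y ∈ Ioi (0 : ℝ), ‖((y ^ (-p) : ℝ) : ℂ) *
        (((t ^ (q - 1) : ℝ) : ℂ) * Complex.exp (-((a + y) * t)))‖ =
        (t ^ (q - 1) * Real.exp (-(a.re * t))) * (y ^ (-p) * Real.exp (-(t * y))) := by
      intro t ht y hy
      rw [norm_mul, norm_rpow_mul_cexp ht, Complex.norm_real,
        Real.norm_of_nonneg (Real.rpow_nonneg (le_of_lt hy) _)]
      simp only [Complex.add_re, Complex.ofReal_re]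
      rw [add_mul, neg_add, Real.exp_add]
      ring_nf
    constructor
    · refine (ae_restrict_iff' measurableSet_Ioi).2 (Eventually.of_forall fun t ht => ?_)
      refine Integrable.mono' ((integrableOn_rpow_mul_exp (q := -p) (by linarith) ht).const_mul
        (t ^ (q - 1) * Real.exp (-(a.re * t)))) (by
          refine Measurable.aestronglyMeasurable ?_
          unfold Function.uncurry
          fun_prop) ?_
      refine (ae_restrict_iff' measurableSet_Ioi).2 (Eventually.of_forall fun y hy => ?_)
      exact (hn t ht y hy).le
    · have h2 : ∀ t ∈ Ioi (0 : ℝ), Real.Gamma (1 - p) * (t ^ (q + p - 2) * Real.exp (-(a.re * t))) =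
          ∫ y in Ioi (0 : ℝ), ‖Function.uncurry (fun (y t : ℝ) => ((y ^ (-p) : ℝ) : ℂ) *
            (((t ^ (q - 1) : ℝ) : ℂ) * Complex.exp (-((a + y) * t)))) (y, t)‖ := by
        intro t ht
        have ht' : 0 < t := ht
        simp only [Function.uncurry_apply_pair]
        rw [setIntegral_congr_fun measurableSet_Ioi (fun y hy => hn t ht y hy), integral_const_mul]
        have := Real.integral_rpow_mul_exp_neg_mul_Ioi (a := 1 - p) (r := t) (by linarith) ht
        rw [show (1 - p - 1) = -p by ring] at this
        rw [this, one_div, Real.inv_rpow ht'.le, ← Real.rpow_neg ht'.le,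
          show q + p - 2 = (q - 1) + (-(1 - p)) by ring, Real.rpow_add ht']
        ring
      refine Integrable.congr ((integrableOn_rpow_mul_exp (q := q + p - 2) (by linarith)
        ha).const_mul (Real.Gamma (1 - p))) ?_
      exact (ae_restrict_iff' measurableSet_Ioi).2 (Eventually.of_forall h2)
  have hswap := integral_integral_swap hint
  have hL : ∀ y ∈ Ioi (0 : ℝ), ∫ t in Ioi (0 : ℝ), ((y ^ (-p) : ℝ) : ℂ) *
      (((t ^ (q - 1) : ℝ) : ℂ) * Complex.exp (-((a + y) * t))) =
      (Real.Gamma q : ℂ) * (((y ^ (-p) : ℝ) : ℂ) * (a + y) ^ (-(q : ℂ))) := by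
    intro y hy
    have hy' : 0 < y := hy
    rw [integral_const_mul, integral_rpow_mul_cexp hq0 (by simp; linarith)]
    ring
  have hR : ∀ t ∈ Ioi (0 : ℝ), ∫ y in Ioi (0 : ℝ), ((y ^ (-p) : ℝ) : ℂ) *
      (((t ^ (q - 1) : ℝ) : ℂ) * Complex.exp (-((a + y) * t))) =
      (Real.Gamma (1 - p) : ℂ) * (((t ^ (q + p - 1 - 1) : ℝ) : ℂ) * Complex.exp (-(a * t))) := by
    intro t ht
    have ht' : 0 < t := ht
    have h1 := integral_rpow_mul_cexp (q := 1 - p) (a := (t : ℂ)) (by linarith) (by simpa using ht)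
    rw [show (1 - p - 1) = -p by ring] at h1
    have h2 : ∀ y : ℝ, ((y ^ (-p) : ℝ) : ℂ) *
      (((t ^ (q - 1) : ℝ) : ℂ) * Complex.exp (-((a + y) * t))) =
      (((t ^ (q - 1) : ℝ) : ℂ) * Complex.exp (-(a * t))) *
        (((y ^ (-p) : ℝ) : ℂ) * Complex.exp (-((t : ℂ) * y))) := by
      intro y
      rw [show -((a + (y : ℂ)) * t) = -(a * t) + -((t : ℂ) * y) by ring, Complex.exp_add]
      ring
    simp_rw [h2]
    rw [integral_const_mul, h1, show q + p - 1 - 1 = (q - 1) + (-(1 - p)) by ring,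
      Real.rpow_add ht']
    push_cast
    rw [Complex.ofReal_cpow ht'.le (-(1 - p))]
    push_cast
    ring
  rw [setIntegral_congr_fun measurableSet_Ioi hL, setIntegral_congr_fun measurableSet_Ioi hR,
    integral_const_mul, integral_const_mul, integral_rpow_mul_cexp (by linarith) ha] at hswap
  rw [hswap, mul_assoc]

end FracStable

/-! ### Volterra convolutions. -/

namespace FracStable

open MeasureTheory

variable {E : Type*} [NormedAddCommGroup E] [NormedSpace ℝ E]

/-- The Volterra convolution `(a * g)(t) = ∫_0^t a(s) g(t - s) ds`. -/
noncomputable def volt (a : ℝ → ℝ) (g : ℝ → E) (t : ℝ) : E :=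
  ∫ s in (0 : ℝ)..t, a s • g (t - s)

/-- The kernel of the fractional integral of order `q`. -/
noncomputable def ker (q : ℝ) (s : ℝ) : ℝ := s ^ (q - 1) / Real.Gamma q

theorem volt_flip (a : ℝ → ℝ) (g : ℝ → E) (t : ℝ) :
    volt a g t = ∫ s in (0 : ℝ)..t, a (t - s) • g s := by
  have := intervalIntegral.integral_comp_sub_left (fun s => a s • g (t - s)) t (a := 0) (b := t)
  simp only [sub_sub_cancel, sub_zero, sub_self] at this
  rw [volt, this]

theorem volt_comm (a b : ℝ → ℝ) (t : ℝ) : volt a b t = volt b a t := by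
  rw [volt_flip, volt]
  simp only [smul_eq_mul, mul_comm]

theorem volt_one (g : ℝ → E) (t : ℝ) : volt (fun _ => 1) g t = ∫ s in (0 : ℝ)..t, g s := by
  simp [volt_flip]

theorem volt_zero_right (a : ℝ → ℝ) (g : ℝ → E) : volt a g 0 = 0 := by simp [volt]

theorem rlIntegral_eq_volt {n : ℕ} (q : ℝ) (g : ℝ → EuclideanSpace ℝ (Fin n)) (t : ℝ) :
    rlIntegral q g t = volt (ker q) g t := by
  rw [volt_flip, rlIntegral, ← intervalIntegral.integral_smul]
  congr 1; ext s : 1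
  rw [smul_smul, ker]; ring_nf

theorem volt_congr {a : ℝ → ℝ} {g h : ℝ → E} {t : ℝ} (ht : 0 ≤ t)
    (H : ∀ s ∈ Icc 0 t, g s = h s) : volt a g t = volt a h t := by
  rw [volt_flip, volt_flip]
  refine intervalIntegral.integral_congr fun s hs => ?_
  rw [uIcc_of_le ht] at hs
  simp only [H s hs]

theorem volt_congr_left {a b : ℝ → ℝ} {g : ℝ → E} {t : ℝ} (ht : 0 ≤ t)
    (H : ∀ s ∈ Ioc 0 t, a s = b s) : volt a g t = volt b g t := by
  unfold volt
  refine intervalIntegral.integral_congr_ae (Eventually.of_forall fun s hs => ?_)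
  rw [uIoc_of_le ht] at hs
  simp only [H s hs]

theorem intervalIntegrable_ker {q : ℝ} (hq : 0 < q) (T : ℝ) :
    IntervalIntegrable (ker q) volume 0 T :=
  (intervalIntegral.intervalIntegrable_rpow' (by linarith)).div_const _

theorem ker_nonneg {q s : ℝ} (hq : 0 < q) (hs : 0 ≤ s) : 0 ≤ ker q s :=
  div_nonneg (Real.rpow_nonneg hs _) (Real.Gamma_pos_of_pos hq).le

theorem intervalIntegrable_volt {a : ℝ → ℝ} {g : ℝ → E} {t : ℝ} (ht : 0 ≤ t)
    (ha : IntervalIntegrable a volume 0 t) (hg : ContinuousOn g (Icc 0 t)) :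
    IntervalIntegrable (fun s => a s • g (t - s)) volume 0 t := by
  refine ha.smul_continuousOn ?_
  rw [uIcc_of_le ht]
  refine hg.comp (by fun_prop) fun s hs => ⟨by linarith [hs.2], by linarith [hs.1]⟩

theorem volt_add {a : ℝ → ℝ} {g h : ℝ → E} {t : ℝ} (ht : 0 ≤ t)
    (ha : IntervalIntegrable a volume 0 t) (hg : ContinuousOn g (Icc 0 t))
    (hh : ContinuousOn h (Icc 0 t)) :
    volt a (fun s => g s + h s) t = volt a g t + volt a h t := by
  unfold volt
  rw [← intervalIntegral.integral_add (intervalIntegrable_volt ht ha hg)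
    (intervalIntegrable_volt ht ha hh)]
  simp

theorem volt_map [CompleteSpace E] {F : Type*} [NormedAddCommGroup F] [NormedSpace ℝ F]
    [CompleteSpace F] (L : E →L[ℝ] F) {a : ℝ → ℝ} {g : ℝ → E} {t : ℝ} (ht : 0 ≤ t)
    (ha : IntervalIntegrable a volume 0 t) (hg : ContinuousOn g (Icc 0 t)) :
    volt a (fun s => L (g s)) t = L (volt a g t) := by
  unfold volt
  rw [← L.intervalIntegral_comp_comm (intervalIntegrable_volt ht ha hg)]
  simp

theorem norm_volt_le {a : ℝ → ℝ} {g : ℝ → E} {t : ℝ} {b : ℝ → ℝ} (ht : 0 ≤ t)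
    (ha0 : ∀ s ∈ Ioc 0 t, 0 ≤ a s)
    (ha : IntervalIntegrable a volume 0 t) (hb : ContinuousOn b (Icc 0 t))
    (hg : ∀ s ∈ Icc 0 t, ‖g s‖ ≤ b s) : ‖volt a g t‖ ≤ volt a b t := by
  unfold volt
  refine intervalIntegral.norm_integral_le_of_norm_le ht (Eventually.of_forall fun s hs => ?_)
    (intervalIntegrable_volt ht ha hb)
  rw [norm_smul, Real.norm_of_nonneg (ha0 s hs), smul_eq_mul]
  exact mul_le_mul_of_nonneg_left (hg _ ⟨by linarith [hs.2], by linarith [hs.1]⟩) (ha0 s hs)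

/-- Kernels are only locally integrable, so they are truncated to `(0, t)` to become integrable on
the line; up to time `t` the truncation is invisible. -/
theorem convolution_indicator_eq_volt (a : ℝ → ℝ) (g : ℝ → E) {t r : ℝ} (hr : 0 < r)
    (hrt : r ≤ t) :
    convolution (indicator (Ioo 0 t) a) (indicator (Ioo 0 t) g)
      (ContinuousLinearMap.lsmul ℝ ℝ) volume r = volt a g r := by
  rw [convolution_def, volt, intervalIntegral.integral_of_le hr.le, integral_Ioc_eq_integral_Ioo,
    ← integral_indicator measurableSet_Ioo]
  congr 1; ext s
  simp only [ContinuousLinearMap.lsmul_apply]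
  by_cases hs : s ∈ Ioo 0 r
  · rw [indicator_of_mem hs, indicator_of_mem (show s ∈ Ioo 0 t from ⟨hs.1, hs.2.trans_le hrt⟩),
      indicator_of_mem (show r - s ∈ Ioo 0 t from ⟨by linarith [hs.2], by linarith [hs.1]⟩)]
  · rw [indicator_of_notMem hs]
    by_cases h0 : 0 < s
    · have : r - s ∉ Ioo 0 t := fun h => hs ⟨h0, by linarith [h.1]⟩
      rw [indicator_of_notMem this, smul_zero]
    · have : s ∉ Ioo 0 t := fun h => h0 h.1
      rw [indicator_of_notMem this, zero_smul]

/-- Associativity of convolution on the line, evaluated at `t` for the truncated functions. -/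
theorem volt_volt [CompleteSpace E] {a b : ℝ → ℝ} {g : ℝ → E} {t : ℝ} (ht : 0 < t)
    (ha : IntervalIntegrable a volume 0 t) (hb : IntervalIntegrable b volume 0 t)
    (hg : ContinuousOn g (Icc 0 t)) : volt a (volt b g) t = volt (volt a b) g t := by
  set A := indicator (Ioo 0 t) a with hA
  set B := indicator (Ioo 0 t) b with hB
  set G := indicator (Ioo 0 t) g with hG
  have iA : Integrable A := (integrable_indicator_iff measurableSet_Ioo).2
    (((intervalIntegrable_iff_integrableOn_Ioc_of_le ht.le).1 ha).mono_set Ioo_subset_Ioc_self)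
  have iB : Integrable B := (integrable_indicator_iff measurableSet_Ioo).2
    (((intervalIntegrable_iff_integrableOn_Ioc_of_le ht.le).1 hb).mono_set Ioo_subset_Ioc_self)
  have iG : Integrable G := (integrable_indicator_iff measurableSet_Ioo).2
    ((hg.integrableOn_Icc).mono_set Ioo_subset_Icc_self)
  obtain ⟨C, hC⟩ := isCompact_Icc.exists_bound_of_continuousOn hg
  have hC0 : 0 ≤ C := (norm_nonneg _).trans (hC 0 ⟨le_rfl, ht.le⟩)
  have bG : ∀ x, ‖G x‖ ≤ C := by
    intro x
    by_cases hx : x ∈ Ioo 0 t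
    · rw [hG, indicator_of_mem hx]; exact hC x (Ioo_subset_Icc_self hx)
    · rw [hG, indicator_of_notMem hx]; simpa using hC0
  have hassoc := convolution_assoc (f := A) (g := B) (k := G) (μ := volume) (ν := volume)
    (ContinuousLinearMap.lsmul ℝ ℝ) (ContinuousLinearMap.lsmul ℝ ℝ) (ContinuousLinearMap.lsmul ℝ ℝ)
    (ContinuousLinearMap.lsmul ℝ ℝ) (by intro x y z; simp only [ContinuousLinearMap.lsmul_apply, smul_eq_mul, mul_smul]) (x₀ := t)
    iA.aestronglyMeasurable iB.aestronglyMeasurable iG.aestronglyMeasurable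
    (Integrable.ae_convolution_exists _ iA iB)
    (Integrable.ae_convolution_exists _ iB.norm iG.norm)
    -- The triple convolution has to exist at the point `t` itself, not just almost everywhere. It
    -- does because `|B| * |G|` is bounded: `G` is bounded and `B` integrable.
    (by
      have hi : Integrable (convolution (fun x => ‖B x‖) (fun x => ‖G x‖)
        (ContinuousLinearMap.mul ℝ ℝ) volume) := Integrable.integrable_convolution _ iB.norm iG.norm
      refine BddAbove.convolutionExistsAt _ (s := univ) ⟨C * ∫ x, ‖B x‖, ?_⟩ MeasurableSet.univ
        (subset_univ _) iA.norm.integrableOn hi.aestronglyMeasurable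
      rintro _ ⟨x, -, rfl⟩
      simp only
      rw [convolution_def, ← integral_const_mul]
      refine norm_integral_le_of_norm_le (iB.norm.const_mul C) (Eventually.of_forall fun s => ?_)
      simp only [ContinuousLinearMap.mul_apply', norm_mul, norm_norm]
      rw [mul_comm]
      exact mul_le_mul_of_nonneg_right (bG _) (norm_nonneg _))
  have hAB : ∀ r, 0 < r → r ≤ t → convolution A B (ContinuousLinearMap.lsmul ℝ ℝ) volume r =
      volt a b r := fun r h0 h1 => convolution_indicator_eq_volt a b h0 h1
  have hBG : ∀ r, 0 < r → r ≤ t → convolution B G (ContinuousLinearMap.lsmul ℝ ℝ) volume r =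
      volt b g r := fun r h0 h1 => convolution_indicator_eq_volt b g h0 h1
  have key : ∀ (f : ℝ → ℝ) (h : ℝ → E), volt f h t = ∫ s, (Ioo 0 t).indicator (fun s =>
      f s • h (t - s)) s := by
    intro f h
    rw [volt, intervalIntegral.integral_of_le ht.le, integral_Ioc_eq_integral_Ioo,
      ← integral_indicator measurableSet_Ioo]
  rw [convolution_def, convolution_def] at hassoc
  rw [key, key]
  refine Eq.trans ?_ (hassoc.symm.trans ?_)
  · congr 1; ext s
    by_cases hs : s ∈ Ioo 0 t
    · rw [indicator_of_mem hs, hA, indicator_of_mem hs, hBG _ (by linarith [hs.2])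
        (by linarith [hs.1])]
      rfl
    · rw [indicator_of_notMem hs, hA, indicator_of_notMem hs]
      simp
  · congr 1; ext s
    by_cases hs : s ∈ Ioo 0 t
    · have hs' : t - s ∈ Ioo 0 t := ⟨by linarith [hs.2], by linarith [hs.1]⟩
      rw [indicator_of_mem hs, hG, indicator_of_mem hs', hAB _ hs.1 hs.2.le]
      rfl
    · have hs' : t - s ∉ Ioo 0 t := fun h => hs ⟨by linarith [h.2], by linarith [h.1]⟩
      rw [indicator_of_notMem hs, hG, indicator_of_notMem hs']
      simp

end FracStable

/-! ### The Beta weight, inversion of fractional integrals, uniqueness. -/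

namespace FracStable

open MeasureTheory

variable {E : Type*} [NormedAddCommGroup E] [NormedSpace ℝ E]

/-- The density of the Beta distribution with parameters `p` and `1 - p`. -/
noncomputable def betaWeight (p θ : ℝ) : ℝ :=
  (1 - θ) ^ (-p) * θ ^ (p - 1) / (Real.Gamma p * Real.Gamma (1 - p))

theorem betaWeight_nonneg {p θ : ℝ} (hp0 : 0 < p) (hp1 : p < 1) (h0 : 0 ≤ θ) (h1 : θ ≤ 1) :
    0 ≤ betaWeight p θ :=
  div_nonneg (mul_nonneg (Real.rpow_nonneg (by linarith) _) (Real.rpow_nonneg h0 _))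
    (mul_pos (Real.Gamma_pos_of_pos hp0) (Real.Gamma_pos_of_pos (by linarith))).le

theorem ofReal_betaWeight {p θ : ℝ} (h0 : 0 ≤ θ) (h1 : θ ≤ 1) :
    ((betaWeight p θ : ℝ) : ℂ) = ((θ : ℂ) ^ ((p : ℂ) - 1) * (1 - (θ : ℂ)) ^ ((1 - p : ℂ) - 1)) /
      (Real.Gamma p * Real.Gamma (1 - p)) := by
  rw [betaWeight]
  push_cast
  rw [Complex.ofReal_cpow h0, Complex.ofReal_cpow (by linarith : 0 ≤ 1 - θ)]
  push_cast
  rw [show (1 - (p : ℂ) - 1) = -p by ring]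
  ring

theorem intervalIntegrable_betaWeight {p : ℝ} (hp0 : 0 < p) (hp1 : p < 1) :
    IntervalIntegrable (betaWeight p) volume 0 1 := by
  have h := (Complex.betaIntegral_convergent (u := p) (v := 1 - p) (by simpa using hp0)
    (by simpa using hp1)).div_const ((Real.Gamma p * Real.Gamma (1 - p) : ℝ) : ℂ)
  have h2 := h.norm
  refine h2.congr fun θ hθ => ?_
  rw [uIoc_of_le zero_le_one] at hθ
  have := ofReal_betaWeight (p := p) hθ.1.le hθ.2
  push_cast
  rw [← this, Complex.norm_real, Real.norm_of_nonneg (betaWeight_nonneg hp0 hp1 hθ.1.le hθ.2)]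

theorem integral_betaWeight {p : ℝ} (hp0 : 0 < p) (hp1 : p < 1) :
    ∫ θ in (0 : ℝ)..1, betaWeight p θ = 1 := by
  have h := Complex.Gamma_mul_Gamma_eq_betaIntegral (s := p) (t := 1 - p) (by simpa using hp0)
    (by simpa using hp1)
  rw [show (p : ℂ) + (1 - p) = 1 by ring, Complex.Gamma_one, one_mul, Complex.betaIntegral] at h
  have hne : (Real.Gamma p * Real.Gamma (1 - p) : ℂ) ≠ 0 := by
    rw [← Complex.ofReal_mul]
    exact_mod_cast (mul_pos (Real.Gamma_pos_of_pos hp0) (Real.Gamma_pos_of_pos (by linarith))).ne'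
  have h2 : ((∫ θ in (0 : ℝ)..1, betaWeight p θ : ℝ) : ℂ) = 1 := by
    rw [← intervalIntegral.integral_ofReal]
    rw [intervalIntegral.integral_congr (g := fun θ : ℝ => ((θ : ℂ) ^ ((p : ℂ) - 1) *
      (1 - (θ : ℂ)) ^ ((1 - p : ℂ) - 1)) / (Real.Gamma p * Real.Gamma (1 - p)))]
    · rw [intervalIntegral.integral_div, ← h, Complex.Gamma_ofReal,
        show (1 - (p : ℂ)) = ((1 - p : ℝ) : ℂ) by push_cast; ring, Complex.Gamma_ofReal]
      exact div_self hne
    · intro θ hθ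
      rw [uIcc_of_le zero_le_one] at hθ
      exact ofReal_betaWeight hθ.1 hθ.2
  exact_mod_cast h2

/-- Substitute `s = t θ`: the powers of `t` cancel because the two orders add up to `1`. The choice
`h = 1` gives `I^(1-p) I^p = I^1`; the choice `h s = e^(-s)` gives the kernel of `I^(1-p) (1 +
D)^(-p)`. -/
theorem volt_ker_ker_mul {p : ℝ} (h : ℝ → ℝ) {t : ℝ} (ht : 0 < t) :
    volt (ker (1 - p)) (fun s => ker p s * h s) t =
      ∫ θ in (0 : ℝ)..1, betaWeight p θ * h (t * θ) := by
  have hsub := intervalIntegral.smul_integral_comp_mul_left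
    (fun s => ker (1 - p) (t - s) * (ker p s * h s)) t (a := 0) (b := 1)
  rw [mul_zero, mul_one] at hsub
  rw [volt_flip]
  simp only [smul_eq_mul]
  rw [← hsub, smul_eq_mul, ← intervalIntegral.integral_const_mul]
  refine intervalIntegral.integral_congr fun θ hθ => ?_
  rw [uIcc_of_le zero_le_one] at hθ
  simp only [ker, betaWeight]
  rw [show t - t * θ = t * (1 - θ) by ring, Real.mul_rpow ht.le (by linarith [hθ.2]),
    Real.mul_rpow ht.le hθ.1, show (1 - p - 1) = -p by ring, show t ^ (p - 1) = t ^ p / t by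
      rw [Real.rpow_sub_one ht.ne'], Real.rpow_neg ht.le]
  have : t ^ p ≠ 0 := (Real.rpow_pos_of_pos ht p).ne'
  field_simp

theorem volt_ker_ker {p : ℝ} (hp0 : 0 < p) (hp1 : p < 1) {t : ℝ} (ht : 0 < t) :
    volt (ker (1 - p)) (ker p) t = 1 := by
  have := volt_ker_ker_mul (p := p) (fun _ => 1) ht
  simpa [integral_betaWeight hp0 hp1] using this

theorem continuousOn_volt [CompleteSpace E] {a : ℝ → ℝ} {g : ℝ → E} {T : ℝ}
    (ha : IntervalIntegrable a volume 0 T) (hg : ContinuousOn g (Icc 0 T)) :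
    ContinuousOn (volt a g) (Icc 0 T) := by
  rcases lt_or_ge T 0 with hT | hT
  · rw [Icc_eq_empty (by linarith)]; exact continuousOn_empty _
  -- `G` vanishes for negative arguments, so the integral of `a s • G (t - s)` may run over the
  -- fixed interval `[0, T]`, where dominated convergence applies. The subtracted constant
  -- contributes only a primitive of `a`.
  set G : ℝ → E := fun u => g (max 0 (min u T)) - g 0 with hG
  have hmaps : ∀ u : ℝ, max 0 (min u T) ∈ Icc 0 T := fun u =>
    ⟨le_max_left _ _, max_le hT (min_le_right _ _)⟩
  have hGc : Continuous G := by
    refine Continuous.sub ?_ continuous_const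
    exact hg.comp_continuous (by fun_prop) hmaps
  obtain ⟨C, hC⟩ := isCompact_Icc.exists_bound_of_continuousOn hg
  have hGb : ∀ u, ‖G u‖ ≤ C + C := fun u => (norm_sub_le _ _).trans
    (add_le_add (hC _ (hmaps u)) (hC 0 ⟨le_rfl, hT⟩))
  have h1 : Continuous fun t => ∫ s in (0 : ℝ)..T, a s • G (t - s) := by
    refine intervalIntegral.continuous_of_dominated_interval (bound := fun s => ‖a s‖ * (C + C))
      (fun t => ?_) (fun t => Eventually.of_forall fun s _ => ?_) (ha.norm.mul_const _)
      (Eventually.of_forall fun s _ => ?_)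
    · exact ha.def'.aestronglyMeasurable.smul
        ((by fun_prop : Continuous fun s => G (t - s)).aestronglyMeasurable)
    · rw [norm_smul]; gcongr; exact hGb _
    · fun_prop
  have h2 : ContinuousOn (fun t => (∫ s in (0 : ℝ)..t, a s) • g 0) (Icc 0 T) := by
    have := intervalIntegral.continuousOn_primitive_interval' ha left_mem_uIcc
    rw [uIcc_of_le hT] at this
    exact this.smul continuousOn_const
  refine (h1.continuousOn.add h2).congr fun t ht => ?_
  have hsub1 : uIcc 0 t ⊆ uIcc 0 T := by
    rw [uIcc_of_le ht.1, uIcc_of_le hT]; exact Icc_subset_Icc_right ht.2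
  have hsub2 : uIcc t T ⊆ uIcc 0 T := by
    rw [uIcc_of_le ht.2, uIcc_of_le hT]; exact Icc_subset_Icc_left ht.1
  have hi : IntervalIntegrable (fun s => a s • G (t - s)) volume 0 T :=
    ha.smul_continuousOn (by fun_prop)
  have ha' := ha.mono_set hsub1
  have e1 : ∫ s in t..T, a s • G (t - s) = 0 := by
    refine intervalIntegral.integral_zero_ae (Eventually.of_forall fun s hs => ?_)
    rw [uIoc_of_le ht.2] at hs
    have : max 0 (min (t - s) T) = 0 :=
      max_eq_left ((min_le_left _ _).trans (by linarith [hs.1]))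
    simp [hG, this]
  rw [Pi.add_apply]
  rw [← intervalIntegral.integral_add_adjacent_intervals (hi.mono_set hsub1) (hi.mono_set hsub2),
    e1, add_zero, ← intervalIntegral.integral_smul_const,
    ← intervalIntegral.integral_add (hi.mono_set hsub1) (ha'.smul_continuousOn continuousOn_const), volt]
  refine intervalIntegral.integral_congr fun s hs => ?_
  rw [uIcc_of_le ht.1] at hs
  have : max 0 (min (t - s) T) = t - s := by
    rw [min_eq_left (by linarith [hs.1, ht.2]), max_eq_right (by linarith [hs.2])]
  simp only [hG, this, ← smul_add, sub_add_cancel]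

theorem eq_of_integral_eq [CompleteSpace E] {f g : ℝ → E} {b : ℝ} (hf : ContinuousOn f (Icc 0 b))
    (hg : ContinuousOn g (Icc 0 b))
    (h : ∀ t ∈ Ioo 0 b, ∫ s in (0 : ℝ)..t, f s = ∫ s in (0 : ℝ)..t, g s) {t : ℝ}
    (ht : t ∈ Ioo 0 b) : f t = g t := by
  have key : ∀ {k : ℝ → E}, ContinuousOn k (Icc 0 b) →
      HasDerivAt (fun u => ∫ s in (0 : ℝ)..u, k s) (k t) t := by
    intro k hk
    refine intervalIntegral.integral_hasDerivAt_right
      ((hk.mono (by rw [uIcc_of_le ht.1.le]; exact Icc_subset_Icc_right ht.2.le)).intervalIntegrable)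
      ?_ ((hk t (Ioo_subset_Icc_self ht)).continuousAt (Icc_mem_nhds ht.1 ht.2))
    exact (hk.mono Ioo_subset_Icc_self).stronglyMeasurableAtFilter isOpen_Ioo t ht
  refine (key hf).unique ((key hg).congr_of_eventuallyEq ?_)
  filter_upwards [isOpen_Ioo.mem_nhds ht] with u hu using h u hu

/-- Inversion of the fractional derivative: a function whose Riemann-Liouville integral of
order `1 - p` is a primitive of `φ` is the integral of order `p` of `φ`. -/
theorem eq_volt_of_hasDerivAt [CompleteSpace E] {p : ℝ} (hp0 : 0 < p) (hp1 : p < 1) {z φ : ℝ → E}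
    {b : ℝ} (hz : ContinuousOn z (Icc 0 b)) (hφ : ContinuousOn φ (Icc 0 b))
    (hd : ∀ t ∈ Ioo 0 b, HasDerivAt (volt (ker (1 - p)) z) (φ t) t) {t : ℝ} (ht : t ∈ Ioo 0 b) :
    z t = volt (ker p) φ t := by
  have hp' : 0 < 1 - p := by linarith
  have hk1 := intervalIntegrable_ker hp'
  have hk := intervalIntegrable_ker hp0
  have h1 : ∀ t ∈ Ioo 0 b, volt (ker (1 - p)) z t = volt (fun _ => 1) φ t := by
    intro t ht
    have hsub : Icc 0 t ⊆ Icc 0 b := Icc_subset_Icc_right ht.2.le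
    have := intervalIntegral.integral_eq_sub_of_hasDerivAt_of_le ht.1.le
      (continuousOn_volt (hk1 t) (hz.mono hsub))
      (fun s hs => hd s ⟨hs.1, hs.2.trans ht.2⟩)
      ((hφ.mono (by rw [uIcc_of_le ht.1.le]; exact hsub)).intervalIntegrable)
    rw [volt_one, this, volt_zero_right, sub_zero]
  -- It suffices to compare primitives: `1 * z = k_p * (k_(1-p) * z) = k_p * (1 * φ) = 1 * (k_p *
  -- φ)`, where `k_q` is `ker q`.
  refine eq_of_integral_eq hz (continuousOn_volt (hk b) hφ) (fun t ht => ?_) ht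
  have hsub : Icc 0 t ⊆ Icc 0 b := Icc_subset_Icc_right ht.2.le
  have hc1 : IntervalIntegrable (fun _ : ℝ => (1 : ℝ)) volume 0 t := intervalIntegrable_const
  calc ∫ s in (0 : ℝ)..t, z s = volt (fun _ => 1) z t := (volt_one _ _).symm
    _ = volt (volt (ker p) (ker (1 - p))) z t := volt_congr_left ht.1.le fun s hs => by
        rw [volt_comm, volt_ker_ker hp0 hp1 hs.1]
    _ = volt (ker p) (volt (ker (1 - p)) z) t := (volt_volt ht.1 (hk t) (hk1 t) (hz.mono hsub)).symm
    _ = volt (ker p) (volt (fun _ => 1) φ) t := volt_congr ht.1.le fun s hs => by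
        rcases hs.1.eq_or_lt with h0 | h0
        · rw [← h0, volt_zero_right, volt_zero_right]
        · exact h1 s ⟨h0, hs.2.trans_lt ht.2⟩
    _ = volt (volt (ker p) (fun _ => 1)) φ t := volt_volt ht.1 (hk t) hc1 (hφ.mono hsub)
    _ = volt (volt (fun _ => 1) (ker p)) φ t := volt_congr_left ht.1.le fun s _ => volt_comm _ _ _
    _ = volt (fun _ => 1) (volt (ker p) φ) t := (volt_volt ht.1 hc1 (hk t) (hφ.mono hsub)).symm
    _ = _ := volt_one _ _

theorem integral_ker_mul_exp {p c : ℝ} (hp0 : 0 < p) (hc : 0 < c) :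
    ∫ s in Ioi (0 : ℝ), ker p s * Real.exp (-(c * s)) = c ^ (-p) := by
  have := Real.integral_rpow_mul_exp_neg_mul_Ioi hp0 hc
  simp only [ker, div_mul_eq_mul_div]
  rw [integral_div, this, one_div, Real.inv_rpow hc.le, ← Real.rpow_neg hc.le,
    mul_div_assoc, div_self (Real.Gamma_pos_of_pos hp0).ne', mul_one]

theorem integrableOn_ker_mul_exp {p c : ℝ} (hp0 : 0 < p) (hc : 0 < c) :
    IntegrableOn (fun s => ker p s * Real.exp (-(c * s))) (Ioi 0) := by
  simp only [ker, div_mul_eq_mul_div]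
  exact (integrableOn_rpow_mul_exp (by linarith) hc).div_const _

/-- After factoring out `e^(ct)`, what remains is a truncated Laplace transform of the kernel. Since
`c^(-p)` is small for large `c`, the fractional integral is a contraction in a weighted sup norm. -/
theorem volt_ker_exp_le {p c : ℝ} (hp0 : 0 < p) (hc : 0 < c) {t : ℝ} (ht : 0 ≤ t) :
    volt (ker p) (fun s => Real.exp (c * s)) t ≤ c ^ (-p) * Real.exp (c * t) := by
  have h1 : volt (ker p) (fun s => Real.exp (c * s)) t =
      (∫ s in Ioc 0 t, ker p s * Real.exp (-(c * s))) * Real.exp (c * t) := by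
    rw [volt, intervalIntegral.integral_of_le ht, ← integral_mul_const]
    congr 1; ext s
    rw [smul_eq_mul, mul_sub, sub_eq_neg_add, Real.exp_add]; ring
  rw [h1, ← integral_ker_mul_exp hp0 hc]
  refine mul_le_mul_of_nonneg_right ?_ (Real.exp_pos _).le
  refine setIntegral_mono_set (integrableOn_ker_mul_exp hp0 hc) ?_
    (Eventually.of_forall Ioc_subset_Ioi_self)
  refine (ae_restrict_iff' measurableSet_Ioi).2 (Eventually.of_forall fun s hs => ?_)
  exact mul_nonneg (ker_nonneg hp0 (le_of_lt hs)) (Real.exp_pos _).le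

/-- Uniqueness for fractional differential inequalities. -/
theorem eq_zero_of_hasDerivAt_volt [CompleteSpace E] {p : ℝ} (hp0 : 0 < p) (hp1 : p < 1)
    {z φ : ℝ → E} {b L : ℝ} (hL : 0 ≤ L) (hz0 : z 0 = 0) (hz : ContinuousOn z (Icc 0 b))
    (hφ : ContinuousOn φ (Icc 0 b))
    (hd : ∀ t ∈ Ioo 0 b, HasDerivAt (volt (ker (1 - p)) z) (φ t) t)
    (hb : ∀ t ∈ Ico 0 b, ‖φ t‖ ≤ L * ‖z t‖) {t : ℝ} (ht : t ∈ Ico 0 b) : z t = 0 := by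
  -- With this weight `L c^(-p) = L / (L + 1) < 1`. The maximum `Z` of `e^(-cs) ‖z s‖` then
  -- satisfies `Z ≤ L / (L + 1) * Z`, hence vanishes.
  set c : ℝ := (L + 1) ^ (1 / p) with hc
  have hc0 : 0 < c := Real.rpow_pos_of_pos (by linarith) _
  have hcp : c ^ (-p) = (L + 1)⁻¹ := by
    rw [hc, ← Real.rpow_mul (by linarith), ← Real.rpow_neg_one]
    congr 1; field_simp
  have hsub : Icc 0 t ⊆ Icc 0 b := Icc_subset_Icc_right ht.2.le
  have hcont : ContinuousOn (fun s => Real.exp (-(c * s)) * ‖z s‖) (Icc 0 t) :=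
    ContinuousOn.mul (by fun_prop) (hz.mono hsub).norm
  obtain ⟨m, hm, hmax⟩ := isCompact_Icc.exists_isMaxOn ⟨0, le_rfl, ht.1⟩ hcont
  set Z := Real.exp (-(c * m)) * ‖z m‖ with hZ
  have hle : ∀ s ∈ Icc 0 t, ‖z s‖ ≤ Z * Real.exp (c * s) := by
    intro s hs
    have h1 : Real.exp (-(c * s)) * ‖z s‖ ≤ Z := hmax hs
    have h2 : Real.exp (c * s) * Real.exp (-(c * s)) = 1 := by rw [← Real.exp_add]; simp
    calc ‖z s‖ = (Real.exp (c * s) * Real.exp (-(c * s))) * ‖z s‖ := by rw [h2, one_mul]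
      _ = Real.exp (-(c * s)) * ‖z s‖ * Real.exp (c * s) := by ring
      _ ≤ _ := mul_le_mul_of_nonneg_right h1 (Real.exp_pos _).le
  have hZ0 : 0 ≤ Z := mul_nonneg (Real.exp_pos _).le (norm_nonneg _)
  have hZle : Z ≤ L * (L + 1)⁻¹ * Z := by
    rcases hm.1.eq_or_lt with h0 | h0
    · have : Z = 0 := by rw [hZ, ← h0, hz0]; simp
      rw [this]; simp
    · have hmb : m < b := hm.2.trans_lt ht.2
      have hsubm : Icc 0 m ⊆ Icc 0 b := Icc_subset_Icc_right hmb.le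
      have e1 := eq_volt_of_hasDerivAt hp0 hp1 hz hφ hd ⟨h0, hmb⟩
      have e2 : ‖z m‖ ≤ volt (ker p) (fun s => L * Z * Real.exp (c * s)) m := by
        rw [e1]
        refine norm_volt_le hm.1 (fun s hs => ker_nonneg hp0 hs.1.le) (intervalIntegrable_ker hp0 m)
          (by fun_prop) fun s hs => ?_
        refine (hb s ⟨hs.1, hs.2.trans_lt hmb⟩).trans ?_
        rw [mul_assoc]
        exact mul_le_mul_of_nonneg_left (hle s ⟨hs.1, hs.2.trans hm.2⟩) hL
      have e3 : volt (ker p) (fun s => L * Z * Real.exp (c * s)) m =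
          L * Z * volt (ker p) (fun s => Real.exp (c * s)) m := by
        unfold volt
        rw [← intervalIntegral.integral_const_mul]
        congr 1; ext s; simp only [smul_eq_mul]; ring
      have e4 := volt_ker_exp_le hp0 hc0 hm.1
      rw [e3] at e2
      have e5 : ‖z m‖ ≤ L * Z * ((L + 1)⁻¹ * Real.exp (c * m)) := by
        rw [hcp] at e4
        exact e2.trans (mul_le_mul_of_nonneg_left e4 (mul_nonneg hL hZ0))
      have h2 : Real.exp (-(c * m)) * Real.exp (c * m) = 1 := by rw [← Real.exp_add]; simp
      calc Z ≤ Real.exp (-(c * m)) * (L * Z * ((L + 1)⁻¹ * Real.exp (c * m))) :=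
            mul_le_mul_of_nonneg_left e5 (Real.exp_pos _).le
        _ = L * (L + 1)⁻¹ * Z * (Real.exp (-(c * m)) * Real.exp (c * m)) := by ring
        _ = _ := by rw [h2, mul_one]
  have hlt : L * (L + 1)⁻¹ < 1 := by
    rw [← div_eq_mul_inv, div_lt_one (by linarith)]; linarith
  have hZ1 : Z = 0 := by nlinarith
  have := hle t ⟨ht.1, le_rfl⟩
  rw [hZ1, zero_mul] at this
  exact norm_le_zero_iff.1 this

end FracStable

/-! ### Laplace transform and absence of bounded unstable solutions. -/

namespace FracStable

open MeasureTheory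

/-- Take `w = exp (log μ / p)`: dividing the argument by `p` keeps it below `π / 2`, so `w` lies in
the right half-plane and no branch is crossed. This is the only zero of `s^p - μ` there. -/
theorem exists_cpow_eq {p : ℝ} (hp0 : 0 < p) {μ : ℂ} (hμ0 : μ ≠ 0)
    (hμ : |μ.arg| < p * Real.pi / 2) : ∃ w : ℂ, 0 < w.re ∧ w ^ (p : ℂ) = μ := by
  have hπ := Real.pi_pos
  have harg : |μ.arg / p| < Real.pi / 2 := by
    rw [abs_div, abs_of_pos hp0, div_lt_iff₀ hp0]; linarith
  have him : (Complex.log μ / p).im = μ.arg / p := by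
    rw [Complex.div_ofReal_im, Complex.log_im]
  refine ⟨Complex.exp (Complex.log μ / p), ?_, ?_⟩
  · rw [Complex.exp_re, him]
    exact mul_pos (Real.exp_pos _) (Real.cos_pos_of_mem_Ioo (abs_lt.1 harg))
  · rw [Complex.cpow_def_of_ne_zero (Complex.exp_ne_zero _), Complex.log_exp]
    · rw [div_mul_cancel₀ _ (by exact_mod_cast hp0.ne'), Complex.exp_log hμ0]
    · rw [him]; linarith [(abs_lt.1 harg).1]
    · rw [him]; linarith [(abs_lt.1 harg).2]

theorem norm_cexp_neg_mul (w : ℂ) (t : ℝ) : ‖Complex.exp (-(w * t))‖ = Real.exp (-(w.re * t)) := by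
  rw [Complex.norm_exp]; simp

variable {E : Type*} [NormedAddCommGroup E] [NormedSpace ℂ E]

theorem integrableOn_exp_neg_mul {r : ℝ} (hr : 0 < r) :
    IntegrableOn (fun t : ℝ => Real.exp (-(r * t))) (Ioi 0) := by
  simpa using integrableOn_rpow_mul_exp (q := 0) (by norm_num) hr

theorem integrableOn_cexp_smul {w : ℂ} (hw : 0 < w.re) {y : ℝ → E} {C : ℝ}
    (hy : ContinuousOn y (Ici 0)) (hC : ∀ t, 0 ≤ t → ‖y t‖ ≤ C) :
    IntegrableOn (fun t : ℝ => Complex.exp (-(w * t)) • y t) (Ioi 0) := by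
  refine Integrable.mono' ((integrableOn_exp_neg_mul hw).mul_const C) ?_ ?_
  · refine ContinuousOn.aestronglyMeasurable ?_ measurableSet_Ioi
    exact ContinuousOn.smul (by fun_prop) (hy.mono Ioi_subset_Ici_self)
  · refine (ae_restrict_iff' measurableSet_Ioi).2 (Eventually.of_forall fun t ht => ?_)
    rw [norm_smul, norm_cexp_neg_mul]
    exact mul_le_mul_of_nonneg_left (hC t (le_of_lt ht)) (Real.exp_pos _).le

/-- The Laplace transform turns convolution into multiplication, and the transform of `ker p` at `w`
is `w^(-p)`. -/
theorem integral_cexp_smul_volt [CompleteSpace E] {p : ℝ} (hp0 : 0 < p) {w : ℂ} (hw : 0 < w.re)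
    {y : ℝ → E} {C : ℝ} (hy : ContinuousOn y (Ici 0)) (hC : ∀ t, 0 ≤ t → ‖y t‖ ≤ C) :
    ∫ t in Ioi (0 : ℝ), Complex.exp (-(w * t)) • volt (ker p) y t =
      w ^ (-(p : ℂ)) • ∫ t in Ioi (0 : ℝ), Complex.exp (-(w * t)) • y t := by
  have hf : IntegrableOn (fun t : ℝ => ((ker p t : ℝ) : ℂ) * Complex.exp (-(w * t))) (Ioi 0) := by
    have := (integrableOn_rpow_mul_cexp (q := p - 1) (by linarith) hw).div_const (Real.Gamma p : ℂ)
    refine this.congr (Eventually.of_forall fun t => ?_)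
    simp only [ker]; push_cast; ring
  have hfi : ∫ t in Ioi (0 : ℝ), ((ker p t : ℝ) : ℂ) * Complex.exp (-(w * t)) =
      w ^ (-(p : ℂ)) := by
    have := integral_rpow_mul_cexp hp0 hw
    have hne : (Real.Gamma p : ℂ) ≠ 0 := by exact_mod_cast (Real.Gamma_pos_of_pos hp0).ne'
    have h2 : ∀ t : ℝ, ((ker p t : ℝ) : ℂ) * Complex.exp (-(w * t)) =
        (((t ^ (p - 1) : ℝ) : ℂ) * Complex.exp (-(w * t))) / Real.Gamma p := by
      intro t; simp only [ker]; push_cast; ring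
    simp_rw [h2]
    rw [integral_div, this, mul_div_cancel_left₀ _ hne]
  have := integral_posConvolution hf (integrableOn_cexp_smul hw hy hC)
    (ContinuousLinearMap.lsmul ℝ ℂ)
  simp only [ContinuousLinearMap.lsmul_apply] at this
  rw [hfi] at this
  rw [← this]
  congr 1; ext t
  rw [volt, ← intervalIntegral.integral_smul]
  congr 1; ext s
  rw [smul_smul, mul_assoc, ← Complex.exp_add, ← Complex.coe_smul, smul_smul]
  congr 1
  push_cast
  rw [mul_comm]
  congr 2
  ring

/-- The scalar equation `D^p y = μ y` with `|arg μ| < p π / 2` has no bounded nonzero solution. -/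
theorem eq_zero_of_bounded [CompleteSpace E] {p : ℝ} (hp0 : 0 < p) (hp1 : p < 1) {μ : ℂ}
    (hμ0 : μ ≠ 0) (hμ : |μ.arg| < p * Real.pi / 2) {y : ℝ → E} {C : ℝ}
    (hy : ContinuousOn y (Ici 0)) (hC : ∀ t, 0 ≤ t → ‖y t‖ ≤ C)
    (hd : ∀ t, 0 < t → HasDerivAt (volt (ker (1 - p)) (fun s => y s - y 0)) (μ • y t) t) :
    y 0 = 0 := by
  obtain ⟨w, hw, hwμ⟩ := exists_cpow_eq hp0 hμ0 hμ
  have hw0 : w ≠ 0 := by rintro rfl; simp at hw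
  have hμy : ContinuousOn (fun t => μ • y t) (Ici 0) := hy.const_smul μ
  have h1 : ∀ t ∈ Ioi (0 : ℝ), y t - y 0 = volt (ker p) (fun s => μ • y s) t := by
    intro t ht
    have ht : 0 < t := ht
    exact eq_volt_of_hasDerivAt hp0 hp1 (z := fun s => y s - y 0) (b := t + 1)
      ((hy.mono Icc_subset_Ici_self).sub continuousOn_const)
      (hμy.mono Icc_subset_Ici_self) (fun s hs => hd s hs.1) ⟨ht, by linarith⟩
  set Y := ∫ t in Ioi (0 : ℝ), Complex.exp (-(w * t)) • y t with hY
  have hI := integral_cexp_smul_volt hp0 hw (y := fun s => μ • y s) (C := ‖μ‖ * C) hμy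
    (fun t ht => by rw [norm_smul]; exact mul_le_mul_of_nonneg_left (hC t ht) (norm_nonneg _))
  have hJ : ∫ t in Ioi (0 : ℝ), Complex.exp (-(w * t)) • (μ • y t) = μ • Y := by
    rw [hY, ← integral_smul]
    congr 1; ext t; rw [smul_comm]
  have hL : ∫ t in Ioi (0 : ℝ), Complex.exp (-(w * t)) • volt (ker p) (fun s => μ • y s) t =
      Y - w⁻¹ • y 0 := by
    have hc := integrableOn_cexp_smul hw (y := fun _ => y 0) continuousOn_const
      (fun t _ => le_rfl)
    rw [hY, ← integral_cexp_neg_mul hw, ← integral_smul_const,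
      ← integral_sub (integrableOn_cexp_smul hw hy hC) hc]
    refine setIntegral_congr_fun measurableSet_Ioi fun t ht => ?_
    simp only [← h1 t ht, smul_sub]
  -- The transformed equation is `Y - y 0 / w = w^(-p) μ Y`; since `w^p = μ`, the terms with `Y`
  -- cancel.
  rw [hL, hJ, smul_smul, ← hwμ, ← Complex.cpow_add _ _ hw0, neg_add_cancel, Complex.cpow_zero,
    one_smul, sub_eq_self] at hI
  exact (smul_eq_zero.1 hI).resolve_left (inv_ne_zero hw0)

end FracStable

/-! ### Stieltjes and Beta representations of the symbols. -/

namespace FracStable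

open MeasureTheory

/-- The density `y^(-p) / (Γ(p) Γ(1-p))` of the Stieltjes representation of `a ↦ a^(-p)`. -/
noncomputable def stieltjesWeight (p y : ℝ) : ℝ := y ^ (-p) / (Real.Gamma p * Real.Gamma (1 - p))

theorem Gamma_mul_Gamma_pos {p : ℝ} (hp0 : 0 < p) (hp1 : p < 1) :
    0 < Real.Gamma p * Real.Gamma (1 - p) :=
  mul_pos (Real.Gamma_pos_of_pos hp0) (Real.Gamma_pos_of_pos (by linarith))

theorem stieltjesWeight_nonneg {p y : ℝ} (hp0 : 0 < p) (hp1 : p < 1) (hy : 0 ≤ y) :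
    0 ≤ stieltjesWeight p y :=
  div_nonneg (Real.rpow_nonneg hy _) (Gamma_mul_Gamma_pos hp0 hp1).le

theorem measurable_stieltjesWeight (p : ℝ) : Measurable (stieltjesWeight p) := by
  unfold stieltjesWeight; fun_prop

theorem measurable_betaWeight (p : ℝ) : Measurable (betaWeight p) := by
  unfold betaWeight; fun_prop

theorem integrableOn_betaWeight {p : ℝ} (hp0 : 0 < p) (hp1 : p < 1) :
    IntegrableOn (betaWeight p) (Ioc 0 1) :=
  (intervalIntegrable_iff_integrableOn_Ioc_of_le zero_le_one).1
    (intervalIntegrable_betaWeight hp0 hp1)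

theorem integrableOn_stieltjesWeight_mul {p : ℝ} (hp0 : 0 < p) (hp1 : p < 1) :
    IntegrableOn (fun y => stieltjesWeight p y * (1 + y)⁻¹) (Ioi 0) := by
  have hm : Measurable fun y : ℝ => y ^ (-p) * (1 + y)⁻¹ := by fun_prop
  have h1 : IntegrableOn (fun y : ℝ => y ^ (-p) * (1 + y)⁻¹) (Ioc 0 1) := by
    have h := (intervalIntegrable_iff_integrableOn_Ioc_of_le zero_le_one).1
      (intervalIntegral.intervalIntegrable_rpow' (a := 0) (b := 1) (r := -p) (by linarith))
    refine Integrable.mono' h hm.aestronglyMeasurable ?_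
    refine (ae_restrict_iff' measurableSet_Ioc).2 (Eventually.of_forall fun y hy => ?_)
    have hy0 : 0 < y := hy.1
    rw [Real.norm_of_nonneg (by positivity)]
    refine mul_le_of_le_one_right (by positivity) (inv_le_one_of_one_le₀ (by linarith))
  have h2 : IntegrableOn (fun y : ℝ => y ^ (-p) * (1 + y)⁻¹) (Ioi 1) := by
    have h := integrableOn_Ioi_rpow_of_lt (a := -p - 1) (by linarith) one_pos
    refine Integrable.mono' h hm.aestronglyMeasurable ?_
    refine (ae_restrict_iff' measurableSet_Ioi).2 (Eventually.of_forall fun y hy => ?_)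
    have hy0 : 0 < y := one_pos.trans hy
    rw [Real.norm_of_nonneg (by positivity), Real.rpow_sub_one hy0.ne', div_eq_mul_inv]
    gcongr
    linarith
  have h3 := (h1.union h2).div_const (Real.Gamma p * Real.Gamma (1 - p))
  rw [Ioc_union_Ioi_eq_Ioi zero_le_one] at h3
  refine h3.congr (Eventually.of_forall fun y => ?_)
  simp only [stieltjesWeight]; ring

theorem re_one_add_div {s : ℂ} (hs : 0 ≤ s.re) : 0 < ((1 + s) / s).re ∨ s = 0 := by
  by_cases h : s = 0
  · exact Or.inr h
  · left
    rw [add_div, div_self h, one_div, Complex.add_re, Complex.inv_re]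
    simp only [Complex.one_re]
    have := Complex.normSq_nonneg s
    positivity

theorem norm_add_ofReal_inv_le {a : ℂ} {b y : ℝ} (hb : 0 < b) (hab : b ≤ a.re) (hy : 0 ≤ y) :
    ‖(a + y)⁻¹‖ ≤ (b + y)⁻¹ := by
  rw [norm_inv]
  refine inv_anti₀ (by linarith) ?_
  refine le_trans ?_ (Complex.re_le_norm _)
  simp; linarith

theorem integrableOn_stieltjesWeight_mul_inv {p : ℝ} (hp0 : 0 < p) (hp1 : p < 1) {a : ℂ}
    (ha : 0 < a.re) :
    IntegrableOn (fun y : ℝ => (stieltjesWeight p y : ℂ) * (a + y)⁻¹) (Ioi 0) := by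
  refine Integrable.mono' ((integrableOn_stieltjesWeight_mul hp0 hp1).const_mul
    (max 1 (a.re)⁻¹)) ?_ ?_
  · have := measurable_stieltjesWeight p
    exact Measurable.aestronglyMeasurable (by fun_prop)
  · refine (ae_restrict_iff' measurableSet_Ioi).2 (Eventually.of_forall fun y hy => ?_)
    have hy0 : 0 < y := hy
    have hw := stieltjesWeight_nonneg hp0 hp1 hy0.le
    rw [norm_mul, Complex.norm_real, Real.norm_of_nonneg hw, mul_left_comm]
    refine mul_le_mul_of_nonneg_left ((norm_add_ofReal_inv_le ha le_rfl hy0.le).trans ?_) hw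
    rw [← div_eq_mul_inv, le_div_iff₀ (by linarith), inv_mul_le_iff₀ (by linarith)]
    have h1 : 1 ≤ max 1 (a.re)⁻¹ := le_max_left _ _
    have h2 : (a.re)⁻¹ ≤ max 1 (a.re)⁻¹ := le_max_right _ _
    have h3 : 1 ≤ a.re * max 1 (a.re)⁻¹ := by
      calc (1 : ℝ) = a.re * (a.re)⁻¹ := (mul_inv_cancel₀ ha.ne').symm
        _ ≤ _ := mul_le_mul_of_nonneg_left h2 ha.le
    nlinarith

theorem integral_stieltjesWeight_mul_inv {p : ℝ} (hp0 : 0 < p) (hp1 : p < 1) {a : ℂ}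
    (ha : 0 < a.re) :
    ∫ y in Ioi (0 : ℝ), (stieltjesWeight p y : ℂ) * (a + y)⁻¹ = a ^ (-(p : ℂ)) := by
  have h := integral_rpow_mul_cpow_add hp0 hp1 le_rfl ha
  have hne : ((Real.Gamma p * Real.Gamma (1 - p) : ℝ) : ℂ) ≠ 0 := by
    exact_mod_cast (Gamma_mul_Gamma_pos hp0 hp1).ne'
  have h2 : ∀ y : ℝ, (stieltjesWeight p y : ℂ) * (a + y)⁻¹ =
      (((y ^ (-p) : ℝ) : ℂ) * (a + y) ^ (-((1 : ℝ) : ℂ))) /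
        ((Real.Gamma p * Real.Gamma (1 - p) : ℝ) : ℂ) := by
    intro y
    rw [Complex.ofReal_one, Complex.cpow_neg_one, stieltjesWeight]; push_cast; ring
  simp_rw [h2]
  rw [Real.Gamma_one, Complex.ofReal_one, one_mul, show (1 + p - 1) = p by ring] at h
  rw [integral_div, Complex.ofReal_one, h, div_eq_iff hne]
  push_cast; ring

theorem integral_stieltjesWeight_mul_sq_inv {p : ℝ} (hp0 : 0 < p) (hp1 : p < 1) {a : ℂ}
    (ha : 0 < a.re) :
    ∫ y in Ioi (0 : ℝ), (stieltjesWeight p y : ℂ) * ((a + y) ^ 2)⁻¹ =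
      p * (a ^ (-(p : ℂ)) * a⁻¹) := by
  have ha0 : a ≠ 0 := by rintro rfl; simp at ha
  have h := integral_rpow_mul_cpow_add hp0 hp1 (q := 2) (by norm_num) ha
  have hne : ((Real.Gamma p * Real.Gamma (1 - p) : ℝ) : ℂ) ≠ 0 := by
    exact_mod_cast (Gamma_mul_Gamma_pos hp0 hp1).ne'
  have h2 : ∀ y : ℝ, (stieltjesWeight p y : ℂ) * ((a + y) ^ 2)⁻¹ =
      (((y ^ (-p) : ℝ) : ℂ) * (a + y) ^ (-((2 : ℝ) : ℂ))) /
        ((Real.Gamma p * Real.Gamma (1 - p) : ℝ) : ℂ) := by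
    intro y
    rw [Complex.ofReal_ofNat, Complex.cpow_neg, Complex.cpow_ofNat, stieltjesWeight]
    push_cast; ring
  have hG2 : Real.Gamma 2 = 1 := by simp
  simp_rw [h2]
  rw [hG2, Complex.ofReal_one, one_mul, show (2 + p - 1) = p + 1 by ring,
    Real.Gamma_add_one hp0.ne'] at h
  rw [integral_div, h, div_eq_iff hne]
  push_cast
  rw [neg_add, Complex.cpow_add _ _ ha0, Complex.cpow_neg_one]
  ring

/-- The substitution `θ = (1 + y)⁻¹` carries `θ * betaWeight p θ` to `stieltjesWeight p y`, with
Jacobian `(1 + y)^(-2)`. -/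
theorem integral_betaWeight_mul {p : ℝ} (F : ℝ → ℂ) :
    ∫ θ in Ioc (0 : ℝ) 1, ((betaWeight p θ * θ : ℝ) : ℂ) * F θ =
      ∫ y in Ioi (0 : ℝ), (stieltjesWeight p y : ℂ) * (((1 + (y : ℂ)) ^ 2)⁻¹ * F (1 + y)⁻¹) := by
  have himg : (fun y : ℝ => (1 + y)⁻¹) '' Ioi 0 = Ioo 0 1 := by
    ext θ
    simp only [mem_image, mem_Ioi, mem_Ioo]
    constructor
    · rintro ⟨y, hy, rfl⟩
      exact ⟨by positivity, inv_lt_one_of_one_lt₀ (by linarith)⟩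
    · rintro ⟨h0, h1⟩
      refine ⟨θ⁻¹ - 1, ?_, by simp⟩
      have := (one_lt_inv₀ h0).2 h1
      linarith
  rw [integral_Ioc_eq_integral_Ioo, ← himg,
    integral_image_eq_integral_abs_deriv_smul measurableSet_Ioi
      (f' := fun y => -1 / (1 + y) ^ 2)]
  · refine setIntegral_congr_fun measurableSet_Ioi fun y hy => ?_
    have hy0 : 0 < y := hy
    have h1y : (0 : ℝ) < 1 + y := by linarith
    have habs : |-1 / (1 + y) ^ 2| = ((1 + y) ^ 2)⁻¹ := by
      rw [abs_div, abs_neg, abs_one, abs_of_pos (by positivity), one_div]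
    have hw : betaWeight p (1 + y)⁻¹ * (1 + y)⁻¹ = stieltjesWeight p y := by
      have e : 1 - (1 + y)⁻¹ = y * (1 + y)⁻¹ := by field_simp; ring
      rw [betaWeight, stieltjesWeight, e, Real.mul_rpow hy0.le (by positivity),
        Real.rpow_sub_one (by positivity), Real.rpow_neg (inv_nonneg.2 h1y.le)]
      have : ((1 + y)⁻¹ : ℝ) ^ p ≠ 0 := (Real.rpow_pos_of_pos (by positivity) p).ne'
      field_simp
    simp only [habs, hw, Complex.real_smul]
    push_cast
    ring
  · intro y hy
    have hy0 : 0 < y := hy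
    have : HasDerivAt (fun y : ℝ => 1 + y) 1 y := by simpa using (hasDerivAt_id y).const_add 1
    exact (this.fun_inv (by positivity)).hasDerivWithinAt
  · intro x _ y _ hxy
    simpa using hxy

/-- After the substitution the integrand is the partial fraction `1 / (1 + y) - 1 / ((1 + s) / s +
y)`, a difference of two Stieltjes integrals. This identifies the symbol of `powDeriv` as `(s / (1 +
s))^p`. -/
theorem integral_betaWeight_mul_inv {p : ℝ} (hp0 : 0 < p) (hp1 : p < 1) {s : ℂ} (hs : 0 ≤ s.re)
    (hs0 : s ≠ 0) :
    ∫ θ in Ioc (0 : ℝ) 1, ((betaWeight p θ * θ : ℝ) : ℂ) * (θ + s)⁻¹ =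
      1 - ((1 + s) / s) ^ (-(p : ℂ)) := by
  have ha := (re_one_add_div hs).resolve_right hs0
  rw [integral_betaWeight_mul, ← integral_stieltjesWeight_mul_inv hp0 hp1 ha]
  have h1 := integral_stieltjesWeight_mul_inv hp0 hp1 (a := 1) (by simp)
  rw [Complex.one_cpow] at h1
  refine Eq.trans ?_ (congrArg (· - _) h1)
  rw [← integral_sub (integrableOn_stieltjesWeight_mul_inv hp0 hp1 (by simp))
    (integrableOn_stieltjesWeight_mul_inv hp0 hp1 ha)]
  refine setIntegral_congr_fun measurableSet_Ioi fun y hy => ?_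
  have hy0 : 0 < y := hy
  have e1 : (1 : ℂ) + y ≠ 0 := fun h => by
    have := congrArg Complex.re h
    simp at this; linarith
  have e2 : (1 + s) / s + y ≠ 0 := fun h => by
    have := congrArg Complex.re h
    simp only [Complex.add_re, Complex.ofReal_re, Complex.zero_re] at this
    linarith
  have e3 : 1 + s + y * s ≠ 0 := fun h => e2 (by rw [div_add' _ _ _ hs0, h, zero_div])
  have e4 : 1 + s * (1 + y) ≠ 0 := fun h => e3 (by rw [← h]; ring)
  push_cast
  rw [← mul_sub]
  congr 1
  rw [div_add' _ _ _ hs0, show ((1 : ℂ) + y)⁻¹ + s = (1 + s * (1 + y)) / (1 + y) by field_simp]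
  field_simp
  rw [show 1 + (1 + (y : ℂ)) * s = 1 + s + y * s by ring, div_self e3]
  ring

/-- The squared denominators encode the derivative of the symbol, which is needed to see that its
zero is simple. -/
theorem integral_betaWeight_mul_sq_inv {p : ℝ} (hp0 : 0 < p) (hp1 : p < 1) {s : ℂ}
    (hs : 0 < s.re) :
    ∫ θ in Ioc (0 : ℝ) 1, ((betaWeight p θ * θ : ℝ) : ℂ) * ((θ + s) ^ 2)⁻¹ =
      (s ^ 2)⁻¹ * (p * (((1 + s) / s) ^ (-(p : ℂ)) * ((1 + s) / s)⁻¹)) := by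
  have hs0 : s ≠ 0 := by rintro rfl; simp at hs
  have ha := (re_one_add_div hs.le).resolve_right hs0
  rw [integral_betaWeight_mul, ← integral_stieltjesWeight_mul_sq_inv hp0 hp1 ha,
    ← integral_const_mul]
  refine setIntegral_congr_fun measurableSet_Ioi fun y hy => ?_
  have hy0 : 0 < y := hy
  have e1 : (1 : ℂ) + y ≠ 0 := fun h => by
    have := congrArg Complex.re h
    simp at this; linarith
  have key : ((1 + (y : ℂ)) ^ 2)⁻¹ * (((1 + (y : ℂ))⁻¹ + s) ^ 2)⁻¹ =
      (s ^ 2)⁻¹ * (((1 + s) / s + y) ^ 2)⁻¹ := by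
    rw [← mul_inv, ← mul_inv, ← mul_pow, ← mul_pow]
    congr 2
    field_simp
    ring
  push_cast
  rw [key, mul_left_comm]

end FracStable

/-! ### Complex powers on the half-plane; resolvent families and their characters. -/

namespace FracStable

open MeasureTheory

/-- Here `|arg (1 + s)| < π / 2` and `|arg s| ≤ π / 2`, so the logarithms subtract without crossing
the branch cut. -/
theorem one_add_div_cpow {p : ℝ} {s : ℂ} (hs : 0 ≤ s.re) (hs0 : s ≠ 0) :
    ((1 + s) / s) ^ (-(p : ℂ)) = s ^ (p : ℂ) * (1 + s) ^ (-(p : ℂ)) := by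
  have h1 : (1 + s) ≠ 0 := fun h => by
    have := congrArg Complex.re h
    simp at this; linarith
  have hre : 0 < (1 + s).re := by simp; linarith
  have a1 : |(1 + s).arg| < Real.pi / 2 := Complex.abs_arg_lt_pi_div_two_iff.2 (Or.inl hre)
  have a2 : |s.arg| ≤ Real.pi / 2 := Complex.abs_arg_le_pi_div_two_iff.2 hs
  have hlog : Complex.log ((1 + s) / s) = Complex.log (1 + s) - Complex.log s := by
    have e : (1 + s) / s = Complex.exp (Complex.log (1 + s) - Complex.log s) := by
      rw [Complex.exp_sub, Complex.exp_log h1, Complex.exp_log hs0]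
    rw [abs_lt] at a1
    rw [abs_le] at a2
    rw [e]
    refine Complex.log_exp ?_ ?_ <;> simp only [Complex.sub_im, Complex.log_im] <;> linarith
  rw [Complex.cpow_def_of_ne_zero (div_ne_zero h1 hs0), Complex.cpow_def_of_ne_zero hs0,
    Complex.cpow_def_of_ne_zero h1, hlog, ← Complex.exp_add]
  ring_nf

/-- This is the origin of the stability sector: `s ↦ s^p` sends the closed right half-plane into it.
-/
theorem abs_arg_cpow_le {p : ℝ} (hp0 : 0 < p) (hp1 : p < 1) {s : ℂ} (hs : 0 ≤ s.re)
    (hs0 : s ≠ 0) : |(s ^ (p : ℂ)).arg| ≤ p * Real.pi / 2 := by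
  have a2 : |s.arg| ≤ Real.pi / 2 := Complex.abs_arg_le_pi_div_two_iff.2 hs
  have hπ := Real.pi_pos
  have him : (Complex.log s * p).im = p * s.arg := by
    rw [Complex.im_mul_ofReal, Complex.log_im, mul_comm]
  have h3 : |p * s.arg| ≤ p * Real.pi / 2 := by
    rw [abs_mul, abs_of_pos hp0, mul_div_assoc]
    exact mul_le_mul_of_nonneg_left a2 hp0.le
  have h4 := abs_le.1 h3
  rw [Complex.cpow_def_of_ne_zero hs0, ← Complex.log_im, Complex.log_exp, him]
  · exact h3
  · rw [him]; nlinarith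
  · rw [him]; nlinarith

theorem cpow_injective_of_re_nonneg {p : ℝ} (hp0 : 0 < p) (hp1 : p < 1) {s w : ℂ} (hs : 0 ≤ s.re)
    (hw : 0 ≤ w.re) (hs0 : s ≠ 0) (hw0 : w ≠ 0) (h : s ^ (p : ℂ) = w ^ (p : ℂ)) : s = w := by
  have hπ := Real.pi_pos
  have him : ∀ z : ℂ, 0 ≤ z.re → -Real.pi < (Complex.log z * p).im ∧
      (Complex.log z * p).im ≤ Real.pi := by
    intro z hz
    have a2 := abs_le.1 (Complex.abs_arg_le_pi_div_two_iff.2 hz)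
    rw [Complex.im_mul_ofReal, Complex.log_im]
    constructor <;> nlinarith
  rw [Complex.cpow_def_of_ne_zero hs0, Complex.cpow_def_of_ne_zero hw0] at h
  have h2 := Complex.exp_inj_of_neg_pi_lt_of_le_pi (him s hs).1 (him s hs).2 (him w hw).1
    (him w hw).2 h
  have hpc : (p : ℂ) ≠ 0 := by exact_mod_cast hp0.ne'
  have h3 := mul_right_cancel₀ hpc h2
  rw [← Complex.exp_log hs0, h3, Complex.exp_log hw0]

variable {𝒜 : Type*} [NormedCommRing 𝒜] [NormedAlgebra ℂ 𝒜]

/-- `J r` behaves like the resolvent `(r + D)⁻¹`, `r > 0`, of the generator of a contraction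
semigroup. -/
structure IsResolvent (J : ℝ → 𝒜) : Prop where
  norm_le : ∀ r, 0 < r → ‖J r‖ ≤ 1 / r
  resolvent : ∀ r q, 0 < r → 0 < q → J r - J q = ((q - r : ℝ) : ℂ) • (J r * J q)

namespace IsResolvent

variable {J : ℝ → 𝒜}

theorem continuousOn (hJ : IsResolvent J) : ContinuousOn J (Ioi 0) := by
  intro q hq
  have hq : 0 < q := hq
  rw [ContinuousWithinAt, tendsto_iff_norm_sub_tendsto_zero]
  have hlim : Tendsto (fun r : ℝ => |q - r| * ((1 / r) * (1 / q))) (𝓝[Ioi 0] q) (𝓝 0) := by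
    have : ContinuousAt (fun r : ℝ => |q - r| * ((1 / r) * (1 / q))) q := by
      have := hq.ne'
      fun_prop (disch := assumption)
    have h := this.tendsto
    simp only [sub_self, abs_zero, zero_mul] at h
    exact h.mono_left nhdsWithin_le_nhds
  refine squeeze_zero' (Eventually.of_forall fun _ => norm_nonneg _) ?_ hlim
  filter_upwards [self_mem_nhdsWithin] with r hr
  have hr : 0 < r := hr
  rw [hJ.resolvent r q hr hq, norm_smul, Complex.norm_real, Real.norm_eq_abs]
  refine mul_le_mul_of_nonneg_left ((norm_mul_le _ _).trans ?_) (abs_nonneg _)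
  exact mul_le_mul (hJ.norm_le r hr) (hJ.norm_le q hq) (norm_nonneg _) (by positivity)

theorem integrableOn_stieltjes (hJ : IsResolvent J) {p : ℝ} (hp0 : 0 < p) (hp1 : p < 1) :
    IntegrableOn (fun y : ℝ => (stieltjesWeight p y : ℂ) • J (1 + y)) (Ioi 0) := by
  refine Integrable.mono' (integrableOn_stieltjesWeight_mul hp0 hp1) ?_ ?_
  · refine AEStronglyMeasurable.smul ?_ ?_
    · have := measurable_stieltjesWeight p
      exact Measurable.aestronglyMeasurable (by fun_prop)
    · refine ContinuousOn.aestronglyMeasurable ?_ measurableSet_Ioi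
      exact hJ.continuousOn.comp (by fun_prop) fun y (hy : 0 < y) => (by simp; linarith)
  · refine (ae_restrict_iff' measurableSet_Ioi).2 (Eventually.of_forall fun y hy => ?_)
    have hy0 : 0 < y := hy
    have hw := stieltjesWeight_nonneg hp0 hp1 hy0.le
    rw [norm_smul, Complex.norm_real, Real.norm_of_nonneg hw, ← one_div]
    exact mul_le_mul_of_nonneg_left (hJ.norm_le _ (by linarith)) hw

theorem aestronglyMeasurable_Ioc (hJ : IsResolvent J) :
    AEStronglyMeasurable J (volume.restrict (Ioc 0 1)) :=
  (hJ.continuousOn.mono Ioc_subset_Ioi_self).aestronglyMeasurable measurableSet_Ioc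

theorem integrableOn_beta (hJ : IsResolvent J) {p : ℝ} (hp0 : 0 < p) (hp1 : p < 1) :
    IntegrableOn (fun θ : ℝ => ((betaWeight p θ * θ : ℝ) : ℂ) • J θ) (Ioc 0 1) := by
  refine Integrable.mono' (integrableOn_betaWeight hp0 hp1) ?_ ?_
  · refine AEStronglyMeasurable.smul ?_ hJ.aestronglyMeasurable_Ioc
    have := measurable_betaWeight p
    exact Measurable.aestronglyMeasurable (by fun_prop)
  · refine (ae_restrict_iff' measurableSet_Ioc).2 (Eventually.of_forall fun θ hθ => ?_)
    have hw := betaWeight_nonneg hp0 hp1 hθ.1.le hθ.2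
    rw [norm_smul, Complex.norm_real, Real.norm_of_nonneg (mul_nonneg hw hθ.1.le), mul_assoc]
    refine mul_le_of_le_one_right hw ?_
    have := hJ.norm_le θ hθ.1
    rwa [le_div_iff₀' hθ.1] at this

end IsResolvent

/-- The operator `(1 + D)^(-p)` expressed by the resolvents `J r = (r + D)⁻¹`. -/
noncomputable def powInt (p : ℝ) (J : ℝ → 𝒜) : 𝒜 :=
  ∫ y in Ioi (0 : ℝ), (stieltjesWeight p y : ℂ) • J (1 + y)

/-- The operator `(D / (1 + D))^p` expressed by the resolvents `J r = (r + D)⁻¹`. -/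
noncomputable def powDeriv (p : ℝ) (J : ℝ → 𝒜) : 𝒜 :=
  1 - ∫ θ in Ioc (0 : ℝ) 1, ((betaWeight p θ * θ : ℝ) : ℂ) • J θ

variable [CompleteSpace 𝒜] {J : ℝ → 𝒜}

/-- Under `χ` the resolvent identity becomes scalar and determines every `χ (J r)` from `χ (J 1)`.
Either all vanish, which is the point at infinity, or `χ (J r) = (r + s)⁻¹` with `s = (χ (J 1))⁻¹ -
1`. Characters do not increase norms, so `|r + s| ≥ r` for all `r > 0`, and this forces `Re s ≥ 0`.
-/
theorem character_dichotomy [NormOneClass 𝒜] (hJ : IsResolvent J)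
    (χ : WeakDual.characterSpace ℂ 𝒜) :
    (∀ r, 0 < r → χ (J r) = 0) ∨
      ∃ s : ℂ, 0 ≤ s.re ∧ ∀ r : ℝ, 0 < r → r + s ≠ 0 ∧ χ (J r) = (r + s)⁻¹ := by
  have hχ : ∀ r, 0 < r → χ (J r) * (1 - (1 - r) * χ (J 1)) = χ (J 1) := by
    intro r hr
    have := congrArg χ (hJ.resolvent r 1 hr one_pos)
    rw [map_sub, map_smul, map_mul, smul_eq_mul] at this
    push_cast at this
    linear_combination this
  by_cases hz : χ (J 1) = 0
  · left
    intro r hr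
    simpa [hz] using hχ r hr
  · right
    have key : ∀ r : ℝ, 0 < r → χ (J r) * (r + ((χ (J 1))⁻¹ - 1)) = 1 := by
      intro r hr
      have := hχ r hr
      field_simp
      linear_combination this
    have hne : ∀ r : ℝ, 0 < r → (r + ((χ (J 1))⁻¹ - 1)) ≠ 0 := fun r hr h => by
      have := key r hr
      rw [h, mul_zero] at this
      exact zero_ne_one this
    refine ⟨(χ (J 1))⁻¹ - 1, ?_, fun r hr => ⟨hne r hr, eq_inv_of_mul_eq_one_left (key r hr)⟩⟩
    set s := (χ (J 1))⁻¹ - 1 with hs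
    by_contra hneg
    push Not at hneg
    -- If `Re s < 0`, this `r` gives `|r + s|² = r² - 1 < r²`.
    set r : ℝ := (1 + s.re ^ 2 + s.im ^ 2) / (-(2 * s.re)) with hr
    have hr0 : 0 < r := div_pos (by positivity) (by linarith)
    have h1 : ‖χ (J r)‖ ≤ 1 / r := by
      have h := AlgHom.norm_apply_le_self (χ : WeakDual.characterSpace ℂ 𝒜) (J r)
      exact h.trans (hJ.norm_le r hr0)
    rw [eq_inv_of_mul_eq_one_left (key r hr0), norm_inv, ← one_div,
      one_div_le_one_div (norm_pos_iff.2 (hne r hr0)) hr0] at h1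
    have h2 : r ^ 2 ≤ ‖(r : ℂ) + s‖ ^ 2 := by gcongr
    rw [← Complex.normSq_eq_norm_sq, Complex.normSq_apply] at h2
    simp only [Complex.add_re, Complex.add_im, Complex.ofReal_re, Complex.ofReal_im] at h2
    have h3 : r * (-(2 * s.re)) = 1 + s.re ^ 2 + s.im ^ 2 := div_mul_cancel₀ _ (by linarith)
    nlinarith

end FracStable

/-! ### Invertibility and factorization of the symbol of `D^p - μ`. -/

namespace FracStable

open MeasureTheory

variable {𝒜 : Type*} [NormedCommRing 𝒜] [NormedAlgebra ℂ 𝒜] {J : ℝ → 𝒜}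

/-- The quotient of the symbols of `D^p - μ` and `D - w`, where `w^p = μ`. -/
noncomputable def quot (p : ℝ) (μ w : ℂ) (J : ℝ → 𝒜) : 𝒜 :=
  (∫ θ in Ioc (0 : ℝ) 1, (((betaWeight p θ * θ : ℝ) : ℂ) * (θ + w)⁻¹) • (1 + (1 - θ : ℂ) • J θ)) +
    μ • ∫ y in Ioi (0 : ℝ), ((stieltjesWeight p y : ℂ) * (1 + w + y)⁻¹) •
      (1 - (y : ℂ) • J (1 + y))

theorem integrableOn_quot_beta [NormOneClass 𝒜] (hJ : IsResolvent J) {p : ℝ} (hp0 : 0 < p)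
    (hp1 : p < 1) {w : ℂ} (hw : 0 < w.re) :
    IntegrableOn (fun θ : ℝ => (((betaWeight p θ * θ : ℝ) : ℂ) * (θ + w)⁻¹) •
      (1 + (1 - θ : ℂ) • J θ)) (Ioc 0 1) := by
  refine Integrable.mono' ((integrableOn_betaWeight hp0 hp1).mul_const ((w.re)⁻¹ * 2)) ?_ ?_
  · refine AEStronglyMeasurable.smul ?_ (aestronglyMeasurable_const.add
      (AEStronglyMeasurable.smul ?_ hJ.aestronglyMeasurable_Ioc))
    · have := measurable_betaWeight p
      exact Measurable.aestronglyMeasurable (by fun_prop)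
    · exact Measurable.aestronglyMeasurable (by fun_prop)
  · refine (ae_restrict_iff' measurableSet_Ioc).2 (Eventually.of_forall fun θ hθ => ?_)
    have hw' := betaWeight_nonneg hp0 hp1 hθ.1.le hθ.2
    have h1 : ‖((θ : ℂ) + w)⁻¹‖ ≤ (w.re)⁻¹ := by
      rw [add_comm]
      refine (norm_add_ofReal_inv_le hw le_rfl hθ.1.le).trans (inv_anti₀ hw (by linarith [hθ.1]))
    -- The factor `θ` absorbs the blow-up of `‖J θ‖ ≤ 1 / θ` at `0`.
    have h2 : θ * ‖1 + (1 - θ : ℂ) • J θ‖ ≤ 2 := by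
      have h3 : ‖1 + (1 - θ : ℂ) • J θ‖ ≤ 1 + 1 / θ := by
        refine (norm_add_le _ _).trans ?_
        rw [norm_one, norm_smul]
        have : ‖(1 - θ : ℂ)‖ ≤ 1 := by
          rw [← Complex.ofReal_one, ← Complex.ofReal_sub, Complex.norm_real, Real.norm_eq_abs,
            abs_of_nonneg (by linarith [hθ.2])]
          linarith [hθ.1]
        have h4 := hJ.norm_le θ hθ.1
        nlinarith [norm_nonneg (J θ)]
      calc θ * ‖1 + (1 - θ : ℂ) • J θ‖ ≤ θ * (1 + 1 / θ) := mul_le_mul_of_nonneg_left h3 hθ.1.le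
        _ = θ + 1 := by have := hθ.1.ne'; field_simp
        _ ≤ 2 := by linarith [hθ.2]
    rw [norm_smul, norm_mul, Complex.norm_real, Real.norm_of_nonneg (mul_nonneg hw' hθ.1.le)]
    calc betaWeight p θ * θ * ‖((θ : ℂ) + w)⁻¹‖ * ‖1 + (1 - θ : ℂ) • J θ‖
        = betaWeight p θ * (‖((θ : ℂ) + w)⁻¹‖ * (θ * ‖1 + (1 - θ : ℂ) • J θ‖)) := by ring
      _ ≤ _ := by
        refine mul_le_mul_of_nonneg_left (mul_le_mul h1 h2 ?_ (inv_nonneg.2 hw.le)) hw'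
        exact mul_nonneg hθ.1.le (norm_nonneg _)

theorem integrableOn_quot_stieltjes [NormOneClass 𝒜] (hJ : IsResolvent J) {p : ℝ} (hp0 : 0 < p)
    (hp1 : p < 1) {w : ℂ} (hw : 0 < w.re) :
    IntegrableOn (fun y : ℝ => ((stieltjesWeight p y : ℂ) * (1 + w + y)⁻¹) •
      (1 - (y : ℂ) • J (1 + y))) (Ioi 0) := by
  refine Integrable.mono' ((integrableOn_stieltjesWeight_mul hp0 hp1).mul_const 2) ?_ ?_
  · have hc : ContinuousOn (fun y => J (1 + y)) (Ioi 0) :=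
      hJ.continuousOn.comp (by fun_prop) fun y (hy : 0 < y) => (by simp; linarith)
    refine AEStronglyMeasurable.smul ?_ (aestronglyMeasurable_const.sub
      (AEStronglyMeasurable.smul ?_ (hc.aestronglyMeasurable measurableSet_Ioi)))
    · have := measurable_stieltjesWeight p
      exact Measurable.aestronglyMeasurable (by fun_prop)
    · exact Measurable.aestronglyMeasurable (by fun_prop)
  · refine (ae_restrict_iff' measurableSet_Ioi).2 (Eventually.of_forall fun y hy => ?_)
    have hy0 : 0 < y := hy
    have hw' := stieltjesWeight_nonneg hp0 hp1 hy0.le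
    have h1 : ‖(1 + w + (y : ℂ))⁻¹‖ ≤ (1 + y)⁻¹ :=
      norm_add_ofReal_inv_le one_pos (by simp; linarith) hy0.le
    have h2 : ‖1 - (y : ℂ) • J (1 + y)‖ ≤ 2 := by
      refine (norm_sub_le _ _).trans ?_
      rw [norm_one, norm_smul, Complex.norm_real, Real.norm_of_nonneg hy0.le]
      have h4 := hJ.norm_le (1 + y) (by linarith)
      have : y * (1 / (1 + y)) ≤ 1 := by
        rw [mul_one_div, div_le_one (by linarith)]; linarith
      nlinarith
    rw [norm_smul, norm_mul, Complex.norm_real, Real.norm_of_nonneg hw', mul_assoc, mul_assoc]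
    exact mul_le_mul_of_nonneg_left (mul_le_mul h1 h2 (norm_nonneg _) (by positivity)) hw'

/-- In symbols: `(s - w) / (1 + s)` times `(1 + s) / (r + s)` is `(s - w) / (r + s)`. The factor
that vanishes at `w` can thus be pulled out uniformly in `r`. -/
theorem IsResolvent.factor (hJ : IsResolvent J) (w : ℂ) {r : ℝ} (hr : 0 < r) :
    (1 - (1 + w) • J 1) * (1 + (1 - r : ℂ) • J r) = 1 - (r + w) • J r := by
  have h := hJ.resolvent r 1 hr one_pos
  push_cast at h
  have e : (1 - (1 + w) • J 1) * (1 + (1 - r : ℂ) • J r) =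
      1 + (1 - r : ℂ) • J r - (1 + w) • J 1 - (1 + w) • ((1 - r : ℂ) • (J r * J 1)) := by
    simp only [sub_mul, mul_add, one_mul, mul_one, smul_mul_smul_comm, smul_smul, mul_comm (J 1)]
    abel
  rw [e, ← h]
  module

variable [CompleteSpace 𝒜]

theorem character_integral (χ : WeakDual.characterSpace ℂ 𝒜) {s : Set ℝ} {f : ℝ → 𝒜}
    (hf : IntegrableOn f s) : χ (∫ x in s, f x) = ∫ x in s, χ (f x) :=
  ((WeakDual.CharacterSpace.toCLM χ).integral_comp_comm hf).symm

theorem character_powInt (hJ : IsResolvent J) {p : ℝ} (hp0 : 0 < p) (hp1 : p < 1)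
    {χ : WeakDual.characterSpace ℂ 𝒜} {s : ℂ} (hs : 0 ≤ s.re)
    (h : ∀ r : ℝ, 0 < r → χ (J r) = (r + s)⁻¹) :
    χ (powInt p J) = (1 + s) ^ (-(p : ℂ)) := by
  rw [powInt, character_integral χ (hJ.integrableOn_stieltjes hp0 hp1),
    ← integral_stieltjesWeight_mul_inv hp0 hp1 (a := 1 + s) (by simp; linarith)]
  refine setIntegral_congr_fun measurableSet_Ioi fun y hy => ?_
  have hy0 : 0 < y := hy
  simp only [map_smul, h (1 + y) (by linarith), smul_eq_mul]
  push_cast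
  ring_nf

theorem character_powInt_of_zero (hJ : IsResolvent J) {p : ℝ} (hp0 : 0 < p) (hp1 : p < 1)
    {χ : WeakDual.characterSpace ℂ 𝒜} (h : ∀ r : ℝ, 0 < r → χ (J r) = 0) :
    χ (powInt p J) = 0 := by
  rw [powInt, character_integral χ (hJ.integrableOn_stieltjes hp0 hp1)]
  refine (setIntegral_congr_fun measurableSet_Ioi fun y hy => ?_).trans (integral_zero _ _)
  have hy0 : 0 < y := hy
  simp only [map_smul, h (1 + y) (by linarith), smul_zero]

theorem character_powDeriv_of_zero (hJ : IsResolvent J) {p : ℝ} (hp0 : 0 < p) (hp1 : p < 1)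
    {χ : WeakDual.characterSpace ℂ 𝒜} (h : ∀ r : ℝ, 0 < r → χ (J r) = 0) :
    χ (powDeriv p J) = 1 := by
  rw [powDeriv, map_sub, map_one, character_integral χ (hJ.integrableOn_beta hp0 hp1), sub_eq_self]
  refine (setIntegral_congr_fun measurableSet_Ioc fun y hy => ?_).trans (integral_zero _ _)
  simp only [map_smul, h y hy.1, smul_zero]

theorem character_powDeriv (hJ : IsResolvent J) {p : ℝ} (hp0 : 0 < p) (hp1 : p < 1)
    {χ : WeakDual.characterSpace ℂ 𝒜} {s : ℂ} (hs : 0 ≤ s.re)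
    (h : ∀ r : ℝ, 0 < r → χ (J r) = (r + s)⁻¹) (hs0 : s ≠ 0) :
    χ (powDeriv p J) = s ^ (p : ℂ) * (1 + s) ^ (-(p : ℂ)) := by
  rw [powDeriv, map_sub, map_one, character_integral χ (hJ.integrableOn_beta hp0 hp1),
    ← one_add_div_cpow hs hs0, sub_eq_iff_eq_add, ← sub_eq_iff_eq_add',
    ← integral_betaWeight_mul_inv hp0 hp1 hs hs0]
  refine setIntegral_congr_fun measurableSet_Ioc fun θ hθ => ?_
  simp only [map_smul, h θ hθ.1, smul_eq_mul]

/-- At `s = 0` the quotient `(1 + s) / s` is meaningless, but the factor `θ` cancels `θ⁻¹` and the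
total mass of `betaWeight p` is `1`. -/
theorem character_powDeriv_zero (hJ : IsResolvent J) {p : ℝ} (hp0 : 0 < p) (hp1 : p < 1)
    {χ : WeakDual.characterSpace ℂ 𝒜} (h : ∀ r : ℝ, 0 < r → χ (J r) = (r + (0 : ℂ))⁻¹) :
    χ (powDeriv p J) = 0 := by
  have h1 : ∫ θ in Ioc (0 : ℝ) 1, (betaWeight p θ : ℂ) = 1 := by
    rw [integral_complex_ofReal, ← intervalIntegral.integral_of_le zero_le_one,
      integral_betaWeight hp0 hp1]; simp
  rw [powDeriv, map_sub, map_one, character_integral χ (hJ.integrableOn_beta hp0 hp1), sub_eq_zero,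
    ← h1]
  refine setIntegral_congr_fun measurableSet_Ioc fun θ hθ => ?_
  have : (θ : ℂ) ≠ 0 := by exact_mod_cast hθ.1.ne'
  simp only [map_smul, h θ hθ.1, smul_eq_mul, add_zero]
  push_cast
  field_simp

theorem one_add_cpow_ne_zero {s : ℂ} (hs : 0 ≤ s.re) (q : ℂ) : (1 + s) ^ q ≠ 0 := by
  have h1 : (1 + s) ≠ 0 := fun h => by
    have := congrArg Complex.re h
    simp at this; linarith
  simp [Complex.cpow_eq_zero_iff, h1]

/-- A character that annihilates the symbol of `D^p - μ` is evaluation at a root of `s^p = μ`. -/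
theorem exists_root_of_character_eq_zero [NormOneClass 𝒜] (hJ : IsResolvent J) {p : ℝ}
    (hp0 : 0 < p) (hp1 : p < 1) {μ : ℂ} (hμ0 : μ ≠ 0) {χ : WeakDual.characterSpace ℂ 𝒜}
    (h : χ (powDeriv p J - μ • powInt p J) = 0) :
    ∃ s : ℂ, 0 ≤ s.re ∧ s ≠ 0 ∧ s ^ (p : ℂ) = μ ∧
      ∀ r : ℝ, 0 < r → r + s ≠ 0 ∧ χ (J r) = (r + s)⁻¹ := by
  rw [map_sub, map_smul, smul_eq_mul] at h
  -- The symbol equals `1` at infinity and `-μ` at `s = 0`, so a zero can only be a nonzero finite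
  -- point.
  rcases character_dichotomy hJ χ with h0 | ⟨s, hs, h1⟩
  · rw [character_powDeriv_of_zero hJ hp0 hp1 h0, character_powInt_of_zero hJ hp0 hp1 h0] at h
    simp at h
  · have h2 := fun r hr => (h1 r hr).2
    have hne := one_add_cpow_ne_zero hs (-(p : ℂ))
    rw [character_powInt hJ hp0 hp1 hs h2] at h
    by_cases hs0 : s = 0
    · subst hs0
      rw [character_powDeriv_zero hJ hp0 hp1 h2, zero_sub, neg_eq_zero] at h
      exact absurd h (mul_ne_zero hμ0 hne)
    · refine ⟨s, hs, hs0, ?_, h1⟩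
      rw [character_powDeriv hJ hp0 hp1 hs h2 hs0, ← sub_mul] at h
      exact sub_eq_zero.1 ((mul_eq_zero.1 h).resolve_right hne)

/-- A non-unit is annihilated by a character, which would give `s` in the closed half-plane with
`s^p = μ`, against the bound on `arg (s^p)`. -/
theorem isUnit_powDeriv_sub [NormOneClass 𝒜] (hJ : IsResolvent J) {p : ℝ}
    (hp0 : 0 < p) (hp1 : p < 1) {μ : ℂ} (hμ0 : μ ≠ 0) (hμ : p * Real.pi / 2 < |μ.arg|) :
    IsUnit (powDeriv p J - μ • powInt p J) := by
  by_contra hu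
  obtain ⟨χ, hχ⟩ := WeakDual.CharacterSpace.exists_apply_eq_zero hu
  obtain ⟨s, hs, hs0, rfl, -⟩ := exists_root_of_character_eq_zero hJ hp0 hp1 hμ0 hχ
  exact absurd (abs_arg_cpow_le hp0 hp1 hs hs0) (not_le.2 hμ)

/-- Subtract from each of the two integrals its value at `s = w`. The integrands become multiples of
`1 - (r + w) • J r`, from which `IsResolvent.factor` extracts the common factor. The subtracted
scalars cancel because the symbol vanishes at `w`. -/
theorem powDeriv_sub_eq_mul_quot [NormOneClass 𝒜] (hJ : IsResolvent J) {p : ℝ}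
    (hp0 : 0 < p) (hp1 : p < 1) {w : ℂ} (hw : 0 < w.re) :
    powDeriv p J - w ^ (p : ℂ) • powInt p J =
      (1 - (1 + w) • J 1) * quot p (w ^ (p : ℂ)) w J := by
  have hw0 : w ≠ 0 := by rintro rfl; simp at hw
  have key : ∀ {s : Set ℝ} {f : ℝ → 𝒜}, IntegrableOn f s →
      (1 - (1 + w) • J 1) * ∫ x in s, f x = ∫ x in s, (1 - (1 + w) • J 1) * f x := fun hf =>
    ((ContinuousLinearMap.mul ℂ 𝒜 (1 - (1 + w) • J 1)).integral_comp_comm hf).symm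
  have h1 : ∫ θ in Ioc (0 : ℝ) 1, (1 - (1 + w) • J 1) *
      ((((betaWeight p θ * θ : ℝ) : ℂ) * (θ + w)⁻¹) • (1 + (1 - θ : ℂ) • J θ)) =
      (1 - ((1 + w) / w) ^ (-(p : ℂ))) • (1 : 𝒜) - (1 - powDeriv p J) := by
    have hi : IntegrableOn (fun θ : ℝ => ((betaWeight p θ * θ : ℝ) : ℂ) * (θ + w)⁻¹) (Ioc 0 1) := by
      refine Integrable.mono' ((integrableOn_betaWeight hp0 hp1).mul_const ((w.re)⁻¹)) ?_ ?_
      · have := measurable_betaWeight p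
        exact Measurable.aestronglyMeasurable (by fun_prop)
      · refine (ae_restrict_iff' measurableSet_Ioc).2 (Eventually.of_forall fun θ hθ => ?_)
        have hw' := betaWeight_nonneg hp0 hp1 hθ.1.le hθ.2
        have h1 : ‖((θ : ℂ) + w)⁻¹‖ ≤ (w.re)⁻¹ := by
          rw [add_comm]
          refine (norm_add_ofReal_inv_le hw le_rfl hθ.1.le).trans (inv_anti₀ hw (by linarith [hθ.1]))
        rw [norm_mul, Complex.norm_real, Real.norm_of_nonneg (mul_nonneg hw' hθ.1.le)]
        exact mul_le_mul (mul_le_of_le_one_right hw' hθ.2) h1 (norm_nonneg _) hw'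
    rw [powDeriv, sub_sub_cancel, ← integral_betaWeight_mul_inv hp0 hp1 hw.le hw0,
      ← integral_smul_const, ← integral_sub (hi.smul_const _) (hJ.integrableOn_beta hp0 hp1)]
    refine setIntegral_congr_fun measurableSet_Ioc fun θ hθ => ?_
    have hne : (θ : ℂ) + w ≠ 0 := fun h => by
      have := congrArg Complex.re h
      simp at this; linarith [hθ.1]
    rw [mul_smul_comm, hJ.factor w hθ.1, smul_sub, smul_smul, mul_assoc, inv_mul_cancel₀ hne,
      mul_one]
  have h2 : ∫ y in Ioi (0 : ℝ), (1 - (1 + w) • J 1) *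
      (((stieltjesWeight p y : ℂ) * (1 + w + y)⁻¹) • (1 - (y : ℂ) • J (1 + y))) =
      (1 + w) ^ (-(p : ℂ)) • (1 : 𝒜) - powInt p J := by
    have hw1 : 0 < (1 + w).re := by simp; linarith
    have hi := integrableOn_stieltjesWeight_mul_inv hp0 hp1 hw1
    rw [powInt, ← integral_stieltjesWeight_mul_inv hp0 hp1 hw1,
      ← integral_smul_const, ← integral_sub (hi.smul_const _) (hJ.integrableOn_stieltjes hp0 hp1)]
    refine setIntegral_congr_fun measurableSet_Ioi fun y hy => ?_
    have hy0 : 0 < y := hy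
    have hne : 1 + w + (y : ℂ) ≠ 0 := fun h => by
      have := congrArg Complex.re h
      simp at this; linarith
    have hf := hJ.factor w (r := 1 + y) (by linarith)
    have e : (1 : 𝒜) + (1 - ((1 + y : ℝ) : ℂ)) • J (1 + y) = 1 - (y : ℂ) • J (1 + y) := by
      push_cast; module
    rw [e] at hf
    rw [mul_smul_comm, hf, smul_sub, smul_smul, mul_assoc]
    congr 2
    push_cast
    rw [show 1 + (y : ℂ) + w = 1 + w + y by ring, inv_mul_cancel₀ hne, mul_one]
  rw [quot, mul_add, mul_smul_comm, key (integrableOn_quot_beta hJ hp0 hp1 hw),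
    key (integrableOn_quot_stieltjes hJ hp0 hp1 hw), h1, h2, one_add_div_cpow hw.le hw0]
  module

/-- A zero of `quot` is a zero of the full symbol, hence is `w`, as `s ↦ s^p` is injective on the
half-plane. At `w` the value of `quot` is `1 + w` times the derivative of the symbol, namely `p w^p
(1 + w)^(-p) (1 + w) / w`, which is nonzero. -/
theorem isUnit_quot [NormOneClass 𝒜] (hJ : IsResolvent J) {p : ℝ}
    (hp0 : 0 < p) (hp1 : p < 1) {w : ℂ} (hw : 0 < w.re) : IsUnit (quot p (w ^ (p : ℂ)) w J) := by
  have hw0 : w ≠ 0 := by rintro rfl; simp at hw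
  have hw1 : 0 < (1 + w).re := by simp; linarith
  have hw1' : 1 + w ≠ 0 := fun h => by rw [h] at hw1; simp at hw1
  have hμ0 : w ^ (p : ℂ) ≠ 0 := by simp [Complex.cpow_eq_zero_iff, hw0]
  by_contra hu
  obtain ⟨χ, hχ⟩ := WeakDual.CharacterSpace.exists_apply_eq_zero hu
  have hM : χ (powDeriv p J - w ^ (p : ℂ) • powInt p J) = 0 := by
    rw [powDeriv_sub_eq_mul_quot hJ hp0 hp1 hw, map_mul, hχ, mul_zero]
  obtain ⟨s, hs, hs0, hsw, h1⟩ := exists_root_of_character_eq_zero hJ hp0 hp1 hμ0 hM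
  obtain rfl := cpow_injective_of_re_nonneg hp0 hp1 hs hw.le hs0 hw0 hsw
  rw [quot, map_add, map_smul, smul_eq_mul,
    character_integral χ (integrableOn_quot_beta hJ hp0 hp1 hw),
    character_integral χ (integrableOn_quot_stieltjes hJ hp0 hp1 hw)] at hχ
  have e1 : ∫ θ in Ioc (0 : ℝ) 1, χ ((((betaWeight p θ * θ : ℝ) : ℂ) * (θ + s)⁻¹) •
      (1 + (1 - θ : ℂ) • J θ)) = (1 + s) * ((s ^ 2)⁻¹ * (p * (((1 + s) / s) ^ (-(p : ℂ)) *
        ((1 + s) / s)⁻¹))) := by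
    rw [← integral_betaWeight_mul_sq_inv hp0 hp1 hw, ← integral_const_mul]
    refine setIntegral_congr_fun measurableSet_Ioc fun θ hθ => ?_
    obtain ⟨hne, hθ'⟩ := h1 θ hθ.1
    simp only [map_smul, map_add, map_one, smul_eq_mul, hθ']
    field_simp
    ring
  have e2 : ∫ y in Ioi (0 : ℝ), χ (((stieltjesWeight p y : ℂ) * (1 + s + y)⁻¹) •
      (1 - (y : ℂ) • J (1 + y))) = (1 + s) * (p * ((1 + s) ^ (-(p : ℂ)) * (1 + s)⁻¹)) := by
    rw [← integral_stieltjesWeight_mul_sq_inv hp0 hp1 hw1, ← integral_const_mul]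
    refine setIntegral_congr_fun measurableSet_Ioi fun y hy => ?_
    have hy0 : 0 < y := hy
    obtain ⟨hne, hy'⟩ := h1 (1 + y) (by linarith)
    rw [show ((1 + y : ℝ) : ℂ) + s = 1 + s + y by push_cast; ring] at hne hy'
    simp only [map_smul, map_sub, map_one, smul_eq_mul, hy']
    field_simp
    ring
  rw [e1, e2, one_add_div_cpow hs hs0] at hχ
  have hpc : (p : ℂ) ≠ 0 := by exact_mod_cast hp0.ne'
  have hne := one_add_cpow_ne_zero hs (-(p : ℂ))
  have e3 : (1 + s) * ((s ^ 2)⁻¹ * (p * (s ^ (p : ℂ) * (1 + s) ^ (-(p : ℂ)) * ((1 + s) / s)⁻¹))) +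
      s ^ (p : ℂ) * ((1 + s) * (p * ((1 + s) ^ (-(p : ℂ)) * (1 + s)⁻¹))) =
      p * s ^ (p : ℂ) * (1 + s) ^ (-(p : ℂ)) * ((1 + s) / s) := by
    field_simp
    try ring
  rw [e3] at hχ
  exact (mul_ne_zero (mul_ne_zero (mul_ne_zero hpc hμ0) hne) (div_ne_zero hw1' hs0)) hχ

end FracStable

/-! ### The resolvent algebra of the derivative on bounded functions. -/

namespace FracStable

open MeasureTheory
open scoped BoundedContinuousFunction

section

variable {E : Type*} [NormedAddCommGroup E] [NormedSpace ℝ E]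

/-- Convolution with `s ↦ e^(-r s)` on the half-line. -/
noncomputable def expConv (r : ℝ) (v : ℝ → E) (t : ℝ) : E :=
  volt (fun s => Real.exp (-(r * s))) v t

theorem expConv_eq [CompleteSpace E] (r : ℝ) (v : ℝ → E) (t : ℝ) :
    expConv r v t = Real.exp (-(r * t)) • ∫ s in (0 : ℝ)..t, Real.exp (r * s) • v s := by
  rw [expConv, volt_flip, ← intervalIntegral.integral_smul]
  congr 1; ext s
  rw [smul_smul, ← Real.exp_add]
  ring_nf

theorem hasDerivAt_expConv [CompleteSpace E] (r : ℝ) {v : ℝ → E} (hv : Continuous v) (t : ℝ) :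
    HasDerivAt (expConv r v) (v t - r • expConv r v t) t := by
  have h0 : expConv r v = fun t =>
      Real.exp (-(r * t)) • ∫ s in (0 : ℝ)..t, Real.exp (r * s) • v s := by
    ext t; exact expConv_eq r v t
  have hc : Continuous fun s => Real.exp (r * s) • v s := by fun_prop
  have h1 : HasDerivAt (fun t => ∫ s in (0 : ℝ)..t, Real.exp (r * s) • v s)
      (Real.exp (r * t) • v t) t :=
    intervalIntegral.integral_hasDerivAt_right (hc.intervalIntegrable _ _)
      (hc.stronglyMeasurableAtFilter _ _) hc.continuousAt
  have h2 : HasDerivAt (fun t => Real.exp (-(r * t))) (Real.exp (-(r * t)) * (-r)) t := by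
    have : HasDerivAt (fun t : ℝ => -(r * t)) (-r) t := by
      simpa using ((hasDerivAt_id t).const_mul r).fun_neg
    exact this.exp
  have h3 := h2.fun_smul h1
  rw [h0]
  refine h3.congr_deriv ?_
  rw [smul_smul, ← Real.exp_add, neg_add_cancel, Real.exp_zero, one_smul, smul_smul, sub_eq_add_neg,
    ← neg_smul]
  congr 2
  ring

theorem continuous_expConv [CompleteSpace E] (r : ℝ) {v : ℝ → E} (hv : Continuous v) :
    Continuous (expConv r v) :=
  continuous_iff_continuousAt.2 fun t => (hasDerivAt_expConv r hv t).continuousAt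

theorem norm_expConv_le {r C : ℝ} (hr : 0 < r) {v : ℝ → E}
    (hC : ∀ t, ‖v t‖ ≤ C) {t : ℝ} (ht : 0 ≤ t) : ‖expConv r v t‖ ≤ C / r := by
  have hC0 : 0 ≤ C := (norm_nonneg _).trans (hC 0)
  have h1 := norm_volt_le (a := fun s => Real.exp (-(r * s))) (g := v) (b := fun _ => C) ht
    (fun s _ => (Real.exp_pos _).le) (Continuous.intervalIntegrable (by fun_prop) _ _)
    continuousOn_const (fun s _ => hC s)
  refine h1.trans ?_
  have h2 : volt (fun s => Real.exp (-(r * s))) (fun _ => C) t =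
      (∫ s in Ioc 0 t, Real.exp (-(r * s))) * C := by
    rw [volt, intervalIntegral.integral_of_le ht, ← integral_mul_const]
    rfl
  have h3 : ∫ s in Ioi (0 : ℝ), Real.exp (-(r * s)) = 1 / r := by
    have := Real.integral_rpow_mul_exp_neg_mul_Ioi one_pos hr
    simpa using this
  rw [h2, div_eq_mul_one_div, mul_comm, ← h3]
  refine mul_le_mul_of_nonneg_left ?_ hC0
  exact setIntegral_mono_set (integrableOn_exp_neg_mul hr)
    (Eventually.of_forall fun s => (Real.exp_pos _).le) (Eventually.of_forall Ioc_subset_Ioi_self)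

theorem eq_expConv_of_hasDerivAt [CompleteSpace E] {r : ℝ} {y z : ℝ → E} (hz : Continuous z)
    (hy0 : y 0 = 0) {t : ℝ} (ht : 0 ≤ t) (hy : ContinuousOn y (Icc 0 t))
    (hd : ∀ s ∈ Ioo 0 t, HasDerivAt y (z s - r • y s) s) : y t = expConv r z t := by
  have h1 := intervalIntegral.integral_eq_sub_of_hasDerivAt_of_le ht
    (f := fun s => Real.exp (r * s) • y s) (f' := fun s => Real.exp (r * s) • z s)
    (ContinuousOn.smul (by fun_prop) hy) (fun s hs => by
      have h2 : HasDerivAt (fun t => Real.exp (r * t)) (Real.exp (r * s) * r) s := by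
        have : HasDerivAt (fun t : ℝ => r * t) r s := by
          simpa using (hasDerivAt_id s).const_mul r
        exact this.exp
      refine (h2.fun_smul (hd s hs)).congr_deriv ?_
      rw [smul_sub, smul_smul]
      abel) (Continuous.intervalIntegrable (by fun_prop) _ _)
  rw [expConv_eq, h1, hy0, smul_zero, sub_zero, smul_smul, ← Real.exp_add, neg_add_cancel,
    Real.exp_zero, one_smul]

/-- The function `y = expConv q v` satisfies `y' + r y = v + (r - q) y` and `y 0 = 0`, so it is also
the convolution with `e^(-rs)` of that right side. -/
theorem expConv_resolvent [CompleteSpace E] (r q : ℝ) {v : ℝ → E} (hv : Continuous v) {t : ℝ}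
    (ht : 0 ≤ t) : expConv r v t - expConv q v t = (q - r) • expConv r (expConv q v) t := by
  have hc := continuous_expConv q hv
  have h1 := eq_expConv_of_hasDerivAt (r := r) (y := expConv q v)
    (z := fun s => v s + (r - q) • expConv q v s) (by fun_prop) (volt_zero_right _ _) ht
    hc.continuousOn (fun s _ => (hasDerivAt_expConv q hv s).congr_deriv (by module))
  have hi : IntervalIntegrable (fun s => Real.exp (-(r * s))) volume 0 t :=
    Continuous.intervalIntegrable (by fun_prop) _ _
  have h2 : expConv r (fun s => v s + (r - q) • expConv q v s) t =
      expConv r v t + (r - q) • expConv r (expConv q v) t := by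
    rw [expConv, volt_add (h := fun s => (r - q) • expConv q v s) ht hi hv.continuousOn
      (by fun_prop), expConv, expConv]
    congr 1
    rw [volt, volt]
    rw [← intervalIntegral.integral_smul]
    congr 1; ext s; rw [smul_comm]
  rw [h2] at h1
  rw [h1]
  module

theorem tendsto_expConv {r C : ℝ} (hr : 0 < r) {v : ℝ → E} (hv : Continuous v)
    (hC : ∀ t, ‖v t‖ ≤ C) (hlim : Tendsto v atTop (𝓝 0)) :
    Tendsto (expConv r v) atTop (𝓝 0) := by
  have h1 : Tendsto (fun t : ℝ => ∫ s in Ioi (0 : ℝ), (Iic t).indicator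
      (fun s => Real.exp (-(r * s)) • v (t - s)) s) atTop (𝓝 (∫ _ in Ioi (0 : ℝ), (0 : E))) := by
    refine tendsto_integral_filter_of_dominated_convergence
      (fun s => Real.exp (-(r * s)) * C) ?_ ?_ ((integrableOn_exp_neg_mul hr).mul_const C) ?_
    · refine Eventually.of_forall fun t => AEStronglyMeasurable.indicator ?_ measurableSet_Iic
      exact (by fun_prop : Continuous fun s => Real.exp (-(r * s)) • v (t - s)).aestronglyMeasurable
    · refine Eventually.of_forall fun t => Eventually.of_forall fun s => ?_
      refine (norm_indicator_le_norm_self _ _).trans ?_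
      rw [norm_smul, Real.norm_of_nonneg (Real.exp_pos _).le]
      exact mul_le_mul_of_nonneg_left (hC _) (Real.exp_pos _).le
    · refine Eventually.of_forall fun s => ?_
      have h2 : Tendsto (fun t => Real.exp (-(r * s)) • v (t - s)) atTop (𝓝 0) := by
        have := (hlim.comp (tendsto_atTop_add_const_right atTop (-s) tendsto_id)).const_smul
          (Real.exp (-(r * s)))
        simpa [sub_eq_add_neg] using this
      refine h2.congr' ?_
      filter_upwards [eventually_ge_atTop s] with t ht
      rw [indicator_of_mem (show s ∈ Iic t from ht)]
  rw [integral_zero] at h1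
  refine h1.congr' ?_
  filter_upwards [eventually_ge_atTop 0] with t ht
  rw [expConv, volt, intervalIntegral.integral_of_le ht, setIntegral_indicator measurableSet_Iic,
    Ioi_inter_Iic]

end

/-- The resolvent `(r + D)⁻¹` of the derivative with zero initial value, acting on bounded
continuous functions (functions are only considered on the half-line). -/
noncomputable def resolventFun {r : ℝ} (hr : 0 < r) (v : ℝ →ᵇ ℂ) : ℝ →ᵇ ℂ :=
  BoundedContinuousFunction.ofNormedAddCommGroup (fun t => expConv r v (max t 0))
    ((continuous_expConv r v.continuous).comp (by fun_prop)) (‖v‖ / r)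
    (fun _ => norm_expConv_le hr v.norm_coe_le_norm (le_max_right _ _))

theorem resolventFun_apply {r : ℝ} (hr : 0 < r) (v : ℝ →ᵇ ℂ) (t : ℝ) :
    resolventFun hr v t = expConv r v (max t 0) := rfl

theorem norm_resolventFun_le {r : ℝ} (hr : 0 < r) (v : ℝ →ᵇ ℂ) : ‖resolventFun hr v‖ ≤ ‖v‖ / r :=
  (BoundedContinuousFunction.norm_le (by positivity)).2 fun _ =>
    norm_expConv_le hr v.norm_coe_le_norm (le_max_right _ _)

theorem intervalIntegrable_exp (r a b : ℝ) :
    IntervalIntegrable (fun s => Real.exp (-(r * s))) volume a b :=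
  Continuous.intervalIntegrable (by fun_prop) _ _

/-- `resolventFun` as a continuous linear map. -/
noncomputable def resolventCLM {r : ℝ} (hr : 0 < r) : (ℝ →ᵇ ℂ) →L[ℂ] (ℝ →ᵇ ℂ) :=
  LinearMap.mkContinuous
    { toFun := resolventFun hr
      map_add' := fun v w => by
        ext t
        exact volt_add (le_max_right _ _) (intervalIntegrable_exp _ _ _) v.continuous.continuousOn
          w.continuous.continuousOn
      map_smul' := fun c v => by
        ext t
        simp only [resolventFun_apply, expConv, volt, BoundedContinuousFunction.coe_smul,
          RingHom.id_apply]
        rw [← intervalIntegral.integral_smul]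
        congr 1; ext s; rw [smul_comm] }
    (1 / r) (fun v => by
      rw [one_div_mul_eq_div]
      exact norm_resolventFun_le hr v)

theorem resolventCLM_apply {r : ℝ} (hr : 0 < r) (v : ℝ →ᵇ ℂ) (t : ℝ) :
    resolventCLM hr v t = expConv r v (max t 0) := rfl

theorem resolventCLM_sub {r q : ℝ} (hr : 0 < r) (hq : 0 < q) :
    resolventCLM hr - resolventCLM hq = ((q - r : ℝ) : ℂ) • (resolventCLM hr * resolventCLM hq) := by
  ext v t
  have h := expConv_resolvent r q v.continuous (le_max_right t 0)
  have h2 : expConv r (expConv q v) (max t 0) = expConv r (resolventCLM hq v) (max t 0) := by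
    refine volt_congr (le_max_right _ _) fun s hs => ?_
    rw [resolventCLM_apply, max_eq_left hs.1]
  rw [h2] at h
  simpa [resolventCLM_apply] using h

theorem resolventCLM_comm {r q : ℝ} (hr : 0 < r) (hq : 0 < q) :
    resolventCLM hr * resolventCLM hq = resolventCLM hq * resolventCLM hr := by
  rcases eq_or_ne r q with rfl | hne
  · rfl
  · have h1 := resolventCLM_sub hr hq
    have h2 := resolventCLM_sub hq hr
    have hc : ((q - r : ℝ) : ℂ) ≠ 0 := by exact_mod_cast sub_ne_zero.2 hne.symm
    have h3 : ((q - r : ℝ) : ℂ) • (resolventCLM hr * resolventCLM hq) =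
        ((q - r : ℝ) : ℂ) • (resolventCLM hq * resolventCLM hr) := by
      rw [← h1, ← neg_sub, h2]
      push_cast
      module
    exact smul_right_injective _ hc h3

/-- The closed subalgebra generated by the resolvents. -/
noncomputable def resolventAlgebra : Subalgebra ℂ ((ℝ →ᵇ ℂ) →L[ℂ] (ℝ →ᵇ ℂ)) :=
  (Algebra.adjoin ℂ {a | ∃ (r : ℝ) (hr : 0 < r), a = resolventCLM hr}).topologicalClosure

theorem resolventAlgebra_mul_comm (a b : resolventAlgebra) : a * b = b * a := by
  have h1 : ∀ x y : Algebra.adjoin ℂ {a | ∃ (r : ℝ) (hr : 0 < r), a = resolventCLM hr},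
      x * y = y * x :=
    (Algebra.isMulCommutative_adjoin ℂ (by
      rintro _ ⟨r, hr, rfl⟩ _ ⟨q, hq, rfl⟩
      exact resolventCLM_comm hr hq)).is_comm.comm
  exact (Subalgebra.commRingTopologicalClosure _ h1).mul_comm a b

noncomputable instance : NormedCommRing resolventAlgebra :=
  { (inferInstance : NormedRing resolventAlgebra) with
    mul_comm := resolventAlgebra_mul_comm }

instance : CompleteSpace resolventAlgebra :=
  (Subalgebra.isClosed_topologicalClosure _).completeSpace_coe

instance : Nontrivial (ℝ →ᵇ ℂ) :=
  ⟨⟨0, BoundedContinuousFunction.const ℝ 1, fun h => by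
    simpa using DFunLike.congr_fun h (0 : ℝ)⟩⟩

instance : NormOneClass resolventAlgebra :=
  ⟨(norm_one : ‖(1 : (ℝ →ᵇ ℂ) →L[ℂ] (ℝ →ᵇ ℂ))‖ = 1)⟩

/-- The resolvents as elements of the resolvent algebra. -/
noncomputable def resolventElem (r : ℝ) : resolventAlgebra :=
  if hr : 0 < r then ⟨resolventCLM hr,
    Subalgebra.le_topologicalClosure _ (Algebra.subset_adjoin ⟨r, hr, rfl⟩)⟩ else 0

theorem coe_resolventElem {r : ℝ} (hr : 0 < r) :
    (resolventElem r : (ℝ →ᵇ ℂ) →L[ℂ] (ℝ →ᵇ ℂ)) = resolventCLM hr := by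
  rw [resolventElem, dif_pos hr]

theorem isResolvent_resolventElem : IsResolvent resolventElem where
  norm_le r hr := by
    change ‖(resolventElem r : (ℝ →ᵇ ℂ) →L[ℂ] (ℝ →ᵇ ℂ))‖ ≤ 1 / r
    rw [coe_resolventElem hr]
    exact LinearMap.mkContinuous_norm_le _ (by positivity) _
  resolvent r q hr hq := by
    apply Subtype.ext
    have := resolventCLM_sub hr hq
    rw [← coe_resolventElem hr, ← coe_resolventElem hq] at this
    exact this

/-- The operators preserving decay at infinity form a closed subalgebra that contains the
resolvents. The conclusion therefore also covers inverses of units of the resolvent algebra. -/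
theorem tendsto_resolventAlgebra (a : resolventAlgebra) {v : ℝ →ᵇ ℂ}
    (hv : Tendsto v atTop (𝓝 0)) :
    Tendsto ((a : (ℝ →ᵇ ℂ) →L[ℂ] (ℝ →ᵇ ℂ)) v) atTop (𝓝 0) := by
  let K : Subalgebra ℂ ((ℝ →ᵇ ℂ) →L[ℂ] (ℝ →ᵇ ℂ)) :=
    { carrier := {a | ∀ v : ℝ →ᵇ ℂ, Tendsto v atTop (𝓝 0) → Tendsto (a v) atTop (𝓝 0)}
      mul_mem' := fun {a b} ha hb v hv => ha _ (hb v hv)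
      add_mem' := fun {a b} ha hb v hv => by
        have := (ha v hv).add (hb v hv)
        rw [add_zero] at this
        exact this
      algebraMap_mem' := fun c v hv => by
        simpa [Algebra.algebraMap_eq_smul_one] using hv.const_smul c }
  have hK : IsClosed (K : Set ((ℝ →ᵇ ℂ) →L[ℂ] (ℝ →ᵇ ℂ))) := by
    refine isClosed_of_closure_subset fun a ha v hv => ?_
    rw [Metric.tendsto_nhds]
    intro ε hε
    obtain ⟨b, hb, hab⟩ := Metric.mem_closure_iff.1 ha (ε / (2 * (‖v‖ + 1))) (by positivity)
    have h1 := (Metric.tendsto_nhds.1 (hb v hv)) (ε / 2) (by positivity)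
    filter_upwards [h1] with t ht
    rw [dist_zero_right] at ht ⊢
    have h2 : ‖(a v - b v) t‖ ≤ ε / 2 := by
      refine (BoundedContinuousFunction.norm_coe_le_norm _ _).trans ?_
      rw [← sub_apply]
      refine ((a - b).le_opNorm v).trans ?_
      rw [dist_eq_norm] at hab
      calc ‖a - b‖ * ‖v‖ ≤ ε / (2 * (‖v‖ + 1)) * (‖v‖ + 1) := by gcongr; linarith
        _ = ε / 2 := by field_simp
    calc ‖(a v) t‖ = ‖(a v - b v) t + (b v) t‖ := by simp
      _ ≤ ‖(a v - b v) t‖ + ‖(b v) t‖ := norm_add_le _ _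
      _ < ε := by linarith
  have hle : resolventAlgebra ≤ K := by
    refine Subalgebra.topologicalClosure_minimal (Algebra.adjoin_le ?_) hK
    rintro _ ⟨r, hr, rfl⟩ v hv
    refine (tendsto_expConv hr v.continuous v.norm_coe_le_norm hv).congr' ?_
    filter_upwards [eventually_ge_atTop 0] with t ht
    rw [resolventCLM_apply, max_eq_left ht]
  exact hle a.2 v hv

end FracStable

/-! ### Fractional powers of the derivative as concrete operators. -/

namespace FracStable

open MeasureTheory
open scoped BoundedContinuousFunction

/-- The action of an element of the resolvent algebra. -/
noncomputable def act (a : resolventAlgebra) (v : ℝ →ᵇ ℂ) : ℝ →ᵇ ℂ :=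
  (a : (ℝ →ᵇ ℂ) →L[ℂ] (ℝ →ᵇ ℂ)) v

theorem norm_act_le (a : resolventAlgebra) (v : ℝ →ᵇ ℂ) : ‖act a v‖ ≤ ‖a‖ * ‖v‖ :=
  (a : (ℝ →ᵇ ℂ) →L[ℂ] (ℝ →ᵇ ℂ)).le_opNorm v

theorem act_mul (a b : resolventAlgebra) (v : ℝ →ᵇ ℂ) : act (a * b) v = act a (act b v) := rfl

theorem act_one (v : ℝ →ᵇ ℂ) : act 1 v = v := rfl

theorem act_sub (a b : resolventAlgebra) (v : ℝ →ᵇ ℂ) : act (a - b) v = act a v - act b v := rfl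

theorem act_smul_apply (c : ℂ) (a : resolventAlgebra) (v : ℝ →ᵇ ℂ) (t : ℝ) :
    act (c • a) v t = c • act a v t := rfl

/-- Evaluation of `act a v` at a point, as a functional of `a`. -/
noncomputable def actEval (v : ℝ →ᵇ ℂ) (t : ℝ) : resolventAlgebra →L[ℂ] ℂ :=
  LinearMap.mkContinuous
    { toFun := fun a => act a v t
      map_add' := fun _ _ => rfl
      map_smul' := fun _ _ => rfl } ‖v‖
    (fun a => by
      rw [mul_comm]
      exact (BoundedContinuousFunction.norm_coe_le_norm _ t).trans (norm_act_le a v))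

theorem act_integral {s : Set ℝ} {f : ℝ → resolventAlgebra} (hf : IntegrableOn f s) (v : ℝ →ᵇ ℂ)
    (t : ℝ) : act (∫ x in s, f x) v t = ∫ x in s, act (f x) v t :=
  ((actEval v t).integral_comp_comm hf).symm

theorem act_resolventElem {r : ℝ} (hr : 0 < r) (v : ℝ →ᵇ ℂ) {t : ℝ} (ht : 0 ≤ t) :
    act (resolventElem r) v t = expConv r v t := by
  rw [act, coe_resolventElem hr, resolventCLM_apply, max_eq_left ht]

/-- The kernel of `(1 + D)^(-p)`. -/
noncomputable def expKer (p s : ℝ) : ℝ := ker p s * Real.exp (-s)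

theorem intervalIntegrable_expKer {p : ℝ} (hp0 : 0 < p) (t : ℝ) :
    IntervalIntegrable (expKer p) volume 0 t :=
  (intervalIntegrable_ker hp0 t).mul_continuousOn (by fun_prop)

theorem integral_stieltjesWeight_mul_exp {p : ℝ} (hp1 : p < 1) {s : ℝ} (hs : 0 < s) :
    ∫ y in Ioi (0 : ℝ), stieltjesWeight p y * Real.exp (-((1 + y) * s)) = expKer p s := by
  have h := Real.integral_rpow_mul_exp_neg_mul_Ioi (a := 1 - p) (by linarith) hs
  have h2 : ∀ y : ℝ, stieltjesWeight p y * Real.exp (-((1 + y) * s)) =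
      (y ^ (1 - p - 1) * Real.exp (-(s * y))) *
        (Real.exp (-s) / (Real.Gamma p * Real.Gamma (1 - p))) := by
    intro y
    rw [stieltjesWeight, show -((1 + y) * s) = -(s * y) + -s by ring, Real.exp_add,
      show 1 - p - 1 = -p by ring]
    ring
  simp_rw [h2]
  rw [integral_mul_const, h, expKer, ker, one_div, Real.inv_rpow hs.le, ← Real.rpow_neg hs.le,
    neg_sub]
  have := (Real.Gamma_pos_of_pos (show 0 < 1 - p by linarith)).ne'
  field_simp

theorem integrableOn_stieltjesWeight_mul_exp {p : ℝ} (hp1 : p < 1) {s : ℝ} (hs : 0 < s) :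
    IntegrableOn (fun y => stieltjesWeight p y * Real.exp (-((1 + y) * s))) (Ioi 0) := by
  have := (integrableOn_rpow_mul_exp (q := -p) (by linarith) hs).mul_const
    (Real.exp (-s) / (Real.Gamma p * Real.Gamma (1 - p)))
  refine this.congr (Eventually.of_forall fun y => ?_)
  simp only
  rw [stieltjesWeight, show -((1 + y) * s) = -(s * y) + -s by ring, Real.exp_add]
  ring

variable {p : ℝ}

/-- By Fubini, since `expKer p` is the superposition of the exponentials `e^(-(1+y)s)` with weight
`stieltjesWeight p`. -/
theorem act_powInt (hp0 : 0 < p) (hp1 : p < 1) (v : ℝ →ᵇ ℂ) {t : ℝ} (ht : 0 ≤ t) :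
    act (powInt p resolventElem) v t = volt (expKer p) v t := by
  rw [powInt, act_integral (isResolvent_resolventElem.integrableOn_stieltjes hp0 hp1), volt,
    intervalIntegral.integral_of_le ht]
  have hmw := measurable_stieltjesWeight p
  have hmeas : AEStronglyMeasurable (Function.uncurry fun (y s : ℝ) =>
      (stieltjesWeight p y * Real.exp (-((1 + y) * s))) • v (t - s))
      ((volume.restrict (Ioi (0 : ℝ))).prod (volume.restrict (Ioc 0 t))) := by
    refine Measurable.aestronglyMeasurable ?_
    have := v.continuous.measurable
    unfold Function.uncurry
    fun_prop
  have hint : Integrable (Function.uncurry fun (y s : ℝ) =>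
      (stieltjesWeight p y * Real.exp (-((1 + y) * s))) • v (t - s))
      ((volume.restrict (Ioi (0 : ℝ))).prod (volume.restrict (Ioc 0 t))) := by
    rw [integrable_prod_iff' hmeas]
    constructor
    · refine (ae_restrict_iff' measurableSet_Ioc).2 (Eventually.of_forall fun s hs => ?_)
      exact Integrable.smul_const (integrableOn_stieltjesWeight_mul_exp hp1 hs.1) (v (t - s))
    · have h1 : IntegrableOn (fun s => expKer p s * ‖v (t - s)‖) (Ioc 0 t) :=
        (intervalIntegrable_iff_integrableOn_Ioc_of_le ht).1
          ((intervalIntegrable_expKer hp0 t).mul_continuousOn (by fun_prop))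
      refine h1.congr ((ae_restrict_iff' measurableSet_Ioc).2 (Eventually.of_forall fun s hs => ?_))
      simp only [Function.uncurry_apply_pair]
      rw [← integral_stieltjesWeight_mul_exp hp1 hs.1, ← integral_mul_const]
      refine setIntegral_congr_fun measurableSet_Ioi fun y hy => ?_
      have hy0 : 0 < y := hy
      rw [norm_smul, Real.norm_of_nonneg
        (mul_nonneg (stieltjesWeight_nonneg hp0 hp1 hy0.le) (Real.exp_pos _).le)]
  have hswap := integral_integral_swap hint
  have hL : ∀ y ∈ Ioi (0 : ℝ), ∫ s in Ioc 0 t,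
      (stieltjesWeight p y * Real.exp (-((1 + y) * s))) • v (t - s) =
      act ((stieltjesWeight p y : ℂ) • resolventElem (1 + y)) v t := by
    intro y hy
    have hy0 : 0 < y := hy
    rw [act_smul_apply, act_resolventElem (by linarith) v ht, expConv,
      volt, intervalIntegral.integral_of_le ht, Complex.coe_smul, ← integral_smul]
    simp only [mul_smul]
  have hR : ∀ s ∈ Ioc 0 t, ∫ y in Ioi (0 : ℝ),
      (stieltjesWeight p y * Real.exp (-((1 + y) * s))) • v (t - s) = expKer p s • v (t - s) := by
    intro s hs
    rw [integral_smul_const, integral_stieltjesWeight_mul_exp hp1 hs.1]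
  rw [setIntegral_congr_fun measurableSet_Ioi hL, setIntegral_congr_fun measurableSet_Ioc hR]
    at hswap
  exact hswap

theorem act_powInt_zero (hp0 : 0 < p) (hp1 : p < 1) (v : ℝ →ᵇ ℂ) :
    act (powInt p resolventElem) v 0 = 0 := by
  rw [act_powInt hp0 hp1 v le_rfl, volt_zero_right]

theorem act_powDeriv (hp0 : 0 < p) (hp1 : p < 1) (v : ℝ →ᵇ ℂ) {t : ℝ} (ht : 0 ≤ t) :
    act (powDeriv p resolventElem) v t =
      v t - ∫ θ in Ioc (0 : ℝ) 1, (betaWeight p θ * θ) • expConv θ v t := by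
  rw [powDeriv, act_sub, act_one, BoundedContinuousFunction.coe_sub, Pi.sub_apply,
    act_integral (isResolvent_resolventElem.integrableOn_beta hp0 hp1)]
  congr 1
  refine setIntegral_congr_fun measurableSet_Ioc fun θ hθ => ?_
  rw [act_smul_apply, act_resolventElem hθ.1 v ht, Complex.coe_smul]

theorem continuous_expConv_left {v : ℝ → ℂ} (hv : Continuous v) (t : ℝ) :
    Continuous fun r => expConv r v t := by
  unfold expConv volt
  exact intervalIntegral.continuous_parametric_intervalIntegral_of_continuous (by fun_prop)
    continuous_const

/-- The composed kernel is the integral of `betaWeight p θ * e^(-θs)` over `θ`. In this form the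
fractional derivative can be taken under the integral sign. -/
theorem volt_ker_act_powInt (hp0 : 0 < p) (hp1 : p < 1) (v : ℝ →ᵇ ℂ) {t : ℝ} (ht : 0 < t) :
    volt (ker (1 - p)) (act (powInt p resolventElem) v) t =
      ∫ θ in Ioc (0 : ℝ) 1, betaWeight p θ • expConv θ v t := by
  have hmw := measurable_betaWeight p
  have h1 : volt (ker (1 - p)) (act (powInt p resolventElem) v) t =
      ∫ s in Ioc 0 t, ∫ θ in Ioc (0 : ℝ) 1,
        (betaWeight p θ * Real.exp (-(θ * s))) • v (t - s) := by
    rw [volt_congr ht.le fun s hs => act_powInt hp0 hp1 v hs.1, volt_volt ht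
      (intervalIntegrable_ker (by linarith) t) (intervalIntegrable_expKer hp0 t)
      v.continuous.continuousOn, volt, intervalIntegral.integral_of_le ht.le]
    refine setIntegral_congr_fun measurableSet_Ioc fun s hs => ?_
    have := volt_ker_ker_mul (p := p) (fun s => Real.exp (-s)) hs.1
    rw [integral_smul_const]
    congr 1
    refine this.trans ?_
    rw [intervalIntegral.integral_of_le zero_le_one]
    simp only [mul_comm s]
  have hint : Integrable (Function.uncurry fun (s θ : ℝ) =>
      (betaWeight p θ * Real.exp (-(θ * s))) • v (t - s))
      ((volume.restrict (Ioc 0 t)).prod (volume.restrict (Ioc (0 : ℝ) 1))) := by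
    have hb : Integrable (fun z : ℝ × ℝ => ‖v‖ * betaWeight p z.2)
        ((volume.restrict (Ioc 0 t)).prod (volume.restrict (Ioc (0 : ℝ) 1))) :=
      (integrable_const (μ := volume.restrict (Ioc 0 t)) ‖v‖).mul_prod
        (integrableOn_betaWeight hp0 hp1)
    refine Integrable.mono' hb ?_ ?_
    · refine Measurable.aestronglyMeasurable ?_
      have := v.continuous.measurable
      unfold Function.uncurry
      fun_prop
    · rw [Measure.prod_restrict]
      refine (ae_restrict_iff' (measurableSet_Ioc.prod measurableSet_Ioc)).2
        (Eventually.of_forall ?_)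
      rintro ⟨s, θ⟩ ⟨hs, hθ⟩
      have hw := betaWeight_nonneg hp0 hp1 hθ.1.le hθ.2
      simp only [Function.uncurry_apply_pair]
      rw [norm_smul, Real.norm_of_nonneg (mul_nonneg hw (Real.exp_pos _).le), mul_comm ‖v‖]
      refine mul_le_mul (mul_le_of_le_one_right hw ?_) (v.norm_coe_le_norm _) (norm_nonneg _) hw
      rw [Real.exp_le_one_iff]
      have := mul_nonneg hθ.1.le hs.1.le
      simp only at this ⊢
      linarith
  rw [h1, integral_integral_swap hint]
  refine setIntegral_congr_fun measurableSet_Ioc fun θ hθ => ?_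
  rw [expConv, volt, intervalIntegral.integral_of_le ht.le, ← integral_smul]
  simp only [mul_smul]

/-- `(1 + D)^(-p) v` has the fractional derivative `(D / (1 + D))^p v`. -/
theorem hasDerivAt_volt_act_powInt (hp0 : 0 < p) (hp1 : p < 1) (v : ℝ →ᵇ ℂ) {t : ℝ} (ht : 0 < t) :
    HasDerivAt (volt (ker (1 - p)) (act (powInt p resolventElem) v))
      (act (powDeriv p resolventElem) v t) t := by
  have hbI := integrableOn_betaWeight hp0 hp1
  have hmw := measurable_betaWeight p
  have hEm : ∀ u, AEStronglyMeasurable (fun θ => expConv θ v u) (volume.restrict (Ioc (0 : ℝ) 1)) :=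
    fun u => (continuous_expConv_left v.continuous u).aestronglyMeasurable
  have hEb : ∀ {θ u : ℝ}, θ ∈ Ioc (0 : ℝ) 1 → 0 < u → ‖θ • expConv θ v u‖ ≤ ‖v‖ := by
    intro θ u hθ hu
    have := norm_expConv_le hθ.1 v.norm_coe_le_norm hu.le
    rw [norm_smul, Real.norm_of_nonneg hθ.1.le]
    rwa [le_div_iff₀' hθ.1] at this
  have hint : ∀ {u : ℝ}, 0 < u → IntegrableOn (fun θ => betaWeight p θ • expConv θ v u) (Ioc 0 1) := by
    intro u hu
    obtain ⟨C, hC⟩ := (isCompact_Icc (a := (0 : ℝ)) (b := 1)).exists_bound_of_continuousOn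
      (continuous_expConv_left v.continuous u).continuousOn
    refine Integrable.mono' (hbI.mul_const C) (hmw.aestronglyMeasurable.smul (hEm u)) ?_
    refine (ae_restrict_iff' measurableSet_Ioc).2 (Eventually.of_forall fun θ hθ => ?_)
    have hw := betaWeight_nonneg hp0 hp1 hθ.1.le hθ.2
    rw [norm_smul, Real.norm_of_nonneg hw]
    exact mul_le_mul_of_nonneg_left (hC θ (Ioc_subset_Icc_self hθ)) hw
  have hint2 : IntegrableOn (fun θ => (betaWeight p θ * θ) • expConv θ v t) (Ioc 0 1) := by
    refine Integrable.mono' (hbI.mul_const ‖v‖)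
      ((hmw.mul measurable_id).aestronglyMeasurable.smul (hEm t)) ?_
    refine (ae_restrict_iff' measurableSet_Ioc).2 (Eventually.of_forall fun θ hθ => ?_)
    have hw := betaWeight_nonneg hp0 hp1 hθ.1.le hθ.2
    rw [mul_smul, norm_smul, Real.norm_of_nonneg hw]
    exact mul_le_mul_of_nonneg_left (hEb hθ ht) hw
  -- The derivative of `(θ + D)⁻¹ v` is `v - θ (θ + D)⁻¹ v`, bounded by `2 ‖v‖` uniformly in `θ`;
  -- the weight has mass `1`, so the first term integrates to `v t`.
  have key := hasDerivAt_integral_of_dominated_loc_of_deriv_le (𝕜 := ℝ)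
    (μ := volume.restrict (Ioc (0 : ℝ) 1)) (x₀ := t) (s := Ioi 0)
    (F := fun u θ => betaWeight p θ • expConv θ v u)
    (F' := fun u θ => betaWeight p θ • (v u - θ • expConv θ v u))
    (bound := fun θ => betaWeight p θ * (‖v‖ + ‖v‖)) (Ioi_mem_nhds ht)
    (Eventually.of_forall fun u => hmw.aestronglyMeasurable.smul (hEm u)) (hint ht)
    (hmw.aestronglyMeasurable.smul (aestronglyMeasurable_const.sub
      (aestronglyMeasurable_id.smul (hEm t))))
    ((ae_restrict_iff' measurableSet_Ioc).2 (Eventually.of_forall fun θ hθ u hu => by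
      have hw := betaWeight_nonneg hp0 hp1 hθ.1.le hθ.2
      rw [norm_smul, Real.norm_of_nonneg hw]
      exact mul_le_mul_of_nonneg_left ((norm_sub_le _ _).trans
        (add_le_add (v.norm_coe_le_norm _) (hEb hθ hu))) hw))
    (hbI.mul_const _)
    (Eventually.of_forall fun θ u _ => (hasDerivAt_expConv θ v.continuous u).fun_const_smul _)
  have h2 : ∫ θ in Ioc (0 : ℝ) 1, betaWeight p θ • (v t - θ • expConv θ v t) =
      act (powDeriv p resolventElem) v t := by
    have hI1 : ∫ θ in Ioc (0 : ℝ) 1, betaWeight p θ • v t = v t := by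
      rw [integral_smul_const, ← intervalIntegral.integral_of_le zero_le_one,
        integral_betaWeight hp0 hp1, one_smul]
    rw [act_powDeriv hp0 hp1 v ht.le]
    conv_rhs => rw [← hI1]
    rw [← integral_sub (hbI.smul_const _) hint2]
    congr 1; ext θ
    rw [smul_sub, mul_smul]
  rw [← h2]
  refine key.2.congr_of_eventuallyEq ?_
  filter_upwards [Ioi_mem_nhds ht] with u hu
  exact volt_ker_act_powInt hp0 hp1 v hu

end FracStable

/-! ### Bounded solutions of the scalar equation. -/

namespace FracStable

open MeasureTheory
open scoped BoundedContinuousFunction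

variable {p : ℝ}

/-- A function with value `1` at time `0`, decaying to `0`, with decaying fractional derivative. -/
noncomputable def liftFun (p : ℝ) : ℝ →ᵇ ℂ := 1 - act (powInt p resolventElem) 1

/-- Minus the fractional derivative of `liftFun`. -/
noncomputable def liftDeriv (p : ℝ) : ℝ →ᵇ ℂ := act (powDeriv p resolventElem) 1

theorem act_sub_right (a : resolventAlgebra) (v w : ℝ →ᵇ ℂ) : act a (v - w) = act a v - act a w :=
  map_sub (a : (ℝ →ᵇ ℂ) →L[ℂ] (ℝ →ᵇ ℂ)) v w

theorem act_smul_right (a : resolventAlgebra) (c : ℂ) (v : ℝ →ᵇ ℂ) : act a (c • v) = c • act a v :=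
  map_smul (a : (ℝ →ᵇ ℂ) →L[ℂ] (ℝ →ᵇ ℂ)) c v

theorem liftFun_zero (hp0 : 0 < p) (hp1 : p < 1) : liftFun p 0 = 1 := by
  change 1 - act (powInt p resolventElem) 1 0 = 1
  rw [act_powInt_zero hp0 hp1, sub_zero]

/-- On the half-line `liftFun p` is the tail of the probability density `expKer p`. -/
theorem tendsto_liftFun (hp0 : 0 < p) (hp1 : p < 1) : Tendsto (liftFun p) atTop (𝓝 0) := by
  have hi : IntegrableOn (expKer p) (Ioi 0) := by
    have h := integrableOn_ker_mul_exp (c := 1) hp0 one_pos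
    simp only [one_mul] at h
    exact h
  have hI : ∫ s in Ioi (0 : ℝ), expKer p s = 1 := by
    have h := integral_ker_mul_exp (c := 1) hp0 one_pos
    simp only [one_mul, Real.one_rpow] at h
    exact h
  have h1 := intervalIntegral_tendsto_integral_Ioi 0 hi tendsto_id
  rw [hI] at h1
  have h2 : Tendsto (fun t : ℝ => (1 : ℂ) - ((∫ s in (0 : ℝ)..t, expKer p s : ℝ) : ℂ)) atTop
      (𝓝 (1 - ((1 : ℝ) : ℂ))) :=
    ((Complex.continuous_ofReal.tendsto _).comp h1).const_sub 1
  rw [Complex.ofReal_one, sub_self] at h2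
  refine h2.congr' ?_
  filter_upwards [eventually_ge_atTop 0] with t ht
  change _ = 1 - act (powInt p resolventElem) 1 t
  rw [act_powInt hp0 hp1 1 ht, volt, ← intervalIntegral.integral_ofReal]
  simp

/-- Since `θ (θ + D)⁻¹ 1 = 1 - e^(-θt)`, for `t ≥ 0` the function is the integral of `betaWeight p θ
* e^(-θt)`, which decays by dominated convergence. -/
theorem tendsto_liftDeriv (hp0 : 0 < p) (hp1 : p < 1) : Tendsto (liftDeriv p) atTop (𝓝 0) := by
  have hbI := integrableOn_betaWeight hp0 hp1
  have h1 : Tendsto (fun t : ℝ => ∫ θ in Ioc (0 : ℝ) 1, betaWeight p θ * Real.exp (-(θ * t))) atTop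
      (𝓝 (∫ _ in Ioc (0 : ℝ) 1, (0 : ℝ))) := by
    refine tendsto_integral_filter_of_dominated_convergence (betaWeight p) ?_ ?_ hbI ?_
    · have := measurable_betaWeight p
      exact Eventually.of_forall fun t => Measurable.aestronglyMeasurable (by fun_prop)
    · filter_upwards [eventually_ge_atTop 0] with t ht
      refine (ae_restrict_iff' measurableSet_Ioc).2 (Eventually.of_forall fun θ hθ => ?_)
      have hw := betaWeight_nonneg hp0 hp1 hθ.1.le hθ.2
      rw [Real.norm_of_nonneg (mul_nonneg hw (Real.exp_pos _).le)]
      refine mul_le_of_le_one_right hw ?_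
      rw [Real.exp_le_one_iff]
      have := mul_nonneg hθ.1.le ht
      linarith
    · refine (ae_restrict_iff' measurableSet_Ioc).2 (Eventually.of_forall fun θ hθ => ?_)
      have h2 : Tendsto (fun t : ℝ => Real.exp (-(θ * t))) atTop (𝓝 0) :=
        Real.tendsto_exp_neg_atTop_nhds_zero.comp (tendsto_id.const_mul_atTop hθ.1)
      simpa using h2.const_mul (betaWeight p θ)
  rw [integral_zero] at h1
  have h2 := (Complex.continuous_ofReal.tendsto _).comp h1
  rw [Complex.ofReal_zero] at h2
  refine h2.congr' ?_
  filter_upwards [eventually_ge_atTop 0] with t ht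
  rw [liftDeriv, act_powDeriv hp0 hp1 1 ht]
  have e1 : ∀ θ ∈ Ioc (0 : ℝ) 1, (betaWeight p θ * θ) • expConv θ (1 : ℝ →ᵇ ℂ) t =
      (((betaWeight p θ - betaWeight p θ * Real.exp (-(θ * t))) : ℝ) : ℂ) := by
    intro θ hθ
    have h3 : expConv θ (1 : ℝ →ᵇ ℂ) t = (((1 - Real.exp (-(θ * t))) / θ : ℝ) : ℂ) := by
      have hθ0 := hθ.1.ne'
      have := eq_expConv_of_hasDerivAt (r := θ)
        (y := fun s => (((1 - Real.exp (-(θ * s))) / θ : ℝ) : ℂ)) (z := (1 : ℝ →ᵇ ℂ))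
        (BoundedContinuousFunction.continuous _) (by simp) ht (by fun_prop) (fun s _ => by
          have h4 : HasDerivAt (fun s : ℝ => -(θ * s)) (-θ) s := by
            simpa using ((hasDerivAt_id s).const_mul θ).fun_neg
          have h5 := ((h4.exp.const_sub 1).div_const θ).ofReal_comp
          refine h5.congr_deriv ?_
          simp only [BoundedContinuousFunction.coe_one, Pi.one_apply, Complex.real_smul]
          push_cast
          have : (θ : ℂ) ≠ 0 := by exact_mod_cast hθ0
          field_simp
          ring)
      exact this.symm
    rw [h3, Complex.real_smul, ← Complex.ofReal_mul]
    congr 1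
    have := hθ.1.ne'
    field_simp
  rw [setIntegral_congr_fun measurableSet_Ioc e1, integral_complex_ofReal, integral_sub hbI,
    ← intervalIntegral.integral_of_le zero_le_one (f := betaWeight p), integral_betaWeight hp0 hp1]
  · simp
  · have := measurable_betaWeight p
    refine Integrable.mono' hbI (Measurable.aestronglyMeasurable (by fun_prop)) ?_
    refine (ae_restrict_iff' measurableSet_Ioc).2 (Eventually.of_forall fun θ hθ => ?_)
    have hw := betaWeight_nonneg hp0 hp1 hθ.1.le hθ.2
    rw [Real.norm_of_nonneg (mul_nonneg hw (Real.exp_pos _).le)]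
    refine mul_le_of_le_one_right hw ?_
    rw [Real.exp_le_one_iff]
    have := mul_nonneg hθ.1.le ht
    linarith

/-- The Caputo equation `D^p x = φ` on the open half-line. -/
def CaputoEq {E : Type*} [NormedAddCommGroup E] [NormedSpace ℝ E] (p : ℝ) (x φ : ℝ → E) : Prop :=
  ∀ t, 0 < t → HasDerivAt (volt (ker (1 - p)) (fun s => x s - x 0)) (φ t) t

/-- The function `x₀ + T (v - x₀)`, where `T = (1 + D)^(-p)`. -/
noncomputable def potential (p : ℝ) (x₀ : ℂ) (v : ℝ →ᵇ ℂ) : ℝ →ᵇ ℂ :=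
  x₀ • liftFun p + act (powInt p resolventElem) v

theorem potential_zero (hp0 : 0 < p) (hp1 : p < 1) (x₀ : ℂ) (v : ℝ →ᵇ ℂ) :
    potential p x₀ v 0 = x₀ := by
  change x₀ * liftFun p 0 + act (powInt p resolventElem) v 0 = x₀
  rw [liftFun_zero hp0 hp1, act_powInt_zero hp0 hp1, mul_one, add_zero]

/-- The potential minus `x₀` is `(1 + D)^(-p) (v - x₀)`, whose fractional derivative is `(D / (1 +
D))^p (v - x₀)`. The differential equation thus becomes an equation in the resolvent algebra for
`v`, with an extra forcing proportional to `x₀`. -/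
theorem caputoEq_potential (hp0 : 0 < p) (hp1 : p < 1) {μ x₀ : ℂ} {v γ : ℝ →ᵇ ℂ}
    (h : ∀ t, 0 ≤ t → act (powDeriv p resolventElem - μ • powInt p resolventElem) v t =
      γ t + x₀ * (liftDeriv p t + μ * liftFun p t)) :
    CaputoEq p (potential p x₀ v) (fun t => μ * potential p x₀ v t + γ t) := by
  intro t ht
  have h1 := hasDerivAt_volt_act_powInt hp0 hp1 (v - x₀ • 1) ht
  have h2 : (fun s => potential p x₀ v s - potential p x₀ v 0) =
      act (powInt p resolventElem) (v - x₀ • 1) := by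
    ext s
    rw [potential_zero hp0 hp1, act_sub_right, act_smul_right]
    change x₀ * (1 - act (powInt p resolventElem) 1 s) + act (powInt p resolventElem) v s - x₀ =
      act (powInt p resolventElem) v s - x₀ * act (powInt p resolventElem) 1 s
    ring
  rw [h2]
  refine h1.congr_deriv ?_
  have h3 := h t ht.le
  rw [act_sub_right, act_smul_right]
  change act (powDeriv p resolventElem) v t - x₀ * liftDeriv p t =
    μ * (x₀ * liftFun p t + act (powInt p resolventElem) v t) + γ t
  change act (powDeriv p resolventElem) v t - μ * act (powInt p resolventElem) v t = _ at h3
  linear_combination h3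

theorem tendsto_potential (hp0 : 0 < p) (hp1 : p < 1) (x₀ : ℂ) {v : ℝ →ᵇ ℂ}
    (hv : Tendsto v atTop (𝓝 0)) : Tendsto (potential p x₀ v) atTop (𝓝 0) := by
  have := ((tendsto_liftFun hp0 hp1).const_mul x₀).add
    (tendsto_resolventAlgebra (powInt p resolventElem) hv)
  rw [mul_zero, add_zero] at this
  exact this

theorem norm_potential_le (x₀ : ℂ) (v : ℝ →ᵇ ℂ) : ‖potential p x₀ v‖ ≤
    ‖x₀‖ * ‖liftFun p‖ + ‖(powInt p resolventElem : resolventAlgebra)‖ * ‖v‖ := by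
  refine (norm_add_le _ _).trans (add_le_add ?_ (norm_act_le _ _))
  rw [norm_smul]

/-- Solvability of the scalar equation `D^p x = μ x + γ` in bounded functions. -/
def ScalarSolvable (p : ℝ) (μ : ℂ) (Z : Set ℂ) : Prop :=
  ∃ C : ℝ, 0 ≤ C ∧ ∀ γ : ℝ →ᵇ ℂ, ∃ x : ℝ →ᵇ ℂ,
    CaputoEq p x (fun t => μ * x t + γ t) ∧ ‖x‖ ≤ C * ‖γ‖ ∧
    (Tendsto γ atTop (𝓝 0) → Tendsto x atTop (𝓝 0)) ∧ x 0 ∈ Z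

theorem scalarSolvable_of_stable (hp0 : 0 < p) (hp1 : p < 1) {μ : ℂ} (hμ0 : μ ≠ 0)
    (hμ : p * Real.pi / 2 < |μ.arg|) : ScalarSolvable p μ {0} := by
  obtain ⟨u, hu⟩ := isUnit_powDeriv_sub isResolvent_resolventElem hp0 hp1 hμ0 hμ
  set m : resolventAlgebra := ((u⁻¹ : resolventAlgebraˣ) : resolventAlgebra) with hm
  refine ⟨‖(powInt p resolventElem : resolventAlgebra)‖ * ‖m‖, by positivity, fun γ =>
    ⟨potential p 0 (act m γ), ?_, ?_, ?_, ?_⟩⟩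
  · refine caputoEq_potential hp0 hp1 fun t _ => ?_
    rw [← act_mul, ← hu, hm, Units.mul_inv, act_one, zero_mul, add_zero]
  · refine (norm_potential_le _ _).trans ?_
    rw [norm_zero, zero_mul, zero_add, mul_assoc]
    exact mul_le_mul_of_nonneg_left (norm_act_le _ _) (norm_nonneg _)
  · exact fun h => tendsto_potential hp0 hp1 _ (tendsto_resolventAlgebra m h)
  · exact potential_zero hp0 hp1 _ _

/-- The Laplace transform at `w` of a bounded function. -/
noncomputable def laplace (w : ℂ) (b : ℝ → ℂ) : ℂ :=
  ∫ t in Ioi (0 : ℝ), Complex.exp (-(w * t)) • b t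

theorem norm_laplace_le {w : ℂ} (hw : 0 < w.re) {b : ℝ → ℂ} {C : ℝ} (hC : ∀ t, ‖b t‖ ≤ C) :
    ‖laplace w b‖ ≤ C / w.re := by
  have h3 : ∫ s in Ioi (0 : ℝ), Real.exp (-(w.re * s)) = 1 / w.re := by
    have := Real.integral_rpow_mul_exp_neg_mul_Ioi one_pos hw
    simpa using this
  rw [div_eq_mul_one_div, ← h3, ← integral_const_mul]
  refine norm_integral_le_of_norm_le ((integrableOn_exp_neg_mul hw).const_mul C)
    (Eventually.of_forall fun t => ?_)
  rw [norm_smul, norm_cexp_neg_mul, mul_comm]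
  exact mul_le_mul_of_nonneg_right (hC t) (Real.exp_pos _).le

/-- The bounded solution of `q' = w q + b`. -/
noncomputable def backward {w : ℂ} (hw : 0 < w.re) (b : ℝ →ᵇ ℂ) : ℝ →ᵇ ℂ :=
  BoundedContinuousFunction.ofNormedAddCommGroup (fun t => -laplace w (fun s => b (t + s)))
    (by
      refine Continuous.neg ?_
      refine continuous_of_dominated (bound := fun s => Real.exp (-(w.re * s)) * ‖b‖) (fun t => ?_)
        (fun t => Eventually.of_forall fun s => ?_) ((integrableOn_exp_neg_mul hw).mul_const _)
        (Eventually.of_forall fun s => by fun_prop)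
      · exact Continuous.aestronglyMeasurable (by fun_prop)
      · rw [norm_smul, norm_cexp_neg_mul]
        exact mul_le_mul_of_nonneg_left (b.norm_coe_le_norm _) (Real.exp_pos _).le)
    (‖b‖ / w.re) (fun t => by
      rw [norm_neg]; exact norm_laplace_le hw fun s => b.norm_coe_le_norm _)

theorem backward_apply {w : ℂ} (hw : 0 < w.re) (b : ℝ →ᵇ ℂ) (t : ℝ) :
    backward hw b t = -laplace w (fun s => b (t + s)) := rfl

theorem norm_backward_le {w : ℂ} (hw : 0 < w.re) (b : ℝ →ᵇ ℂ) : ‖backward hw b‖ ≤ ‖b‖ / w.re :=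
  (BoundedContinuousFunction.norm_le (by positivity)).2 fun t => by
    rw [backward_apply, norm_neg]
    exact norm_laplace_le hw fun s => b.norm_coe_le_norm _

theorem tendsto_backward {w : ℂ} (hw : 0 < w.re) {b : ℝ →ᵇ ℂ} (hb : Tendsto b atTop (𝓝 0)) :
    Tendsto (backward hw b) atTop (𝓝 0) := by
  have h1 : Tendsto (fun t => laplace w (fun s => b (t + s))) atTop
      (𝓝 (∫ _ in Ioi (0 : ℝ), (0 : ℂ))) := by
    refine tendsto_integral_filter_of_dominated_convergence
      (fun s => Real.exp (-(w.re * s)) * ‖b‖) (Eventually.of_forall fun t => ?_)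
      (Eventually.of_forall fun t => Eventually.of_forall fun s => ?_)
      ((integrableOn_exp_neg_mul hw).mul_const _) (Eventually.of_forall fun s => ?_)
    · exact Continuous.aestronglyMeasurable (by fun_prop)
    · rw [norm_smul, norm_cexp_neg_mul]
      exact mul_le_mul_of_nonneg_left (b.norm_coe_le_norm _) (Real.exp_pos _).le
    · simpa using (hb.comp (tendsto_atTop_add_const_right atTop s tendsto_id)).const_smul
        (Complex.exp (-(w * s)))
  rw [integral_zero] at h1
  have := h1.neg
  rw [neg_zero] at this
  exact this

/-- The vanishing transform turns the integral over `(t, ∞)` into minus the integral over `(0, t)`;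
in particular the bounded solution starts at `0`. -/
theorem backward_eq {w : ℂ} (hw : 0 < w.re) {b : ℝ →ᵇ ℂ} (hb : laplace w b = 0) {t : ℝ}
    (ht : 0 ≤ t) : backward hw b t =
      Complex.exp (w * t) * ∫ s in (0 : ℝ)..t, Complex.exp (-(w * s)) • b s := by
  have hi := integrableOn_cexp_smul hw (y := b) b.continuous.continuousOn
    (fun t _ => b.norm_coe_le_norm t)
  have h1 : laplace w (fun s => b (t + s)) =
      Complex.exp (w * t) * ∫ s in Ioi t, Complex.exp (-(w * s)) • b s := by
    have := (measurePreserving_add_right volume t).setIntegral_preimage_emb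
      (measurableEmbedding_addRight t) (fun s : ℝ => Complex.exp (-(w * s)) • b s) (Ioi t)
    rw [preimage_add_const_Ioi, sub_self] at this
    rw [← this, laplace, ← integral_const_mul]
    refine setIntegral_congr_fun measurableSet_Ioi fun s _ => ?_
    simp only [smul_eq_mul]
    rw [← mul_assoc, ← Complex.exp_add, add_comm t s]
    congr 2
    push_cast
    ring
  have h2 := intervalIntegral.integral_interval_add_Ioi hi
    (hi.mono_set (Ioi_subset_Ioi ht))
  have h3 : ∫ s in Ioi (0 : ℝ), Complex.exp (-(w * s)) • b s = 0 := hb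
  rw [h3] at h2
  rw [backward_apply, h1, eq_neg_of_add_eq_zero_right h2]
  ring

theorem expConv_backward {w : ℂ} (hw : 0 < w.re) {b : ℝ →ᵇ ℂ} (hb : laplace w b = 0) {t : ℝ}
    (ht : 0 ≤ t) : expConv 1 (b + (1 + w) • backward hw b) t = backward hw b t := by
  refine (eq_expConv_of_hasDerivAt (BoundedContinuousFunction.continuous _) ?_ ht
    (BoundedContinuousFunction.continuous _).continuousOn fun s hs => ?_).symm
  · rw [backward_eq hw hb le_rfl]; simp
  · have hc : Continuous fun s : ℝ => Complex.exp (-(w * s)) • b s := by fun_prop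
    have h1 : HasDerivAt (fun t => ∫ s in (0 : ℝ)..t, Complex.exp (-(w * s)) • b s)
        (Complex.exp (-(w * s)) • b s) s :=
      intervalIntegral.integral_hasDerivAt_right (hc.intervalIntegrable _ _)
        (hc.stronglyMeasurableAtFilter _ _) hc.continuousAt
    have h2 : HasDerivAt (fun t : ℝ => Complex.exp (w * t)) (Complex.exp (w * s) * w) s := by
      have : HasDerivAt (fun t : ℝ => w * (t : ℂ)) w s := by
        simpa using (hasDerivAt_id s).ofReal_comp.const_mul w
      exact this.cexp
    have h3 : HasDerivAt (backward hw b) _ s := (h2.fun_mul h1).congr_of_eventuallyEq (by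
      filter_upwards [Ioi_mem_nhds hs.1] with u hu
      exact backward_eq hw hb (le_of_lt hu))
    refine h3.congr_deriv ?_
    change _ = b s + (1 + w) * backward hw b s - (1 : ℝ) • backward hw b s
    have e : Complex.exp (w * s) * Complex.exp (-(w * s)) = 1 := by
      rw [← Complex.exp_add, add_neg_cancel, Complex.exp_zero]
    rw [backward_eq hw hb hs.1.le, one_smul, smul_eq_mul]
    linear_combination b s * e

/-- With `q = backward hw b`, which starts at `0` and satisfies `q' + q = b + (1 + w) q`, the
function `u = b + (1 + w) q` solves `(1 - (1 + w) (1 + D)⁻¹) u = b` on the half-line. Applying the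
inverse of `quot` to `u` gives `v`. -/
theorem exists_act_eq (hp0 : 0 < p) (hp1 : p < 1) {w : ℂ} (hw : 0 < w.re) :
    ∃ C : ℝ, 0 ≤ C ∧ ∀ b : ℝ →ᵇ ℂ, laplace w b = 0 → ∃ v : ℝ →ᵇ ℂ,
      (∀ t, 0 ≤ t → act (powDeriv p resolventElem - w ^ (p : ℂ) • powInt p resolventElem) v t = b t) ∧
      ‖v‖ ≤ C * ‖b‖ ∧ (Tendsto b atTop (𝓝 0) → Tendsto v atTop (𝓝 0)) := by
  obtain ⟨u, hu⟩ := isUnit_quot isResolvent_resolventElem hp0 hp1 hw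
  set m : resolventAlgebra := ((u⁻¹ : resolventAlgebraˣ) : resolventAlgebra) with hm
  refine ⟨‖m‖ * (1 + ‖1 + w‖ / w.re), by positivity, fun b hb =>
    ⟨act m (b + (1 + w) • backward hw b), fun t ht => ?_, ?_, fun h => ?_⟩⟩
  · rw [powDeriv_sub_eq_mul_quot isResolvent_resolventElem hp0 hp1 hw, ← act_mul, ← hu, mul_assoc,
      hm, Units.mul_inv, mul_one, act_sub, act_one]
    change b t + (1 + w) * backward hw b t - (1 + w) * act (resolventElem 1) _ t = b t
    rw [act_resolventElem one_pos _ ht, expConv_backward hw hb ht]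
    ring
  · refine (norm_act_le _ _).trans ?_
    rw [mul_assoc]
    refine mul_le_mul_of_nonneg_left ((norm_add_le _ _).trans ?_) (norm_nonneg _)
    rw [norm_smul]
    have := mul_le_mul_of_nonneg_left (norm_backward_le hw b) (norm_nonneg (1 + w))
    calc _ ≤ ‖b‖ + ‖1 + w‖ * (‖b‖ / w.re) := by linarith
      _ = _ := by ring
  · refine tendsto_resolventAlgebra m ?_
    have := h.add ((tendsto_backward hw h).const_mul (1 + w))
    rw [mul_zero, add_zero] at this
    exact this

theorem scalarSolvable_of_unstable (hp0 : 0 < p) (hp1 : p < 1) {μ : ℂ} (hμ0 : μ ≠ 0)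
    (hμ : |μ.arg| < p * Real.pi / 2) : ScalarSolvable p μ univ := by
  obtain ⟨w, hw, rfl⟩ := exists_cpow_eq hp0 hμ0 hμ
  obtain ⟨C, hC0, hC⟩ := exists_act_eq hp0 hp1 hw
  -- `β` is the forcing created by a unit initial value in `caputoEq_potential`.
  set β : ℝ →ᵇ ℂ := liftDeriv p + w ^ (p : ℂ) • liftFun p with hβ
  have hβt : Tendsto β atTop (𝓝 0) := by
    have := (tendsto_liftDeriv hp0 hp1).add ((tendsto_liftFun hp0 hp1).const_mul (w ^ (p : ℂ)))
    rw [mul_zero, add_zero] at this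
    exact this
  -- Otherwise the homogeneous equation would have a bounded solution with initial value `1`.
  have hne : laplace w β ≠ 0 := by
    intro h0
    obtain ⟨v, hv, -, -⟩ := hC β h0
    have h1 := caputoEq_potential hp0 hp1 (x₀ := 1) (γ := 0) (v := v) (fun t ht => by
      rw [hv t ht]
      change liftDeriv p t + w ^ (p : ℂ) * liftFun p t = 0 + _
      ring)
    have h2 := eq_zero_of_bounded hp0 hp1 hμ0 hμ
      (BoundedContinuousFunction.continuous (potential p 1 v)).continuousOn
      (fun t _ => BoundedContinuousFunction.norm_coe_le_norm _ t) (fun t ht => by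
        refine (h1 t ht).congr_deriv ?_
        change _ + (0 : ℂ) = _
        rw [add_zero, smul_eq_mul])
    rw [potential_zero hp0 hp1] at h2
    exact one_ne_zero h2
  have hlin : ∀ (γ : ℝ →ᵇ ℂ) (c : ℂ), laplace w ((γ + c • β : ℝ →ᵇ ℂ) : ℝ → ℂ) =
      laplace w γ + c * laplace w β := by
    intro γ c
    have hi := fun b : ℝ →ᵇ ℂ => integrableOn_cexp_smul hw (y := b) b.continuous.continuousOn
      (fun t _ => b.norm_coe_le_norm t)
    unfold laplace
    rw [← integral_const_mul, ← integral_add (hi γ) ((hi β).const_mul c)]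
    congr 1; ext t
    change _ * (γ t + c * β t) = _
    simp only [smul_eq_mul]
    ring
  set D : ℝ := (w.re)⁻¹ * ‖laplace w β‖⁻¹ with hD
  have hD0 : 0 ≤ D := mul_nonneg (inv_nonneg.2 hw.le) (inv_nonneg.2 (norm_nonneg _))
  refine ⟨D * ‖liftFun p‖ + ‖(powInt p resolventElem : resolventAlgebra)‖ * (C * (1 + D * ‖β‖)),
    by positivity, fun γ => ?_⟩
  -- The initial value for which `γ + x₀ β` meets the solvability condition at `w`.
  set x₀ : ℂ := -laplace w γ / laplace w β with hx₀
  have hx₀n : ‖x₀‖ ≤ D * ‖γ‖ := by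
    rw [hx₀, norm_div, norm_neg, div_eq_mul_inv, hD, mul_right_comm]
    refine mul_le_mul_of_nonneg_right ?_ (inv_nonneg.2 (norm_nonneg _))
    rw [inv_mul_eq_div]
    exact norm_laplace_le hw γ.norm_coe_le_norm
  obtain ⟨v, hv, hvn, hvt⟩ := hC (γ + x₀ • β) (by
    rw [hlin, hx₀, div_mul_cancel₀ _ hne, add_neg_cancel])
  have hvn' : ‖v‖ ≤ C * (1 + D * ‖β‖) * ‖γ‖ := by
    refine hvn.trans ?_
    rw [mul_assoc]
    refine mul_le_mul_of_nonneg_left ((norm_add_le _ _).trans ?_) hC0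
    rw [norm_smul]
    have := mul_le_mul_of_nonneg_right hx₀n (norm_nonneg β)
    calc _ ≤ ‖γ‖ + D * ‖γ‖ * ‖β‖ := by linarith
      _ = _ := by ring
  refine ⟨potential p x₀ v, ?_, ?_, ?_, mem_univ _⟩
  · exact caputoEq_potential hp0 hp1 fun t ht => hv t ht
  · refine (norm_potential_le _ _).trans ?_
    have h1 := mul_le_mul_of_nonneg_right hx₀n (norm_nonneg (liftFun p))
    have h2 := mul_le_mul_of_nonneg_left hvn'
      (norm_nonneg (powInt p resolventElem : resolventAlgebra))
    calc _ ≤ _ := add_le_add h1 h2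
      _ = _ := by ring
  · intro h
    refine tendsto_potential hp0 hp1 _ (hvt ?_)
    have := h.add (hβt.const_mul x₀)
    rw [mul_zero, add_zero] at this
    exact this

end FracStable

/-! ### Calculus of Caputo equations; from scalar equations to generalized eigenvectors. -/

namespace FracStable

open MeasureTheory
open scoped BoundedContinuousFunction

section CaputoEq

variable {p : ℝ} {E F : Type*} [NormedAddCommGroup E] [NormedSpace ℝ E]
  [NormedAddCommGroup F] [NormedSpace ℝ F]

theorem CaputoEq.congr {x y φ ψ : ℝ → E} (h : CaputoEq p x φ) (hxy : EqOn x y (Ici 0))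
    (hφ : EqOn φ ψ (Ioi 0)) : CaputoEq p y ψ := by
  intro t ht
  rw [← hφ ht]
  refine (h t ht).congr_of_eventuallyEq ?_
  filter_upwards [Ioi_mem_nhds ht] with u hu
  refine volt_congr (le_of_lt hu) fun s hs => ?_
  rw [hxy hs.1, hxy (le_refl (0 : ℝ))]

theorem CaputoEq.add (hp1 : p < 1) {x y φ ψ : ℝ → E} (hx : CaputoEq p x φ) (hy : CaputoEq p y ψ)
    (hxc : ContinuousOn x (Ici 0)) (hyc : ContinuousOn y (Ici 0)) :
    CaputoEq p (fun t => x t + y t) (fun t => φ t + ψ t) := by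
  intro t ht
  refine ((hx t ht).fun_add (hy t ht)).congr_of_eventuallyEq ?_
  filter_upwards [Ioi_mem_nhds ht] with u hu
  rw [← volt_add (g := fun s => x s - x 0) (h := fun s => y s - y 0) (le_of_lt hu)
    (intervalIntegrable_ker (by linarith) u)
    ((hxc.mono Icc_subset_Ici_self).sub continuousOn_const)
    ((hyc.mono Icc_subset_Ici_self).sub continuousOn_const)]
  congr 1; ext s; abel

theorem CaputoEq.map [CompleteSpace E] [CompleteSpace F] (hp1 : p < 1) {x φ : ℝ → E}
    (hx : CaputoEq p x φ) (hxc : ContinuousOn x (Ici 0)) (L : E →L[ℝ] F) :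
    CaputoEq p (fun t => L (x t)) (fun t => L (φ t)) := by
  intro t ht
  refine (L.hasFDerivAt.comp_hasDerivAt t (hx t ht)).congr_of_eventuallyEq ?_
  filter_upwards [Ioi_mem_nhds ht] with u hu
  simp only [← map_sub]
  exact volt_map L (le_of_lt hu) (intervalIntegrable_ker (by linarith) u)
    ((hxc.mono Icc_subset_Ici_self).sub continuousOn_const)

theorem CaputoEq.zero : CaputoEq p (fun _ => (0 : E)) (fun _ => 0) := by
  intro t _
  have : volt (ker (1 - p)) (fun _ => (0 : E) - 0) = fun _ => 0 := by ext t; simp [volt]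
  rw [this]
  exact hasDerivAt_const t (0 : E)

theorem CaputoEq.sub [CompleteSpace E] (hp1 : p < 1) {x y φ ψ : ℝ → E} (hx : CaputoEq p x φ)
    (hy : CaputoEq p y ψ) (hxc : ContinuousOn x (Ici 0)) (hyc : ContinuousOn y (Ici 0)) :
    CaputoEq p (fun t => x t - y t) (fun t => φ t - ψ t) := by
  have h := hx.add hp1 (hy.map hp1 hyc (-ContinuousLinearMap.id ℝ E)) hxc
    (by simpa using hyc.fun_neg)
  simpa [sub_eq_add_neg] using h

theorem CaputoEq.sum (hp1 : p < 1) {ι : Type*} (s : Finset ι) {x φ : ι → ℝ → E}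
    (hx : ∀ i ∈ s, CaputoEq p (x i) (φ i)) (hxc : ∀ i ∈ s, ContinuousOn (x i) (Ici 0)) :
    CaputoEq p (fun t => ∑ i ∈ s, x i t) (fun t => ∑ i ∈ s, φ i t) := by
  classical
  induction s using Finset.induction_on with
  | empty => simpa using CaputoEq.zero
  | insert i s hi ih =>
    simp only [Finset.sum_insert hi]
    exact (hx i (Finset.mem_insert_self i s)).add hp1
      (ih (fun j hj => hx j (Finset.mem_insert_of_mem hj))
        fun j hj => hxc j (Finset.mem_insert_of_mem hj))
      (hxc i (Finset.mem_insert_self i s))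
      (continuousOn_finsetSum s fun j hj => hxc j (Finset.mem_insert_of_mem hj))

/-- Local uniqueness for the zero initial value. -/
theorem CaputoEq.eq_zero [CompleteSpace E] (hp0 : 0 < p) (hp1 : p < 1) {x φ : ℝ → E} {L : ℝ}
    (hL : 0 ≤ L) (h : CaputoEq p x φ) (hx : ContinuousOn x (Ici 0)) (hφ : ContinuousOn φ (Ici 0))
    (h0 : x 0 = 0) (hb : ∀ t, 0 ≤ t → ‖φ t‖ ≤ L * ‖x t‖) {t : ℝ} (ht : 0 ≤ t) : x t = 0 := by
  refine eq_zero_of_hasDerivAt_volt hp0 hp1 hL h0 (hx.mono Icc_subset_Ici_self) (b := t + 1)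
    (hφ.mono Icc_subset_Ici_self) (fun s hs => ?_) (fun s hs => hb s hs.1) ⟨ht, by linarith⟩
  have := h s hs.1
  simpa only [h0, sub_zero] using this

end CaputoEq

section Linear

variable {p : ℝ} {V : Type*} [NormedAddCommGroup V] [NormedSpace ℂ V]

/-- A scalar function times a fixed vector. -/
noncomputable def spanMap (e : V) : (ℝ →ᵇ ℂ) →L[ℂ] (ℝ →ᵇ V) :=
  (ContinuousLinearMap.toSpanSingleton ℂ e).compLeftContinuousBounded ℝ

theorem spanMap_apply (e : V) (γ : ℝ →ᵇ ℂ) (t : ℝ) : spanMap e γ t = γ t • e := rfl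

theorem tendsto_spanMap {γ : ℝ →ᵇ ℂ} (hγ : Tendsto γ atTop (𝓝 0)) (e : V) :
    Tendsto (spanMap e γ) atTop (𝓝 0) := by
  have := hγ.smul_const e
  rw [zero_smul] at this
  exact this

variable [NormedSpace ℝ V]

/-- Solvability of `D^p x = T x + γ e` in bounded functions, for all bounded scalar `γ`, with initial
value in `U`. -/
def Solvable (p : ℝ) (T : Module.End ℂ V) (U : Submodule ℂ V) (e : V) : Prop :=
  ∃ C : ℝ, 0 ≤ C ∧ ∀ γ : ℝ →ᵇ ℂ, ∃ x : ℝ →ᵇ V,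
    CaputoEq p x (fun t => T (x t) + γ t • e) ∧ ‖x‖ ≤ C * ‖γ‖ ∧
    (Tendsto γ atTop (𝓝 0) → Tendsto x atTop (𝓝 0)) ∧ x 0 ∈ U

theorem Solvable.zero (T : Module.End ℂ V) (U : Submodule ℂ V) : Solvable p T U 0 :=
  ⟨0, le_rfl, fun γ => ⟨0, CaputoEq.zero.congr (fun _ _ => rfl) fun _ _ => by simp, by simp,
    fun _ => tendsto_const_nhds, by simp⟩⟩

theorem Solvable.add (hp1 : p < 1) {T : Module.End ℂ V} {U : Submodule ℂ V} {e e' : V}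
    (h : Solvable p T U e) (h' : Solvable p T U e') : Solvable p T U (e + e') := by
  obtain ⟨C, hC, H⟩ := h
  obtain ⟨C', hC', H'⟩ := h'
  refine ⟨C + C', by positivity, fun γ => ?_⟩
  obtain ⟨x, h1, h2, h3, h4⟩ := H γ
  obtain ⟨x', h1', h2', h3', h4'⟩ := H' γ
  refine ⟨x + x', ?_, ?_, fun hγ => ?_, U.add_mem h4 h4'⟩
  · refine (h1.add hp1 h1' x.continuous.continuousOn x'.continuous.continuousOn).congr
      (fun _ _ => rfl) fun t _ => ?_
    simp only [BoundedContinuousFunction.coe_add, Pi.add_apply, map_add, smul_add]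
    abel
  · rw [add_mul]
    exact (norm_add_le _ _).trans (add_le_add h2 h2')
  · have := (h3 hγ).add (h3' hγ)
    rw [add_zero] at this
    exact this

theorem Solvable.smul {T : Module.End ℂ V} {U : Submodule ℂ V} {e : V} (c : ℂ)
    (h : Solvable p T U e) : Solvable p T U (c • e) := by
  obtain ⟨C, hC, H⟩ := h
  refine ⟨C * ‖c‖, by positivity, fun γ => ?_⟩
  obtain ⟨x, h1, h2, h3, h4⟩ := H (c • γ)
  refine ⟨x, h1.congr (fun _ _ => rfl) fun t _ => ?_, ?_, fun hγ => h3 ?_, h4⟩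
  · simp only [BoundedContinuousFunction.coe_smul, smul_eq_mul, smul_smul, mul_comm]
  · rw [mul_assoc, ← norm_smul]; exact h2
  · simpa using hγ.const_mul c

/-- The vectors in whose direction every bounded forcing can be solved for. -/
def solvableSubmodule (hp1 : p < 1) (T : Module.End ℂ V) (U : Submodule ℂ V) : Submodule ℂ V where
  carrier := {e | Solvable p T U e}
  add_mem' h h' := h.add hp1 h'
  zero_mem' := Solvable.zero T U
  smul_mem' c _ h := h.smul c

variable [IsScalarTower ℝ ℂ V]

/-- Split the forcing into its coordinates in a basis of `F` and superpose the solutions. -/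
theorem exists_bounded_solution (hp1 : p < 1) {T : Module.End ℂ V} {U : Submodule ℂ V} {F : Type*}
    [NormedAddCommGroup F] [NormedSpace ℝ F] [FiniteDimensional ℝ F] (ι : F →ₗ[ℝ] V)
    (hι : ∀ e, Solvable p T U (ι e)) :
    ∃ C : ℝ, 0 ≤ C ∧ ∀ g : ℝ →ᵇ F, ∃ x : ℝ →ᵇ V,
      CaputoEq p x (fun t => T (x t) + ι (g t)) ∧ ‖x‖ ≤ C * ‖g‖ ∧
      (Tendsto g atTop (𝓝 0) → Tendsto x atTop (𝓝 0)) ∧ x 0 ∈ U := by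
  let b := Module.finBasis ℝ F
  choose C hC H using fun i => hι (b i)
  let L : Fin (Module.finrank ℝ F) → F →L[ℝ] ℂ := fun i =>
    Complex.ofRealCLM.comp (LinearMap.toContinuousLinearMap (b.coord i))
  let G : Fin (Module.finrank ℝ F) → (ℝ →ᵇ F) →L[ℝ] (ℝ →ᵇ ℂ) := fun i =>
    (L i).compLeftContinuousBounded ℝ
  have hG : ∀ i g t, G i g t = ((b.repr (g t) i : ℝ) : ℂ) := fun _ _ _ => rfl
  refine ⟨∑ i, C i * ‖G i‖, Finset.sum_nonneg fun i _ => mul_nonneg (hC i) (norm_nonneg _),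
    fun g => ?_⟩
  choose x h1 h2 h3 h4 using fun i => H i (G i g)
  refine ⟨∑ i, x i, ?_, ?_, fun hg => ?_, ?_⟩
  · refine (CaputoEq.sum hp1 Finset.univ (fun i _ => h1 i)
      fun i _ => (x i).continuous.continuousOn).congr (fun t _ => by simp) fun t _ => ?_
    have e : ι (g t) = ∑ i, G i g t • ι (b i) := by
      conv_lhs => rw [← b.sum_repr (g t), map_sum]
      refine Finset.sum_congr rfl fun i _ => ?_
      rw [map_smul, hG]
      exact (algebraMap_smul ℂ _ _).symm
    simp only [BoundedContinuousFunction.coe_sum, Finset.sum_apply, map_sum, e,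
      Finset.sum_add_distrib]
  · rw [Finset.sum_mul]
    refine (norm_sum_le _ _).trans (Finset.sum_le_sum fun i _ => (h2 i).trans ?_)
    rw [mul_assoc]
    exact mul_le_mul_of_nonneg_left ((G i).le_opNorm g) (hC i)
  · have : ∀ i, Tendsto (G i g) atTop (𝓝 0) := fun i => by
      have := ((L i).continuous.tendsto 0).comp hg
      rw [map_zero] at this
      exact this
    have := tendsto_finsetSum Finset.univ fun i _ => h3 i (this i)
    rw [Finset.sum_const_zero] at this
    exact this.congr fun t => by simp
  · simpa using U.sum_mem fun i (_ : i ∈ Finset.univ) => h4 i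

variable [CompleteSpace V]

theorem CaputoEq.spanMap (hp1 : p < 1) {x : ℝ →ᵇ ℂ} {φ : ℝ → ℂ} (h : CaputoEq p x φ) (e : V) :
    CaputoEq p (spanMap e x) (fun t => φ t • e) :=
  h.map hp1 x.continuous.continuousOn ((ContinuousLinearMap.toSpanSingleton ℂ e).restrictScalars ℝ)

/-- Induction on the height of `e`. If `x` solves the scalar equation, then `x e` solves the vector
equation up to the error `x N e`, where `N = T - μ`. The vector `N e` has smaller height, so a
solution `y` forced by `x` in that direction corrects the error. -/
theorem ScalarSolvable.solvable (hp1 : p < 1) {μ : ℂ} {Z : Set ℂ} (h : ScalarSolvable p μ Z)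
    {T : Module.End ℂ V} {U : Submodule ℂ V}
    (hU : ∀ z ∈ Z, ∀ e ∈ T.maxGenEigenspace μ, z • e ∈ U) {e : V}
    (he : e ∈ T.maxGenEigenspace μ) : Solvable p T U e := by
  obtain ⟨k, hk⟩ := (Module.End.mem_maxGenEigenspace T μ e).1 he
  induction k generalizing e with
  | zero =>
    have : e = 0 := by simpa using hk
    rw [this]
    exact Solvable.zero T U
  | succ k ih =>
    set N : Module.End ℂ V := T - μ • 1 with hN
    have hk' : (N ^ k) (N e) = 0 := by rw [← Module.End.mul_apply, ← pow_succ, hk]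
    have hNe : T e = μ • e + N e := by simp [hN]
    obtain ⟨C', hC', H'⟩ := ih ((Module.End.mem_maxGenEigenspace T μ _).2 ⟨k, hk'⟩) hk'
    obtain ⟨C, hC, H⟩ := h
    refine ⟨‖spanMap e‖ * C + C' * C, by positivity, fun γ => ?_⟩
    obtain ⟨x, h1, h2, h3, h4⟩ := H γ
    obtain ⟨y, h1', h2', h3', h4'⟩ := H' x
    refine ⟨spanMap e x + y, ?_, ?_, fun hγ => ?_, U.add_mem (hU _ h4 e he) h4'⟩
    · refine ((h1.spanMap hp1 e).add hp1 h1' (spanMap e x).continuous.continuousOn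
        y.continuous.continuousOn).congr (fun _ _ => rfl) fun t _ => ?_
      simp only [BoundedContinuousFunction.coe_add, Pi.add_apply, spanMap_apply, map_add, map_smul,
        hNe, smul_add, add_smul, smul_smul, mul_comm]
      abel
    · refine (norm_add_le _ _).trans ?_
      have e1 := (spanMap e).le_opNorm x
      have e2 := mul_le_mul_of_nonneg_left h2 (norm_nonneg (spanMap e))
      have e3 := mul_le_mul_of_nonneg_left h2 hC'
      calc _ ≤ ‖spanMap e‖ * (C * ‖γ‖) + C' * (C * ‖γ‖) := by linarith
        _ = _ := by ring
    · have := (tendsto_spanMap (h3 hγ) e).add (h3' (h3 hγ))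
      rw [add_zero] at this
      exact this

theorem caputoEq_liftFun (hp0 : 0 < p) (hp1 : p < 1) :
    CaputoEq p (liftFun p) (fun t => -liftDeriv p t) := by
  have h0 : ∀ a : resolventAlgebra, act a 0 = 0 := fun a =>
    map_zero (a : (ℝ →ᵇ ℂ) →L[ℂ] (ℝ →ᵇ ℂ))
  have e : potential p 1 0 = liftFun p := by rw [potential, h0, one_smul, add_zero]
  have h := caputoEq_potential hp0 hp1 (μ := 0) (x₀ := 1) (v := 0) (γ := -liftDeriv p)
    fun t _ => by rw [h0]; simp
  rw [e] at h
  exact h.congr (fun _ _ => rfl) fun t _ => by simp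

/-- If forcings in the directions `v` and `T v` can be solved for with zero initial value, then the
homogeneous equation has a decaying solution starting at `v`. -/
theorem exists_homogeneous_solution (hp0 : 0 < p) (hp1 : p < 1) {T : Module.End ℂ V} {v : V}
    (h : Solvable p T ⊥ v) (h' : Solvable p T ⊥ (T v)) :
    ∃ x : ℝ →ᵇ V, CaputoEq p x (fun t => T (x t)) ∧ x 0 = v ∧ Tendsto x atTop (𝓝 0) := by
  obtain ⟨_, _, H⟩ := h
  obtain ⟨_, _, H'⟩ := h'
  obtain ⟨y, h1, -, h3, h4⟩ := H (liftDeriv p)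
  obtain ⟨z, h1', -, h3', h4'⟩ := H' (liftFun p)
  rw [Submodule.mem_bot] at h4 h4'
  -- The lift supplies the initial value `v`; `y` cancels its fractional derivative `-liftDeriv p •
  -- v`, and `z` supplies the missing term `liftFun p • T v`.
  refine ⟨spanMap v (liftFun p) + (y + z), ?_, ?_, ?_⟩
  · refine (((caputoEq_liftFun hp0 hp1).spanMap hp1 v).add hp1
      (h1.add hp1 h1' y.continuous.continuousOn z.continuous.continuousOn)
      (spanMap v (liftFun p)).continuous.continuousOn
      (y + z).continuous.continuousOn).congr (fun _ _ => rfl) fun t _ => ?_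
    simp only [BoundedContinuousFunction.coe_add, Pi.add_apply, spanMap_apply, map_add, map_smul,
      neg_smul]
    abel
  · simp only [BoundedContinuousFunction.coe_add, Pi.add_apply, spanMap_apply, h4, h4',
      liftFun_zero hp0 hp1, one_smul, add_zero]
  · have := (tendsto_spanMap (tendsto_liftFun hp0 hp1) v).add
      ((h3 (tendsto_liftDeriv hp0 hp1)).add (h3' (tendsto_liftFun hp0 hp1)))
    rw [add_zero, add_zero] at this
    exact this

end Linear

end FracStable

/-! ### Complex and real spectral subspaces. -/

namespace FracStable

open MeasureTheory
open scoped BoundedContinuousFunction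

section Spectral

variable {n : ℕ} (A : Matrix (Fin n) (Fin n) ℝ)

/-- The action of a real matrix on complex vectors. -/
noncomputable def complexEnd : Module.End ℂ (Fin n → ℂ) := Matrix.toLin' (complexMatrix A)

/-- The sum of the complex generalized eigenspaces for the eigenvalues in `S`. -/
noncomputable def complexSpectralSubspace (S : Set ℂ) : Submodule ℂ (Fin n → ℂ) :=
  ⨆ μ ∈ S, (complexEnd A).maxGenEigenspace μ

variable {A}

theorem mem_spectralSubspace {S : Set ℂ} {v : EuclideanSpace ℝ (Fin n)} :
    v ∈ spectralSubspace A S ↔ complexify n v ∈ complexSpectralSubspace A S := Iff.rfl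

/-- Coordinatewise complex conjugation. -/
def conjMap (n : ℕ) : (Fin n → ℂ) →ₛₗ[starRingEnd ℂ] (Fin n → ℂ) where
  toFun v i := starRingEnd ℂ (v i)
  map_add' v w := by ext i; simp
  map_smul' c v := by ext i; simp

/-- Coordinatewise real part. -/
noncomputable def reMap (n : ℕ) : (Fin n → ℂ) →ₗ[ℝ] EuclideanSpace ℝ (Fin n) where
  toFun v := WithLp.toLp 2 fun i => (v i).re
  map_add' v w := by ext i; simp
  map_smul' c v := by ext i; simp

theorem reMap_complexify (v : EuclideanSpace ℝ (Fin n)) : reMap n (complexify n v) = v := by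
  ext i; simp [reMap, complexify]

theorem complexify_reMap (v : Fin n → ℂ) :
    complexify n (reMap n v) = (1 / 2 : ℂ) • (v + conjMap n v) := by
  ext i
  change (((v i).re : ℝ) : ℂ) = 1 / 2 * (v i + starRingEnd ℂ (v i))
  rw [Complex.add_conj]
  push_cast
  ring

theorem complexify_injective : Function.Injective (complexify n) :=
  Function.LeftInverse.injective reMap_complexify

theorem complexEnd_complexify (v : EuclideanSpace ℝ (Fin n)) :
    complexEnd A (complexify n v) = complexify n (Matrix.toEuclideanLin A v) := by
  ext i
  simp [complexEnd, complexify, complexMatrix, Matrix.mulVec, dotProduct]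

theorem reMap_complexEnd (v : Fin n → ℂ) :
    reMap n (complexEnd A v) = Matrix.toEuclideanLin A (reMap n v) := by
  ext i
  simp [complexEnd, reMap, complexMatrix, Matrix.mulVec, dotProduct]

theorem conjMap_complexEnd (v : Fin n → ℂ) :
    conjMap n (complexEnd A v) = complexEnd A (conjMap n v) := by
  ext i
  simp [complexEnd, conjMap, complexMatrix, Matrix.mulVec, dotProduct]

theorem conjMap_mem_maxGenEigenspace {μ : ℂ} {v : Fin n → ℂ}
    (hv : v ∈ (complexEnd A).maxGenEigenspace μ) :
    conjMap n v ∈ (complexEnd A).maxGenEigenspace (starRingEnd ℂ μ) := by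
  rw [Module.End.mem_maxGenEigenspace] at hv ⊢
  obtain ⟨k, hk⟩ := hv
  refine ⟨k, ?_⟩
  have h : ∀ (k : ℕ) (v : Fin n → ℂ), ((complexEnd A - starRingEnd ℂ μ • 1) ^ k) (conjMap n v) =
      conjMap n (((complexEnd A - μ • 1) ^ k) v) := by
    intro k
    induction k with
    | zero => intro v; simp
    | succ k ih =>
      intro v
      rw [pow_succ, pow_succ, Module.End.mul_apply, Module.End.mul_apply, ← ih]
      congr 1
      simp [conjMap_complexEnd]
  rw [h, hk, map_zero]

theorem conjMap_mem_complexSpectralSubspace {S : Set ℂ} (hS : ∀ μ ∈ S, starRingEnd ℂ μ ∈ S)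
    {v : Fin n → ℂ} (hv : v ∈ complexSpectralSubspace A S) :
    conjMap n v ∈ complexSpectralSubspace A S := by
  have : complexSpectralSubspace A S ≤ (complexSpectralSubspace A S).comap (conjMap n) := by
    refine iSup₂_le fun μ hμ v hv => ?_
    exact (le_iSup₂_of_le (f := fun μ (_ : μ ∈ S) => (complexEnd A).maxGenEigenspace μ)
      (starRingEnd ℂ μ) (hS μ hμ) le_rfl) (conjMap_mem_maxGenEigenspace hv)
  exact this hv

/-- The real part is the mean of `v` and its conjugate, and conjugation permutes the generalized
eigenspaces of a real matrix. -/
theorem reMap_mem_spectralSubspace {S : Set ℂ} (hS : ∀ μ ∈ S, starRingEnd ℂ μ ∈ S)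
    {v : Fin n → ℂ} (hv : v ∈ complexSpectralSubspace A S) : reMap n v ∈ spectralSubspace A S := by
  rw [mem_spectralSubspace, complexify_reMap]
  exact Submodule.smul_mem _ _ (Submodule.add_mem _ hv (conjMap_mem_complexSpectralSubspace hS hv))

theorem complexEnd_mem_complexSpectralSubspace {S : Set ℂ} {v : Fin n → ℂ}
    (hv : v ∈ complexSpectralSubspace A S) : complexEnd A v ∈ complexSpectralSubspace A S := by
  have : complexSpectralSubspace A S ≤ (complexSpectralSubspace A S).comap (complexEnd A) := by
    refine iSup₂_le fun μ hμ v hv => ?_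
    exact (le_iSup₂_of_le (f := fun μ (_ : μ ∈ S) => (complexEnd A).maxGenEigenspace μ) μ hμ le_rfl)
      (Module.End.mapsTo_maxGenEigenspace_of_comm (Commute.refl _) μ hv)
  exact this hv

theorem abs_arg_conj (μ : ℂ) : |(starRingEnd ℂ μ).arg| = |μ.arg| := by
  rw [Complex.arg_conj]
  split_ifs with h
  · rw [h]
  · rw [abs_neg]

theorem disjoint_complexSpectralSubspace {S S' : Set ℂ} (h : Disjoint S S') :
    Disjoint (complexSpectralSubspace A S) (complexSpectralSubspace A S') :=
  (complexEnd A).independent_maxGenEigenspace.disjoint_biSup_biSup h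

variable {p : ℝ}

theorem IsHyperbolic.of_maxGenEigenspace_ne_bot (hA : IsHyperbolic p A) {μ : ℂ}
    (hμ : (complexEnd A).maxGenEigenspace μ ≠ ⊥) : μ ≠ 0 ∧ |μ.arg| ≠ p * Real.pi / 2 := by
  have h : (complexEnd A).HasUnifEigenvalue μ ⊤ := hμ
  have h1 := (h.lt zero_lt_one).mem_spectrum
  rw [complexEnd, Matrix.spectrum_toLin'] at h1
  exact hA μ h1

theorem IsHyperbolic.sup_eq_top (hA : IsHyperbolic p A) :
    complexSpectralSubspace A {μ : ℂ | p * Real.pi / 2 < |μ.arg|} ⊔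
      complexSpectralSubspace A {μ : ℂ | |μ.arg| < p * Real.pi / 2} = ⊤ := by
  rw [eq_top_iff, ← (complexEnd A).iSup_maxGenEigenspace_eq_top]
  refine iSup_le fun μ => ?_
  rcases eq_or_ne ((complexEnd A).maxGenEigenspace μ) ⊥ with h | h
  · rw [h]; exact bot_le
  · rcases lt_or_gt_of_ne (hA.of_maxGenEigenspace_ne_bot h).2 with h' | h'
    · exact le_sup_of_le_right (le_iSup₂_of_le (f := fun μ (_ : μ ∈ {μ : ℂ | _}) =>
        (complexEnd A).maxGenEigenspace μ) μ h' le_rfl)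
    · exact le_sup_of_le_left (le_iSup₂_of_le (f := fun μ (_ : μ ∈ {μ : ℂ | _}) =>
        (complexEnd A).maxGenEigenspace μ) μ h' le_rfl)

theorem disjoint_stable_unstable :
    Disjoint {μ : ℂ | p * Real.pi / 2 < |μ.arg|} {μ : ℂ | |μ.arg| < p * Real.pi / 2} :=
  Set.disjoint_left.2 fun _ h h' => lt_asymm (mem_ofPred.1 h) (mem_ofPred.1 h')

theorem reMap_mem_stableSubspace {v : Fin n → ℂ}
    (hv : v ∈ complexSpectralSubspace A {μ : ℂ | p * Real.pi / 2 < |μ.arg|}) :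
    reMap n v ∈ stableSubspace p A :=
  reMap_mem_spectralSubspace (fun μ hμ => by rw [mem_ofPred, abs_arg_conj]; exact hμ) hv

theorem reMap_mem_unstableSubspace {v : Fin n → ℂ}
    (hv : v ∈ complexSpectralSubspace A {μ : ℂ | |μ.arg| < p * Real.pi / 2}) :
    reMap n v ∈ unstableSubspace p A :=
  reMap_mem_spectralSubspace (fun μ hμ => by rw [mem_ofPred, abs_arg_conj]; exact hμ) hv

/-- The splitting holds over `ℂ` by the generalized eigenspace decomposition. It descends because
both sectors are invariant under conjugation, so real parts of the components stay in the right
subspaces. -/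
theorem IsHyperbolic.isCompl (hA : IsHyperbolic p A) :
    IsCompl (stableSubspace p A) (unstableSubspace p A) := by
  constructor
  · rw [Submodule.disjoint_def]
    intro v hs hu
    refine complexify_injective ?_
    rw [map_zero]
    exact (Submodule.disjoint_def.1 (disjoint_complexSpectralSubspace disjoint_stable_unstable))
      _ hs hu
  · rw [codisjoint_iff, eq_top_iff]
    intro v _
    have h : complexify n v ∈ (⊤ : Submodule ℂ (Fin n → ℂ)) := trivial
    rw [← hA.sup_eq_top, Submodule.mem_sup] at h
    obtain ⟨a, ha, b, hb, hab⟩ := h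
    rw [Submodule.mem_sup]
    refine ⟨reMap n a, reMap_mem_stableSubspace ha, reMap n b, reMap_mem_unstableSubspace hb, ?_⟩
    rw [← map_add, hab, reMap_complexify]

end Spectral

end FracStable

/-! ### Bounded solutions of the linear system. -/

namespace FracStable

open MeasureTheory
open scoped BoundedContinuousFunction

variable {n : ℕ} {A : Matrix (Fin n) (Fin n) ℝ} {p : ℝ}

theorem IsHyperbolic.solvable_of_stable (hp0 : 0 < p) (hp1 : p < 1) (hA : IsHyperbolic p A)
    {e : Fin n → ℂ}
    (he : e ∈ complexSpectralSubspace A {μ : ℂ | p * Real.pi / 2 < |μ.arg|}) :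
    Solvable p (complexEnd A) ⊥ e := by
  have : complexSpectralSubspace A {μ : ℂ | p * Real.pi / 2 < |μ.arg|} ≤
      solvableSubmodule hp1 (complexEnd A) ⊥ := by
    refine iSup₂_le fun μ hμ e he => ?_
    rcases eq_or_ne ((complexEnd A).maxGenEigenspace μ) ⊥ with h | h
    · rw [h, Submodule.mem_bot] at he
      rw [he]; exact Submodule.zero_mem _
    · exact (scalarSolvable_of_stable hp0 hp1 (hA.of_maxGenEigenspace_ne_bot h).1 hμ).solvable hp1
        (fun z hz e _ => by rw [mem_singleton_iff.1 hz, zero_smul]; exact Submodule.zero_mem _) he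
  exact this he

theorem IsHyperbolic.solvable (hp0 : 0 < p) (hp1 : p < 1) (hA : IsHyperbolic p A)
    (e : Fin n → ℂ) : Solvable p (complexEnd A)
      (complexSpectralSubspace A {μ : ℂ | |μ.arg| < p * Real.pi / 2}) e := by
  set U := complexSpectralSubspace A {μ : ℂ | |μ.arg| < p * Real.pi / 2} with hU
  have : (⊤ : Submodule ℂ (Fin n → ℂ)) ≤ solvableSubmodule hp1 (complexEnd A) U := by
    rw [← hA.sup_eq_top]
    refine sup_le (fun e he => ?_) (iSup₂_le fun μ hμ e he => ?_)
    · obtain ⟨C, hC, H⟩ := hA.solvable_of_stable hp0 hp1 he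
      refine ⟨C, hC, fun γ => ?_⟩
      obtain ⟨x, h1, h2, h3, h4⟩ := H γ
      exact ⟨x, h1, h2, h3, bot_le (a := U) h4⟩
    -- The sector also contains non-eigenvalues, among them `μ = 0`, whose `arg` is `0`; for these
    -- the generalized eigenspace is trivial.
    · rcases eq_or_ne ((complexEnd A).maxGenEigenspace μ) ⊥ with h | h
      · rw [h, Submodule.mem_bot] at he
        rw [he]; exact Submodule.zero_mem _
      · refine (scalarSolvable_of_unstable hp0 hp1
          (hA.of_maxGenEigenspace_ne_bot h).1 hμ).solvable hp1 (fun z _ e he => ?_) he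
        exact U.smul_mem z ((le_iSup₂_of_le (f := fun μ
          (_ : μ ∈ {μ : ℂ | |μ.arg| < p * Real.pi / 2}) => (complexEnd A).maxGenEigenspace μ)
          μ hμ le_rfl) he)
  exact this trivial

/-- The real part of a bounded function. -/
noncomputable def realPart (n : ℕ) : (ℝ →ᵇ (Fin n → ℂ)) →L[ℝ] (ℝ →ᵇ EuclideanSpace ℝ (Fin n)) :=
  (LinearMap.toContinuousLinearMap (reMap n)).compLeftContinuousBounded ℝ

theorem realPart_apply (x : ℝ →ᵇ (Fin n → ℂ)) (t : ℝ) : realPart n x t = reMap n (x t) := rfl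

theorem CaputoEq.realPart (hp1 : p < 1) {x : ℝ →ᵇ (Fin n → ℂ)} {φ : ℝ → Fin n → ℂ}
    (h : CaputoEq p x φ) : CaputoEq p (realPart n x) (fun t => reMap n (φ t)) :=
  h.map hp1 x.continuous.continuousOn (LinearMap.toContinuousLinearMap (reMap n))

theorem tendsto_realPart {x : ℝ →ᵇ (Fin n → ℂ)} (hx : Tendsto x atTop (𝓝 0)) :
    Tendsto (realPart n x) atTop (𝓝 0) := by
  have := ((LinearMap.toContinuousLinearMap (reMap n)).continuous.tendsto 0).comp hx
  rw [map_zero] at this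
  exact this

/-- Solutions are chosen over a basis of `E^s` and extended linearly; finite dimension makes the
resulting operator continuous. -/
theorem IsHyperbolic.exists_homogeneous_solution (hp0 : 0 < p) (hp1 : p < 1)
    (hA : IsHyperbolic p A) : ∃ H : stableSubspace p A →L[ℝ] (ℝ →ᵇ EuclideanSpace ℝ (Fin n)),
      ∀ σ, CaputoEq p (H σ) (fun t => Matrix.toEuclideanLin A (H σ t)) ∧ H σ 0 = σ ∧
        Tendsto (H σ) atTop (𝓝 0) := by
  let b := Module.finBasis ℝ (stableSubspace p A)
  have hb : ∀ i, ∃ x : ℝ →ᵇ EuclideanSpace ℝ (Fin n),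
      CaputoEq p x (fun t => Matrix.toEuclideanLin A (x t)) ∧ x 0 = b i ∧
        Tendsto x atTop (𝓝 0) := by
    intro i
    have h : complexify n (b i) ∈ complexSpectralSubspace A {μ : ℂ | p * Real.pi / 2 < |μ.arg|} :=
      (b i).2
    obtain ⟨x, h1, h2, h3⟩ := FracStable.exists_homogeneous_solution hp0 hp1
      (hA.solvable_of_stable hp0 hp1 h)
      (hA.solvable_of_stable hp0 hp1 (complexEnd_mem_complexSpectralSubspace h))
    refine ⟨realPart n x, (h1.realPart hp1).congr (fun _ _ => rfl) fun t _ => ?_, ?_,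
      tendsto_realPart h3⟩
    · simp only [realPart_apply, reMap_complexEnd]
    · rw [realPart_apply, h2, reMap_complexify]
  choose x h1 h2 h3 using hb
  obtain ⟨H, hH⟩ : ∃ H : stableSubspace p A →L[ℝ] (ℝ →ᵇ EuclideanSpace ℝ (Fin n)),
      ∀ σ t, H σ t = ∑ i, b.repr σ i • x i t :=
    ⟨LinearMap.toContinuousLinearMap (b.constr ℝ x), fun σ t => by
      simp [Module.Basis.constr_apply_fintype]⟩
  refine ⟨H, fun σ => ?_⟩
  have hσ := hH σ
  refine ⟨?_, ?_, ?_⟩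
  · have h4 := CaputoEq.sum hp1 Finset.univ (x := fun i t => b.repr σ i • x i t)
      (fun i _ => (h1 i).map hp1 (x i).continuous.continuousOn
        (b.repr σ i • ContinuousLinearMap.id ℝ (EuclideanSpace ℝ (Fin n))))
      fun i _ => ((x i).continuous.const_smul (b.repr σ i)).continuousOn
    refine h4.congr (fun t _ => (hσ t).symm) fun t _ => ?_
    simp only [hσ, map_sum, map_smul]
    rfl
  · rw [hσ]
    simp only [h2]
    have := congrArg Subtype.val (b.sum_repr σ)
    rw [Submodule.coe_sum] at this
    exact this
  · have := tendsto_finsetSum Finset.univ fun i _ => (h3 i).const_smul (b.repr σ i)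
    simp only [smul_zero, Finset.sum_const_zero] at this
    exact this.congr fun t => (hσ t).symm

theorem IsHyperbolic.exists_forced_solution (hp0 : 0 < p) (hp1 : p < 1) (hA : IsHyperbolic p A) :
    ∃ C : ℝ, 0 ≤ C ∧ ∀ g : ℝ →ᵇ EuclideanSpace ℝ (Fin n), ∃ x : ℝ →ᵇ EuclideanSpace ℝ (Fin n),
      CaputoEq p x (fun t => Matrix.toEuclideanLin A (x t) + g t) ∧ ‖x‖ ≤ C * ‖g‖ ∧
      (Tendsto g atTop (𝓝 0) → Tendsto x atTop (𝓝 0)) ∧ x 0 ∈ unstableSubspace p A := by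
  obtain ⟨C, hC, H⟩ := exists_bounded_solution hp1 (complexify n) fun e =>
    hA.solvable hp0 hp1 (complexify n e)
  refine ⟨‖realPart n‖ * C, by positivity, fun g => ?_⟩
  obtain ⟨x, h1, h2, h3, h4⟩ := H g
  refine ⟨realPart n x, (h1.realPart hp1).congr (fun _ _ => rfl) fun t _ => ?_, ?_,
    fun hg => tendsto_realPart (h3 hg), reMap_mem_unstableSubspace h4⟩
  · simp only [realPart_apply, map_add, reMap_complexEnd, reMap_complexify]
  · rw [mul_assoc]
    exact ((realPart n).le_opNorm x).trans (mul_le_mul_of_nonneg_left h2 (norm_nonneg _))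

/-- Bounded solutions on the half-line of the complexified linear equation. -/
structure IsBoundedSol (p : ℝ) (A : Matrix (Fin n) (Fin n) ℝ) (y : ℝ → Fin n → ℂ) : Prop where
  cont : ContinuousOn y (Ici 0)
  bdd : ∃ C : ℝ, ∀ t, 0 ≤ t → ‖y t‖ ≤ C
  eqn : CaputoEq p y (fun t => complexEnd A (y t))

theorem IsBoundedSol.add (hp1 : p < 1) {y z : ℝ → Fin n → ℂ} (hy : IsBoundedSol p A y)
    (hz : IsBoundedSol p A z) : IsBoundedSol p A (fun t => y t + z t) where
  cont := hy.cont.add hz.cont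
  bdd := by
    obtain ⟨C, hC⟩ := hy.bdd
    obtain ⟨D, hD⟩ := hz.bdd
    exact ⟨C + D, fun t ht => (norm_add_le _ _).trans (add_le_add (hC t ht) (hD t ht))⟩
  eqn := (hy.eqn.add hp1 hz.eqn hy.cont hz.cont).congr (fun _ _ => rfl) fun t _ => by simp

theorem IsBoundedSol.map (hp1 : p < 1) {y : ℝ → Fin n → ℂ} (hy : IsBoundedSol p A y)
    {L : Module.End ℂ (Fin n → ℂ)} (hL : Commute L (complexEnd A)) :
    IsBoundedSol p A (fun t => L (y t)) := by
  let L' := (LinearMap.toContinuousLinearMap L).restrictScalars ℝ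
  refine ⟨L'.continuous.comp_continuousOn hy.cont, ?_,
    (hy.eqn.map hp1 hy.cont L').congr (fun _ _ => rfl) fun t _ => ?_⟩
  · obtain ⟨C, hC⟩ := hy.bdd
    exact ⟨‖L'‖ * C, fun t ht => (L'.le_opNorm (y t)).trans
      (mul_le_mul_of_nonneg_left (hC t ht) (norm_nonneg _))⟩
  · exact LinearMap.congr_fun hL.eq (y t)

theorem IsBoundedSol.eq_zero (hp0 : 0 < p) (hp1 : p < 1) {y : ℝ → Fin n → ℂ}
    (hy : IsBoundedSol p A y) (h0 : y 0 = 0) {t : ℝ} (ht : 0 ≤ t) : y t = 0 := by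
  let L' := (LinearMap.toContinuousLinearMap (complexEnd A)).restrictScalars ℝ
  exact hy.eqn.eq_zero hp0 hp1 (norm_nonneg L') hy.cont (L'.continuous.comp_continuousOn hy.cont) h0
    (fun t _ => L'.le_opNorm (y t)) ht

/-- The initial values in the unstable subspace of bounded solutions. -/
noncomputable def boundedInitial (hp1 : p < 1) (A : Matrix (Fin n) (Fin n) ℝ) :
    Submodule ℂ (Fin n → ℂ) where
  carrier := {v | v ∈ complexSpectralSubspace A {μ : ℂ | |μ.arg| < p * Real.pi / 2} ∧
    ∃ y, IsBoundedSol p A y ∧ y 0 = v}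
  add_mem' := by
    rintro _ _ ⟨hv, y, hy, rfl⟩ ⟨hw, z, hz, rfl⟩
    exact ⟨Submodule.add_mem _ hv hw, _, hy.add hp1 hz, rfl⟩
  zero_mem' := ⟨Submodule.zero_mem _, fun _ => 0,
    ⟨continuousOn_const, ⟨0, by simp⟩, by simpa using CaputoEq.zero⟩, rfl⟩
  smul_mem' := by
    rintro c _ ⟨hv, y, hy, rfl⟩
    exact ⟨Submodule.smul_mem _ c hv, _, hy.map hp1 ((Commute.one_left _).smul_left c), rfl⟩

/-- The subspace is invariant under `A`, so if nonzero it contains an eigenvector `e`, with an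
unstable eigenvalue `μ`. Let `y` be the bounded solution from `e`. Then `(A - μ) y` is a solution
from `0`, hence zero, so each coordinate of `y` solves the scalar equation, and boundedness forces
`e = 0`. Jordan blocks never enter. -/
theorem IsHyperbolic.boundedInitial_eq_bot (hp0 : 0 < p) (hp1 : p < 1) (hA : IsHyperbolic p A) :
    boundedInitial hp1 A = ⊥ := by
  by_contra hne
  have hinv : ∀ v ∈ boundedInitial hp1 A, complexEnd A v ∈ boundedInitial hp1 A := by
    rintro _ ⟨hv, y, hy, rfl⟩
    exact ⟨complexEnd_mem_complexSpectralSubspace hv, _, hy.map hp1 (Commute.refl _), rfl⟩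
  have : Nontrivial (boundedInitial hp1 A) := Submodule.nontrivial_iff_ne_bot.2 hne
  obtain ⟨μ, hμ⟩ := Module.End.exists_eigenvalue ((complexEnd A).restrict hinv)
  obtain ⟨⟨e, he⟩, hev⟩ := hμ.exists_hasEigenvector
  have he0 : e ≠ 0 := fun h => hev.2 (Subtype.ext h)
  have hTe : complexEnd A e = μ • e := congrArg Subtype.val hev.apply_eq_smul
  obtain ⟨heU, y, hy, rfl⟩ := he
  have heV : y 0 ∈ (complexEnd A).maxGenEigenspace μ :=
    (Module.End.mem_maxGenEigenspace _ _ _).2 ⟨1, by simp [hTe]⟩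
  have hμu : |μ.arg| < p * Real.pi / 2 := by
    by_contra hμu
    exact he0 (Submodule.disjoint_def.1
      ((complexEnd A).independent_maxGenEigenspace.disjoint_biSup (x := μ)
        (y := {μ : ℂ | |μ.arg| < p * Real.pi / 2}) hμu) _ heV heU)
  have hμ0 := (hA.of_maxGenEigenspace_ne_bot (μ := μ) fun h => he0 (by
    rwa [h, Submodule.mem_bot] at heV)).1
  have hTy : ∀ t, 0 ≤ t → complexEnd A (y t) = μ • y t := by
    intro t ht
    have hc : Commute (complexEnd A - μ • 1) (complexEnd A) :=
      (Commute.refl _).sub_left ((Commute.one_left _).smul_left μ)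
    have := (hy.map hp1 hc).eq_zero hp0 hp1 (by simp [hTe]) ht
    simpa [sub_eq_zero] using this
  obtain ⟨C, hC⟩ := hy.bdd
  refine he0 (funext fun i => ?_)
  have hyi := (hy.eqn.congr (fun _ _ => rfl) fun t ht => hTy t (le_of_lt ht)).map hp1 hy.cont
    (ContinuousLinearMap.proj (R := ℝ) (φ := fun _ : Fin n => ℂ) i)
  exact eq_zero_of_bounded hp0 hp1 hμ0 hμu (y := fun t => y t i)
    ((continuous_apply i).comp_continuousOn hy.cont)
    (fun t ht => (norm_le_pi_norm (y t) i).trans (hC t ht)) hyi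

/-- A bounded solution of the linear equation starting in the unstable subspace vanishes. -/
theorem IsHyperbolic.eq_zero_of_bounded (hp0 : 0 < p) (hp1 : p < 1) (hA : IsHyperbolic p A)
    {x : ℝ → EuclideanSpace ℝ (Fin n)} {C : ℝ} (hx : ContinuousOn x (Ici 0))
    (hC : ∀ t, 0 ≤ t → ‖x t‖ ≤ C) (h : CaputoEq p x (fun t => Matrix.toEuclideanLin A (x t)))
    (h0 : x 0 ∈ unstableSubspace p A) {t : ℝ} (ht : 0 ≤ t) : x t = 0 := by
  let L := LinearMap.toContinuousLinearMap (complexify n)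
  have hy : IsBoundedSol p A (fun t => L (x t)) := by
    refine ⟨L.continuous.comp_continuousOn hx, ⟨‖L‖ * C, fun t ht => (L.le_opNorm (x t)).trans
      (mul_le_mul_of_nonneg_left (hC t ht) (norm_nonneg _))⟩,
      (h.map hp1 hx L).congr (fun _ _ => rfl) fun t _ => (complexEnd_complexify (x t)).symm⟩
  have h1 : L (x 0) ∈ boundedInitial hp1 A := ⟨h0, _, hy, rfl⟩
  rw [hA.boundedInitial_eq_bot hp0 hp1, Submodule.mem_bot] at h1
  exact complexify_injective ((hy.eq_zero hp0 hp1 h1 ht).trans (map_zero _).symm)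

end FracStable

/-! ### The dichotomy of the linear equation. -/

namespace FracStable

open MeasureTheory
open scoped BoundedContinuousFunction

variable {n : ℕ} {A : Matrix (Fin n) (Fin n) ℝ} {p : ℝ}

theorem isSolution_iff {x : ℝ → EuclideanSpace ℝ (Fin n)}
    {f : EuclideanSpace ℝ (Fin n) → EuclideanSpace ℝ (Fin n)} : IsSolution p A f x ↔
      ContinuousOn x (Ici 0) ∧ CaputoEq p x (fun t => Matrix.toEuclideanLin A (x t) + f (x t)) := by
  have : ∀ g : ℝ → EuclideanSpace ℝ (Fin n), rlIntegral (1 - p) g = volt (ker (1 - p)) g :=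
    fun g => funext fun t => rlIntegral_eq_volt _ _ _
  simp only [IsSolution, HasCaputoDerivAt, CaputoEq, this]

/-- The function constant on the negative half-line that agrees with a bounded continuous function
on the half-line `[0, ∞)`. -/
noncomputable def extendConst {E : Type*} [NormedAddCommGroup E] (d : ℝ → E)
    (hd : ContinuousOn d (Ici 0)) {M : ℝ} (hM : ∀ t, 0 ≤ t → ‖d t‖ ≤ M) : ℝ →ᵇ E :=
  BoundedContinuousFunction.ofNormedAddCommGroup (fun t => d (max t 0))
    (hd.comp_continuous (by fun_prop) fun t => le_max_right t 0) M fun t => hM _ (le_max_right t 0)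

theorem extendConst_apply {E : Type*} [NormedAddCommGroup E] {d : ℝ → E}
    (hd : ContinuousOn d (Ici 0)) {M : ℝ} (hM : ∀ t, 0 ≤ t → ‖d t‖ ≤ M) (t : ℝ) :
    extendConst d hd hM t = d (max t 0) := rfl

/-- The bounded solution operators of the linear equation `D^p x = A x + g`. -/
structure Dichotomy (p : ℝ) (A : Matrix (Fin n) (Fin n) ℝ) where
  /-- the decaying solution of the homogeneous equation with initial value in `E^s` -/
  hom : stableSubspace p A →L[ℝ] (ℝ →ᵇ EuclideanSpace ℝ (Fin n))
  /-- the bounded solution of the forced equation with initial value in `E^u` -/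
  forced : (ℝ →ᵇ EuclideanSpace ℝ (Fin n)) → (ℝ →ᵇ EuclideanSpace ℝ (Fin n))
  /-- a bound for `forced` -/
  bound : ℝ
  bound_nonneg : 0 ≤ bound
  caputoEq_hom : ∀ σ, CaputoEq p (hom σ) (fun t => Matrix.toEuclideanLin A (hom σ t))
  hom_zero : ∀ σ, hom σ 0 = σ
  tendsto_hom : ∀ σ, Tendsto (hom σ) atTop (𝓝 0)
  caputoEq_forced : ∀ g, CaputoEq p (forced g)
    (fun t => Matrix.toEuclideanLin A (forced g t) + g t)
  forced_mem : ∀ g, forced g 0 ∈ unstableSubspace p A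
  tendsto_forced : ∀ g : ℝ →ᵇ EuclideanSpace ℝ (Fin n), Tendsto g atTop (𝓝 0) →
    Tendsto (forced g) atTop (𝓝 0)
  norm_forced_le : ∀ g, ‖forced g‖ ≤ bound * ‖g‖
  norm_forced_sub_le : ∀ g g', ‖forced g - forced g'‖ ≤ bound * ‖g - g'‖
  eq_add : ∀ (d : ℝ → EuclideanSpace ℝ (Fin n)) (g : ℝ →ᵇ EuclideanSpace ℝ (Fin n)) (C : ℝ)
    (σ : stableSubspace p A), ContinuousOn d (Ici 0) → (∀ t, 0 ≤ t → ‖d t‖ ≤ C) →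
    CaputoEq p d (fun t => Matrix.toEuclideanLin A (d t) + g t) →
    d 0 - σ ∈ unstableSubspace p A → ∀ t, 0 ≤ t → d t = hom σ t + forced g t

/-- The forced solutions are merely chosen, with no linearity in `g`. Uniqueness of bounded
solutions starting in `E^u` restores it on the half-line: `S g - S g' = S (g - g')`, whence the
Lipschitz bound. -/
theorem IsHyperbolic.nonempty_dichotomy (hp0 : 0 < p) (hp1 : p < 1) (hA : IsHyperbolic p A) :
    Nonempty (Dichotomy p A) := by
  obtain ⟨H, hH⟩ := hA.exists_homogeneous_solution hp0 hp1
  obtain ⟨C, hC0, hC⟩ := hA.exists_forced_solution hp0 hp1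
  choose S h1 h2 h3 h4 using hC
  have huniq : ∀ (d : ℝ → EuclideanSpace ℝ (Fin n)) (g : ℝ →ᵇ EuclideanSpace ℝ (Fin n)) (M : ℝ),
      ContinuousOn d (Ici 0) → (∀ t, 0 ≤ t → ‖d t‖ ≤ M) →
      CaputoEq p d (fun t => Matrix.toEuclideanLin A (d t) + g t) →
      d 0 ∈ unstableSubspace p A → ∀ t, 0 ≤ t → d t = S g t := by
    intro d g M hd hM hdg h0 t ht
    refine sub_eq_zero.1 (hA.eq_zero_of_bounded hp0 hp1 (x := fun t => d t - S g t)
      (C := M + ‖S g‖) (hd.sub (S g).continuous.continuousOn) (fun t ht =>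
        (norm_sub_le _ _).trans (add_le_add (hM t ht) ((S g).norm_coe_le_norm t))) ?_
      (Submodule.sub_mem _ h0 (h4 g)) ht)
    refine (hdg.sub hp1 (h1 g) hd (S g).continuous.continuousOn).congr (fun _ _ => rfl)
      fun t _ => ?_
    simp only [map_sub]
    abel
  -- Uniqueness says nothing about negative times, but the sup norm sees them; precomposing with `m`
  -- freezes the functions there.
  let m : C(ℝ, ℝ) := ⟨fun t => max t 0, by fun_prop⟩
  have hm : ∀ t, 0 ≤ t → m t = t := fun t ht => max_eq_left ht
  have hm0 : ∀ t, 0 ≤ m t := fun t => le_max_right t 0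
  have hS : ∀ g, EqOn (S g) ((S g).compContinuous m) (Ici 0) := fun g t ht => by
    change S g t = S g (m t)
    rw [hm t ht]
  have hSn : ∀ g, ‖(S g).compContinuous m‖ ≤ C * ‖g‖ := fun g =>
    (BoundedContinuousFunction.norm_le (by positivity)).2 fun t =>
      ((S g).norm_coe_le_norm _).trans (h2 g)
  refine ⟨⟨H, fun g => (S g).compContinuous m, C, hC0, fun σ => (hH σ).1, fun σ => (hH σ).2.1,
    fun σ => (hH σ).2.2, fun g => (h1 g).congr (hS g) fun t ht => ?_, fun g => ?_, fun g hg => ?_,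
    hSn, fun g g' => ?_, fun d g M σ hd hM hdg h0 t ht => ?_⟩⟩
  · simp only [← hS g (mem_Ici.2 (le_of_lt ht))]
  · rw [← hS g (le_refl (0 : ℝ))]; exact h4 g
  · refine (h3 g hg).congr' ?_
    filter_upwards [eventually_ge_atTop 0] with t ht
    exact hS g ht
  · refine (BoundedContinuousFunction.norm_le (by positivity)).2 fun t => ?_
    have : S g (m t) - S g' (m t) = S (g - g') (m t) := by
      refine huniq (fun t => S g t - S g' t) (g - g') (‖S g‖ + ‖S g'‖)
        ((S g).continuous.sub (S g').continuous).continuousOn (fun t _ => (norm_sub_le _ _).trans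
          (add_le_add ((S g).norm_coe_le_norm t) ((S g').norm_coe_le_norm t))) ?_
        (Submodule.sub_mem _ (h4 g) (h4 g')) _ (hm0 t)
      refine ((h1 g).sub hp1 (h1 g') (S g).continuous.continuousOn
        (S g').continuous.continuousOn).congr (fun _ _ => rfl) fun t _ => ?_
      simp only [map_sub, BoundedContinuousFunction.coe_sub, Pi.sub_apply]
      abel
    change ‖S g (m t) - S g' (m t)‖ ≤ _
    rw [this]
    exact ((S (g - g')).norm_coe_le_norm _).trans (h2 _)
  · have := huniq (fun t => d t - H σ t) g (M + ‖H σ‖) (hd.sub (H σ).continuous.continuousOn)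
      (fun t ht => (norm_sub_le _ _).trans (add_le_add (hM t ht) ((H σ).norm_coe_le_norm t)))
      ((hdg.sub hp1 (hH σ).1 hd (H σ).continuous.continuousOn).congr (fun _ _ => rfl) fun t _ => by
        simp only [map_sub]; abel) (by rw [(hH σ).2.1]; exact h0) t ht
    rw [← hS g ht, ← this, add_sub_cancel]

end FracStable

/-! ### Superposition operators and nonlinear uniqueness. -/

namespace FracStable

open MeasureTheory
open scoped BoundedContinuousFunction

variable {n : ℕ} {A : Matrix (Fin n) (Fin n) ℝ} {p : ℝ}

/-- A superposition operator on the functions with norm less than `r`. -/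
theorem exists_superposition {E : Type*} [NormedAddCommGroup E] {f : E → E} {r : ℝ} {ε : ℝ≥0}
    (hf0 : f 0 = 0) (hr : 0 < r) (hf : LipschitzOnWith ε f (Metric.ball 0 r)) :
    ∃ N : (ℝ →ᵇ E) → (ℝ →ᵇ E), ∀ x : ℝ →ᵇ E, ‖x‖ < r → ∀ t, N x t = f (x t) := by
  have : ∀ x : ℝ →ᵇ E, ∃ y : ℝ →ᵇ E, ‖x‖ < r → ∀ t, y t = f (x t) := by
    intro x
    by_cases hx : ‖x‖ < r
    · have hm : ∀ t, x t ∈ Metric.ball (0 : E) r := fun t =>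
        mem_ball_zero_iff.2 ((x.norm_coe_le_norm t).trans_lt hx)
      refine ⟨BoundedContinuousFunction.ofNormedAddCommGroup (fun t => f (x t))
        (hf.continuousOn.comp_continuous x.continuous hm) (ε * ‖x‖) fun t => ?_, fun _ t => rfl⟩
      have := hf.norm_sub_le (hm t) (Metric.mem_ball_self hr)
      rw [hf0, sub_zero, sub_zero] at this
      exact this.trans (mul_le_mul_of_nonneg_left (x.norm_coe_le_norm t) ε.2)
    · exact ⟨0, fun h => absurd h hx⟩
  choose N hN using this
  exact ⟨N, hN⟩

theorem norm_superposition_le {E : Type*} [NormedAddCommGroup E] {f : E → E} {ρ : ℝ} {ε : ℝ≥0}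
    (hf0 : f 0 = 0) (hf : LipschitzOnWith ε f (Metric.ball 0 ρ)) {x y : ℝ →ᵇ E}
    (hy : ∀ t, y t = f (x t)) (hx : ‖x‖ < ρ) : ‖y‖ ≤ ε * ‖x‖ := by
  refine (BoundedContinuousFunction.norm_le (by positivity)).2 fun t => ?_
  have := hf.norm_sub_le (mem_ball_zero_iff.2 ((x.norm_coe_le_norm t).trans_lt hx))
    (Metric.mem_ball_self ((norm_nonneg x).trans_lt hx))
  rw [hf0, sub_zero, sub_zero] at this
  rw [hy]
  exact this.trans (mul_le_mul_of_nonneg_left (x.norm_coe_le_norm t) ε.2)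

theorem norm_superposition_sub_le {E : Type*} [NormedAddCommGroup E] {f : E → E} {r : ℝ} {ε : ℝ≥0}
    (hf : LipschitzOnWith ε f (Metric.ball 0 r)) {x x' y y' : ℝ →ᵇ E} (hx : ‖x‖ < r)
    (hx' : ‖x'‖ < r) (hy : ∀ t, y t = f (x t)) (hy' : ∀ t, y' t = f (x' t)) :
    ‖y - y'‖ ≤ ε * ‖x - x'‖ := by
  refine (BoundedContinuousFunction.norm_le (by positivity)).2 fun t => ?_
  have := hf.norm_sub_le (mem_ball_zero_iff.2 ((x.norm_coe_le_norm t).trans_lt hx))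
    (mem_ball_zero_iff.2 ((x'.norm_coe_le_norm t).trans_lt hx'))
  change ‖y t - y' t‖ ≤ _
  rw [hy, hy']
  exact this.trans (mul_le_mul_of_nonneg_left ((x - x').norm_coe_le_norm t) ε.2)

/-- Bounded solutions of the nonlinear equation starting over the same point of `E^s` agree. -/
theorem Dichotomy.eq_of_isSolution (𝒟 : Dichotomy p A) (hp1 : p < 1)
    {f : EuclideanSpace ℝ (Fin n) → EuclideanSpace ℝ (Fin n)} {r : ℝ} {ε : ℝ≥0}
    (hε : 𝒟.bound * ε < 1) (hf : LipschitzOnWith ε f (Metric.ball 0 r))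
    {x y : ℝ → EuclideanSpace ℝ (Fin n)} (hx : IsSolution p A f x) (hy : IsSolution p A f y)
    (hxr : ∀ t, 0 ≤ t → x t ∈ Metric.ball (0 : EuclideanSpace ℝ (Fin n)) r)
    (hyr : ∀ t, 0 ≤ t → y t ∈ Metric.ball (0 : EuclideanSpace ℝ (Fin n)) r)
    (h0 : x 0 - y 0 ∈ unstableSubspace p A) : EqOn x y (Ici 0) := by
  obtain ⟨hxc, hxe⟩ := isSolution_iff.1 hx
  obtain ⟨hyc, hye⟩ := isSolution_iff.1 hy
  have hdc : ContinuousOn (fun t => x t - y t) (Ici 0) := hxc.sub hyc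
  have hgc : ContinuousOn (fun t => f (x t) - f (y t)) (Ici 0) :=
    (hf.continuousOn.comp hxc hxr).sub (hf.continuousOn.comp hyc hyr)
  have hdM : ∀ t, 0 ≤ t → ‖x t - y t‖ ≤ r + r := fun t ht =>
    (norm_sub_le _ _).trans (add_le_add (mem_ball_zero_iff.1 (hxr t ht)).le
      (mem_ball_zero_iff.1 (hyr t ht)).le)
  have hgd : ∀ t, 0 ≤ t → ‖f (x t) - f (y t)‖ ≤ ε * ‖x t - y t‖ := fun t ht =>
    hf.norm_sub_le (hxr t ht) (hyr t ht)
  have hgM : ∀ t, 0 ≤ t → ‖f (x t) - f (y t)‖ ≤ ε * (r + r) := fun t ht =>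
    (hgd t ht).trans (mul_le_mul_of_nonneg_left (hdM t ht) ε.2)
  set D := extendConst _ hdc hdM with hD
  set G := extendConst _ hgc hgM with hG
  have hGD : ‖G‖ ≤ ε * ‖D‖ := (BoundedContinuousFunction.norm_le (by positivity)).2 fun t =>
    (hgd _ (le_max_right t 0)).trans (mul_le_mul_of_nonneg_left (D.norm_coe_le_norm t) ε.2)
  -- The difference is a bounded solution of the linear equation forced by `f (x t) - f (y t)`, with
  -- zero `E^s`-component at time `0`. Hence `‖D‖ ≤ bound * ε * ‖D‖`, and the factor is below `1`.
  have key : ∀ t, 0 ≤ t → x t - y t = 𝒟.forced G t := by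
    intro t ht
    have h1 : CaputoEq p (fun t => x t - y t)
        (fun t => Matrix.toEuclideanLin A (x t - y t) + G t) := by
      refine (hxe.sub hp1 hye hxc hyc).congr (fun _ _ => rfl) fun t ht => ?_
      rw [extendConst_apply, max_eq_left (le_of_lt ht), map_sub]
      exact add_sub_add_comm _ _ _ _
    have := 𝒟.eq_add (fun t => x t - y t) G (r + r) 0 hdc hdM h1 (by simpa using h0) t ht
    simpa using this
  have hDG : ‖D‖ ≤ 𝒟.bound * ‖G‖ :=
    (BoundedContinuousFunction.norm_le (mul_nonneg 𝒟.bound_nonneg (norm_nonneg _))).2 fun t => by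
      rw [extendConst_apply, key _ (le_max_right t 0)]
      exact ((𝒟.forced G).norm_coe_le_norm _).trans (𝒟.norm_forced_le G)
  have hD0 : ‖D‖ ≤ 0 := by
    have h1 := mul_le_mul_of_nonneg_left hGD 𝒟.bound_nonneg
    have h2 : ‖D‖ ≤ 𝒟.bound * ε * ‖D‖ := by linarith [mul_assoc 𝒟.bound (ε : ℝ) ‖D‖]
    nlinarith [norm_nonneg D]
  intro t ht
  have h1 := (D.norm_coe_le_norm t).trans hD0
  rw [extendConst_apply, max_eq_left (mem_Ici.1 ht)] at h1
  exact sub_eq_zero.1 (norm_le_zero_iff.1 h1)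

/-- Two solutions with the same initial value agree as long as they stay in the ball on which the
nonlinearity is Lipschitz. -/
theorem eq_of_isSolution_of_mem (hp0 : 0 < p) (hp1 : p < 1)
    {f : EuclideanSpace ℝ (Fin n) → EuclideanSpace ℝ (Fin n)} {r b : ℝ} {ε : ℝ≥0}
    (hf : LipschitzOnWith ε f (Metric.ball 0 r))
    {x y : ℝ → EuclideanSpace ℝ (Fin n)} (hx : IsSolution p A f x) (hy : IsSolution p A f y)
    (hxr : ∀ t ∈ Icc 0 b, x t ∈ Metric.ball (0 : EuclideanSpace ℝ (Fin n)) r)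
    (hyr : ∀ t ∈ Icc 0 b, y t ∈ Metric.ball (0 : EuclideanSpace ℝ (Fin n)) r)
    (h0 : y 0 = x 0) : EqOn y x (Ico 0 b) := by
  obtain ⟨hxc, hxe⟩ := isSolution_iff.1 hx
  obtain ⟨hyc, hye⟩ := isSolution_iff.1 hy
  have hsub : Icc 0 b ⊆ Ici 0 := Icc_subset_Ici_self
  let L := LinearMap.toContinuousLinearMap (Matrix.toEuclideanLin A)
  intro t ht
  refine sub_eq_zero.1 (eq_zero_of_hasDerivAt_volt hp0 hp1 (z := fun t => y t - x t)
    (φ := fun t => L (y t - x t) + (f (y t) - f (x t))) (L := ‖L‖ + ε) (by positivity)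
    (by rw [h0, sub_self]) ((hyc.sub hxc).mono hsub) ?_ ?_ ?_ ht)
  · exact (L.continuous.comp_continuousOn ((hyc.sub hxc).mono hsub)).add
      ((hf.continuousOn.comp (hyc.mono hsub) hyr).sub (hf.continuousOn.comp (hxc.mono hsub) hxr))
  · intro s hs
    have h1 := (hye.sub hp1 hxe hyc hxc) s hs.1
    simp only [h0, sub_self, sub_zero] at h1
    refine h1.congr_deriv ?_
    rw [map_sub]
    change Matrix.toEuclideanLin A (y s) + f (y s) - (Matrix.toEuclideanLin A (x s) + f (x s)) =
      Matrix.toEuclideanLin A (y s) - Matrix.toEuclideanLin A (x s) + (f (y s) - f (x s))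
    exact add_sub_add_comm _ _ _ _
  · intro s hs
    rw [add_mul]
    exact (norm_add_le _ _).trans (add_le_add (L.le_opNorm _)
      (hf.norm_sub_le (hyr s (Ico_subset_Icc_self hs)) (hxr s (Ico_subset_Icc_self hs))))

/-- A solution staying well inside the ball on which the nonlinearity is Lipschitz is determined by
its initial value. -/
theorem eqOn_of_isSolution (hp0 : 0 < p) (hp1 : p < 1)
    {f : EuclideanSpace ℝ (Fin n) → EuclideanSpace ℝ (Fin n)} {r r' : ℝ} {ε : ℝ≥0} (hr : r' < r)
    (hf : LipschitzOnWith ε f (Metric.ball 0 r))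
    {x y : ℝ → EuclideanSpace ℝ (Fin n)} (hx : IsSolution p A f x) (hy : IsSolution p A f y)
    (hxr : ∀ t, 0 ≤ t → ‖x t‖ ≤ r') (h0 : y 0 = x 0) : EqOn y x (Ici 0) := by
  -- Continuity argument: `y` agrees with `x` until `‖y‖` first reaches `R`, say at time `m`. By
  -- continuity they also agree at `m`, where `‖x m‖ ≤ r' < R`, so that time never comes.
  obtain ⟨R, hR, hR'⟩ := exists_between hr
  have hxb : ∀ t, 0 ≤ t → x t ∈ Metric.ball (0 : EuclideanSpace ℝ (Fin n)) r := fun t ht =>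
    mem_ball_zero_iff.2 ((hxr t ht).trans_lt hr)
  have step : ∀ m, (∀ t ∈ Ico 0 m, ‖y t‖ < R) → EqOn y x (Ico 0 m) := by
    intro m hm t ht
    obtain ⟨b, htb, hbm⟩ := exists_between ht.2
    exact eq_of_isSolution_of_mem hp0 hp1 hf hx hy (fun s hs => hxb s hs.1)
      (fun s hs => mem_ball_zero_iff.2 ((hm s ⟨hs.1, hs.2.trans_lt hbm⟩).trans hR')) h0 ⟨ht.1, htb⟩
  have hlt : ∀ t, 0 ≤ t → ‖y t‖ < R := by
    by_contra! hcon
    obtain ⟨t₀, ht₀, hyt₀⟩ := hcon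
    have hc : IsCompact (Icc 0 t₀ ∩ (fun t => ‖y t‖) ⁻¹' Ici R) :=
      isCompact_Icc.of_isClosed_subset
        ((hy.1.norm.mono Icc_subset_Ici_self).preimage_isClosed_of_isClosed isClosed_Icc isClosed_Ici)
        inter_subset_left
    obtain ⟨m, ⟨hm, hmR⟩, hmin⟩ := hc.exists_isLeast ⟨t₀, ⟨ht₀, le_rfl⟩, hyt₀⟩
    have hmR : R ≤ ‖y m‖ := hmR
    have hm0 : 0 < m := by
      refine lt_of_le_of_ne hm.1 fun h => ?_
      rw [← h, h0] at hmR
      linarith [hxr 0 le_rfl]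
    have h1 : EqOn y x (Ico 0 m) := by
      refine step m fun t ht => ?_
      by_contra! h
      exact absurd (hmin ⟨⟨ht.1, ht.2.le.trans hm.2⟩, h⟩) (not_le.2 ht.2)
    have h2 : EqOn y x (Icc 0 m) := h1.of_subset_closure (hy.1.mono Icc_subset_Ici_self)
      (hx.1.mono Icc_subset_Ici_self) Ico_subset_Icc_self (by rw [closure_Ico hm0.ne])
    rw [h2 ⟨hm.1, le_rfl⟩] at hmR
    linarith [hxr m hm.1]
  exact fun t ht => step (t + 1) (fun s hs => hlt s hs.1) ⟨ht, by linarith⟩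

end FracStable

/-! ### The Lyapunov-Perron fixed point. -/

namespace FracStable

open MeasureTheory
open scoped BoundedContinuousFunction

variable {n : ℕ} {A : Matrix (Fin n) (Fin n) ℝ} {p : ℝ}

theorem isClosed_setOf_tendsto_zero {E : Type*} [NormedAddCommGroup E] :
    IsClosed {x : ℝ →ᵇ E | Tendsto x atTop (𝓝 0)} := by
  refine isClosed_of_closure_subset fun x hx => ?_
  refine Metric.tendsto_nhds.2 fun ε hε => ?_
  obtain ⟨y, hy, hxy⟩ := Metric.mem_closure_iff.1 hx (ε / 2) (half_pos hε)
  filter_upwards [Metric.tendsto_nhds.1 (show Tendsto y atTop (𝓝 0) from hy) (ε / 2) (half_pos hε)]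
    with t ht
  calc dist (x t) 0 ≤ dist (x t) (y t) + dist (y t) 0 := dist_triangle _ _ _
    _ < ε / 2 + ε / 2 := add_lt_add ((BoundedContinuousFunction.dist_coe_le_dist t).trans_lt hxy) ht
    _ = ε := add_halves ε

/-- The Lyapunov-Perron fixed point. -/
theorem Dichotomy.exists_fixedPoint (𝒟 : Dichotomy p A)
    {f : EuclideanSpace ℝ (Fin n) → EuclideanSpace ℝ (Fin n)} {r : ℝ} {ε : ℝ≥0} (hr : 0 < r)
    (hε : 𝒟.bound * ε ≤ 1 / 2) (hf0 : f 0 = 0) (hf : LipschitzOnWith ε f (Metric.ball 0 r))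
    {N : (ℝ →ᵇ EuclideanSpace ℝ (Fin n)) → (ℝ →ᵇ EuclideanSpace ℝ (Fin n))}
    (hN : ∀ x, ‖x‖ < r → ∀ t, N x t = f (x t)) {σ : stableSubspace p A}
    (hσ : ‖𝒟.hom‖ * ‖σ‖ ≤ r / 4) :
    ∃ x : ℝ →ᵇ EuclideanSpace ℝ (Fin n), ‖x‖ ≤ r / 2 ∧ Tendsto x atTop (𝓝 0) ∧
      x = 𝒟.hom σ + 𝒟.forced (N x) := by
  set s : Set (ℝ →ᵇ EuclideanSpace ℝ (Fin n)) :=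
    {x | ‖x‖ ≤ r / 2} ∩ {x | Tendsto x atTop (𝓝 0)} with hs
  have hlt : ∀ {x : ℝ →ᵇ EuclideanSpace ℝ (Fin n)}, ‖x‖ ≤ r / 2 → ‖x‖ < r := fun h => by linarith
  have hsc : IsComplete s :=
    ((isClosed_le continuous_norm continuous_const).inter isClosed_setOf_tendsto_zero).isComplete
  have hmaps : MapsTo (fun x => 𝒟.hom σ + 𝒟.forced (N x)) s s := by
    rintro x ⟨hx, hxt⟩
    have hx : ‖x‖ ≤ r / 2 := hx
    refine ⟨?_, ?_⟩
    -- The budget is `r / 4` from the homogeneous part plus half of `‖x‖ ≤ r / 2` from the forced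
    -- part.
    · have h1 := (𝒟.hom.le_opNorm σ).trans hσ
      have h2 := mul_le_mul_of_nonneg_left (norm_superposition_le hf0 hf (hN x (hlt hx)) (hlt hx))
        𝒟.bound_nonneg
      have h3 := mul_le_mul_of_nonneg_right hε (norm_nonneg x)
      have h4 := norm_add_le (𝒟.hom σ) (𝒟.forced (N x))
      have h5 := 𝒟.norm_forced_le (N x)
      change ‖𝒟.hom σ + 𝒟.forced (N x)‖ ≤ r / 2
      rw [← mul_assoc] at h2
      linarith
    · have h1 : Tendsto (N x) atTop (𝓝 0) := by
        have hc : ContinuousAt f 0 := hf.continuousOn.continuousAt (Metric.ball_mem_nhds 0 hr)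
        have := hc.tendsto.comp hxt
        rw [hf0] at this
        exact this.congr fun t => (hN x (hlt hx) t).symm
      have := (𝒟.tendsto_hom σ).add (𝒟.tendsto_forced _ h1)
      rw [add_zero] at this
      exact this
  have hcontr : ContractingWith (1 / 2) (hmaps.restrict _ s s) := by
    refine ⟨by norm_num, LipschitzWith.of_dist_le_mul ?_⟩
    rintro ⟨x, hx, -⟩ ⟨y, hy, -⟩
    have hx : ‖x‖ ≤ r / 2 := hx
    have hy : ‖y‖ ≤ r / 2 := hy
    change dist (𝒟.hom σ + 𝒟.forced (N x)) (𝒟.hom σ + 𝒟.forced (N y)) ≤ _ * dist x y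
    rw [dist_add_left, dist_eq_norm, dist_eq_norm]
    have h1 := mul_le_mul_of_nonneg_left (norm_superposition_sub_le hf (hlt hx) (hlt hy)
      (hN x (hlt hx)) (hN y (hlt hy))) 𝒟.bound_nonneg
    have h2 := mul_le_mul_of_nonneg_right hε (norm_nonneg (x - y))
    rw [← mul_assoc] at h1
    have h3 : ((1 / 2 : ℝ≥0) : ℝ) = 1 / 2 := by push_cast; rfl
    rw [h3]
    exact (𝒟.norm_forced_sub_le _ _).trans (h1.trans h2)
  obtain ⟨x, hx, hfix, -⟩ := hcontr.exists_fixedPoint' hsc hmaps (x := 0)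
    ⟨by simpa using (half_pos hr).le, tendsto_const_nhds⟩ (edist_ne_top _ _)
  exact ⟨x, hx.1, hx.2, hfix.symm⟩

/-- The forced part contributes at most half of `‖x - x'‖`, which is absorbed on the left. -/
theorem Dichotomy.norm_sub_le_of_fixedPoint (𝒟 : Dichotomy p A)
    {f : EuclideanSpace ℝ (Fin n) → EuclideanSpace ℝ (Fin n)} {r : ℝ} {ε : ℝ≥0}
    (hε : 𝒟.bound * ε ≤ 1 / 2) (hf : LipschitzOnWith ε f (Metric.ball 0 r))
    {N : (ℝ →ᵇ EuclideanSpace ℝ (Fin n)) → (ℝ →ᵇ EuclideanSpace ℝ (Fin n))}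
    (hN : ∀ x, ‖x‖ < r → ∀ t, N x t = f (x t)) {σ σ' : stableSubspace p A}
    {x x' : ℝ →ᵇ EuclideanSpace ℝ (Fin n)} (hx : ‖x‖ < r) (hx' : ‖x'‖ < r)
    (h : x = 𝒟.hom σ + 𝒟.forced (N x)) (h' : x' = 𝒟.hom σ' + 𝒟.forced (N x')) :
    ‖x - x'‖ ≤ 2 * ‖𝒟.hom‖ * ‖σ - σ'‖ ∧
      ‖𝒟.forced (N x) - 𝒟.forced (N x')‖ ≤ ‖𝒟.hom‖ * ‖σ - σ'‖ := by
  have h1 := mul_le_mul_of_nonneg_left (norm_superposition_sub_le hf hx hx' (hN x hx) (hN x' hx'))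
    𝒟.bound_nonneg
  have h2 := mul_le_mul_of_nonneg_right hε (norm_nonneg (x - x'))
  rw [← mul_assoc] at h1
  have h3 := 𝒟.norm_forced_sub_le (N x) (N x')
  have h4 : x - x' = 𝒟.hom (σ - σ') + (𝒟.forced (N x) - 𝒟.forced (N x')) := by
    rw [map_sub]
    conv_lhs => rw [h, h']
    exact add_sub_add_comm _ _ _ _
  have h5 := norm_add_le (𝒟.hom (σ - σ')) (𝒟.forced (N x) - 𝒟.forced (N x'))
  rw [← h4] at h5
  have h6 := 𝒟.hom.le_opNorm (σ - σ')
  constructor <;> linarith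

theorem Dichotomy.isSolution_of_fixedPoint (𝒟 : Dichotomy p A) (hp1 : p < 1)
    {f : EuclideanSpace ℝ (Fin n) → EuclideanSpace ℝ (Fin n)} {σ : stableSubspace p A}
    {x y : ℝ →ᵇ EuclideanSpace ℝ (Fin n)} (hy : ∀ t, y t = f (x t))
    (h : x = 𝒟.hom σ + 𝒟.forced y) : IsSolution p A f x := by
  refine isSolution_iff.2 ⟨x.continuous.continuousOn, ?_⟩
  have hx : ∀ t, x t = 𝒟.hom σ t + 𝒟.forced y t := fun t => by
    conv_lhs => rw [h]
    rfl
  refine ((𝒟.caputoEq_hom σ).add hp1 (𝒟.caputoEq_forced y) (𝒟.hom σ).continuous.continuousOn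
    (𝒟.forced y).continuous.continuousOn).congr (fun t _ => (hx t).symm) fun t _ => ?_
  rw [← hy t, hx t, map_add, add_assoc]

end FracStable

/-! ### The local stable manifold theorem. -/

theorem mainTheorem1 {n : ℕ} (p : ℝ) (hp0 : 0 < p) (hp1 : p < 1)
    (A : Matrix (Fin n) (Fin n) ℝ) (hA : FracStable.IsHyperbolic p A) :
    IsCompl (FracStable.stableSubspace p A) (FracStable.unstableSubspace p A) ∧
    ∃ ε₀ : ℝ≥0, 0 < ε₀ ∧
      ∀ (f : EuclideanSpace ℝ (Fin n) → EuclideanSpace ℝ (Fin n)) (r : ℝ),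
        f 0 = 0 → 0 < r → LipschitzOnWith ε₀ f (Metric.ball 0 r) →
        ∃ (δ : ℝ) (h : FracStable.stableSubspace p A → FracStable.unstableSubspace p A),
          0 < δ ∧ h 0 = 0 ∧
          (∃ K : ℝ≥0, LipschitzOnWith K h (Metric.ball 0 δ)) ∧
          -- if the Lipschitz constant of `f` near `0` tends to `0`, then the graph is tangent
          -- to `E^s` at the origin
          ((∀ ε : ℝ≥0, 0 < ε → ∃ ρ : ℝ, 0 < ρ ∧ LipschitzOnWith ε f (Metric.ball 0 ρ)) →
            HasFDerivAt h
              (0 : FracStable.stableSubspace p A →L[ℝ] FracStable.unstableSubspace p A) 0) ∧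
          ∀ σ : FracStable.stableSubspace p A, ‖σ‖ < δ →
            -- over the `δ`-ball of `E^s`, the local stable set is the graph of `h`
            (∀ υ : FracStable.unstableSubspace p A,
              (σ : EuclideanSpace ℝ (Fin n)) + (υ : EuclideanSpace ℝ (Fin n)) ∈
                  FracStable.localStableSet p A f (Metric.ball 0 r) ↔ υ = h σ) ∧
            -- through a point of the graph passes exactly one solution; it stays near the
            -- origin and tends to it
            (∃ x : ℝ → EuclideanSpace ℝ (Fin n),
              FracStable.IsSolution p A f x ∧
              x 0 = (σ : EuclideanSpace ℝ (Fin n)) + (h σ : EuclideanSpace ℝ (Fin n)) ∧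
              (∀ t : ℝ, 0 ≤ t → x t ∈ Metric.ball (0 : EuclideanSpace ℝ (Fin n)) r) ∧
              Tendsto x atTop (𝓝 0) ∧
              ∀ y : ℝ → EuclideanSpace ℝ (Fin n), FracStable.IsSolution p A f y →
                y 0 = x 0 → EqOn y x (Ici 0)) ∧
            -- a solution that stays near the origin starts on the graph
            (∀ (υ : FracStable.unstableSubspace p A) (y : ℝ → EuclideanSpace ℝ (Fin n)),
              FracStable.IsSolution p A f y →
              y 0 = (σ : EuclideanSpace ℝ (Fin n)) + (υ : EuclideanSpace ℝ (Fin n)) →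
              (∀ t : ℝ, 0 ≤ t → y t ∈ Metric.ball (0 : EuclideanSpace ℝ (Fin n)) r) →
              υ = h σ) := by
  refine ⟨hA.isCompl, ?_⟩
  obtain ⟨𝒟⟩ := hA.nonempty_dichotomy hp0 hp1
  have hb := 𝒟.bound_nonneg
  -- Chosen to give `bound * ε₀ ≤ 1 / 2`; the `+ 1` covers `bound = 0`.
  obtain ⟨ε₀, hε₀⟩ : ∃ ε₀ : ℝ≥0, (ε₀ : ℝ) = 1 / (2 * (𝒟.bound + 1)) :=
    CanLift.prf _ (by positivity)
  refine ⟨ε₀, by rw [← NNReal.coe_pos, hε₀]; positivity, ?_⟩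
  have hε : 𝒟.bound * ε₀ ≤ 1 / 2 := by
    rw [hε₀, mul_one_div, div_le_div_iff₀ (by linarith) two_pos]
    linarith
  intro f r hf0 hr hf
  obtain ⟨N, hN⟩ := FracStable.exists_superposition hf0 hr hf
  have hex : ∀ σ : FracStable.stableSubspace p A, ∃ x : BoundedContinuousFunction ℝ
      (EuclideanSpace ℝ (Fin n)), ‖𝒟.hom‖ * ‖σ‖ ≤ r / 4 → ‖x‖ ≤ r / 2 ∧ Tendsto x atTop (𝓝 0) ∧
        x = 𝒟.hom σ + 𝒟.forced (N x) := by
    intro σ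
    by_cases hσ : ‖𝒟.hom‖ * ‖σ‖ ≤ r / 4
    · obtain ⟨x, hx⟩ := 𝒟.exists_fixedPoint hr hε hf0 hf hN hσ
      exact ⟨x, fun _ => hx⟩
    · exact ⟨0, fun h => absurd h hσ⟩
  choose X hX using hex
  set δ : ℝ := r / (4 * (‖𝒟.hom‖ + 1)) with hδ
  have hδ0 : 0 < δ := by positivity
  have hX' : ∀ σ : FracStable.stableSubspace p A, ‖σ‖ < δ → ‖X σ‖ ≤ r / 2 ∧
      Tendsto (X σ) atTop (𝓝 0) ∧ X σ = 𝒟.hom σ + 𝒟.forced (N (X σ)) := by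
    intro σ hσ
    refine hX σ ?_
    rw [hδ, lt_div_iff₀ (by positivity)] at hσ
    nlinarith [norm_nonneg σ, norm_nonneg 𝒟.hom]
  have hXr : ∀ σ : FracStable.stableSubspace p A, ‖σ‖ < δ → ‖X σ‖ < r := fun σ hσ =>
    ((hX' σ hσ).1).trans_lt (half_lt_self hr)
  -- At time `0` the homogeneous part of the fixed point is `σ`, so the forced part is the
  -- `E^u`-component. Outside the `δ`-ball the value need not belong to a solution.
  let h : FracStable.stableSubspace p A → FracStable.unstableSubspace p A := fun σ =>
    ⟨𝒟.forced (N (X σ)) 0, 𝒟.forced_mem _⟩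
  have hX0 : ∀ σ, ‖σ‖ < δ → X σ 0 = (σ : EuclideanSpace ℝ (Fin n)) + h σ := fun σ hσ => by
    conv_lhs => rw [(hX' σ hσ).2.2]
    change 𝒟.hom σ 0 + _ = _
    rw [𝒟.hom_zero]
  have hsol : ∀ σ, ‖σ‖ < δ → FracStable.IsSolution p A f (X σ) := fun σ hσ =>
    𝒟.isSolution_of_fixedPoint hp1 (hN _ (hXr σ hσ)) (hX' σ hσ).2.2
  have hball : ∀ σ, ‖σ‖ < δ → ∀ t : ℝ, 0 ≤ t →
      X σ t ∈ Metric.ball (0 : EuclideanSpace ℝ (Fin n)) r := fun σ hσ t _ =>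
    mem_ball_zero_iff.2 (((X σ).norm_coe_le_norm t).trans_lt (hXr σ hσ))
  have hz : ‖(0 : FracStable.stableSubspace p A)‖ < δ := by rwa [norm_zero]
  have h3 : ∀ σ : FracStable.stableSubspace p A, ‖σ‖ < δ → ∀ (υ : FracStable.unstableSubspace p A)
      (y : ℝ → EuclideanSpace ℝ (Fin n)), FracStable.IsSolution p A f y →
      y 0 = (σ : EuclideanSpace ℝ (Fin n)) + (υ : EuclideanSpace ℝ (Fin n)) →
      (∀ t : ℝ, 0 ≤ t → y t ∈ Metric.ball (0 : EuclideanSpace ℝ (Fin n)) r) → υ = h σ := by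
    intro σ hσ υ y hy hy0 hyr
    have := 𝒟.eq_of_isSolution hp1 (hε.trans_lt (by norm_num)) hf hy (hsol σ hσ) hyr
      (hball σ hσ) (by
        rw [hy0, hX0 σ hσ, add_sub_add_left_eq_sub]
        exact Submodule.sub_mem _ υ.2 (h σ).2) (le_refl (0 : ℝ))
    rw [hy0, hX0 σ hσ] at this
    exact Subtype.ext (add_left_cancel this)
  -- the fixed point over `0` is `0`
  have hXz : X 0 = 0 ∧ h 0 = 0 := by
    have hN0 : ∀ t, N 0 t = f ((0 : BoundedContinuousFunction ℝ (EuclideanSpace ℝ (Fin n))) t) :=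
      hN 0 (by rwa [norm_zero])
    have hN0' : 𝒟.forced (N 0) = 0 := by
      have h1 := FracStable.norm_superposition_le hf0 hf hN0 (by rwa [norm_zero])
      have h2 := (𝒟.norm_forced_le (N 0)).trans (mul_le_mul_of_nonneg_left h1 hb)
      rw [norm_zero, mul_zero, mul_zero] at h2
      exact norm_le_zero_iff.1 h2
    have h1 := (𝒟.norm_sub_le_of_fixedPoint hε hf hN (hXr 0 hz) (by rwa [norm_zero])
      (hX' 0 hz).2.2 (x' := 0) (σ' := 0) (by rw [hN0', map_zero, add_zero])).1
    rw [sub_zero, sub_zero, norm_zero, mul_zero] at h1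
    have h2 : X 0 = 0 := norm_le_zero_iff.1 h1
    refine ⟨h2, Subtype.ext ?_⟩
    change 𝒟.forced (N (X 0)) 0 = 0
    rw [h2, hN0']
    rfl
  have hXn : ∀ σ, ‖σ‖ < δ → ‖X σ‖ ≤ 2 * ‖𝒟.hom‖ * ‖σ‖ := by
    intro σ hσ
    have h1 := (𝒟.norm_sub_le_of_fixedPoint hε hf hN (hXr σ hσ) (hXr 0 hz)
      (hX' σ hσ).2.2 (hX' 0 hz).2.2).1
    rwa [hXz.1, sub_zero, sub_zero] at h1
  refine ⟨δ, h, hδ0, hXz.2, ⟨‖𝒟.hom‖₊, ?_⟩, fun htan => ?_,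
    fun σ hσ => ⟨fun υ => ⟨?_, ?_⟩, ⟨X σ, hsol σ hσ, hX0 σ hσ, hball σ hσ, (hX' σ hσ).2.1, ?_⟩,
      h3 σ hσ⟩⟩
  · refine LipschitzOnWith.of_dist_le_mul fun σ hσ σ' hσ' => ?_
    rw [mem_ball_zero_iff] at hσ hσ'
    have h1 := (𝒟.norm_sub_le_of_fixedPoint hε hf hN (hXr σ hσ) (hXr σ' hσ')
      (hX' σ hσ).2.2 (hX' σ' hσ').2.2).2
    rw [dist_eq_norm, dist_eq_norm]
    exact ((𝒟.forced (N (X σ)) - 𝒟.forced (N (X σ'))).norm_coe_le_norm 0).trans h1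
  · refine HasFDerivAt.of_isLittleO (Asymptotics.isLittleO_iff.2 fun c hc => ?_)
    -- On a small ball `f` has Lipschitz constant `c / D`. Together with `‖X σ‖ ≤ 2 ‖hom‖ ‖σ‖` this
    -- yields `‖h σ‖ ≤ (D - 1) / D * c ‖σ‖ ≤ c ‖σ‖`.
    set D : ℝ := 𝒟.bound * (2 * ‖𝒟.hom‖) + 1 with hD
    have hD0 : 0 < D := by positivity
    obtain ⟨ε, hεD⟩ : ∃ ε : ℝ≥0, (ε : ℝ) = c / D := CanLift.prf _ (by positivity)
    obtain ⟨ρ, hρ, hfρ⟩ := htan ε (by rw [← NNReal.coe_pos, hεD]; positivity)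
    have hδ' : 0 < min δ (ρ / (2 * ‖𝒟.hom‖ + 1)) := lt_min hδ0 (by positivity)
    filter_upwards [Metric.ball_mem_nhds (0 : FracStable.stableSubspace p A) hδ'] with σ hσ
    rw [mem_ball_zero_iff, lt_min_iff] at hσ
    have h1 := hXn σ hσ.1
    have h2 : ‖X σ‖ < ρ := by
      have := hσ.2
      rw [lt_div_iff₀ (by positivity)] at this
      nlinarith [norm_nonneg σ]
    have h4 := FracStable.norm_superposition_le hf0 hfρ (hN _ (hXr σ hσ.1)) h2
    rw [hεD] at h4
    have h5 : ‖N (X σ)‖ ≤ c / D * (2 * ‖𝒟.hom‖ * ‖σ‖) :=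
      h4.trans (mul_le_mul_of_nonneg_left h1 (by positivity))
    have h6 : ‖h σ‖ ≤ 𝒟.bound * (c / D * (2 * ‖𝒟.hom‖ * ‖σ‖)) :=
      ((𝒟.forced (N (X σ))).norm_coe_le_norm 0).trans
        ((𝒟.norm_forced_le _).trans (mul_le_mul_of_nonneg_left h5 hb))
    rw [hXz.2, sub_zero, sub_zero, zero_apply, sub_zero]
    refine h6.trans ?_
    calc 𝒟.bound * (c / D * (2 * ‖𝒟.hom‖ * ‖σ‖)) = (D - 1) / D * (c * ‖σ‖) := by
          rw [hD]; ring
      _ ≤ 1 * (c * ‖σ‖) := by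
          refine mul_le_mul_of_nonneg_right ?_ (by positivity)
          rw [div_le_one hD0]
          linarith
      _ = c * ‖σ‖ := one_mul _
  · rintro ⟨y, hy, hy0, hyr, -⟩
    exact h3 σ hσ υ y hy hy0 hyr
  · rintro rfl
    exact ⟨X σ, hsol σ hσ, hX0 σ hσ, hball σ hσ, (hX' σ hσ).2.1⟩
  · intro y hy hy0
    -- The competitor `y` is not assumed to stay in the ball; the margin between `r / 2` and `r`
    -- keeps it there.
    exact FracStable.eqOn_of_isSolution hp0 hp1 (half_lt_self hr) hf (hsol σ hσ) hy
      (fun t _ => ((X σ).norm_coe_le_norm t).trans (hX' σ hσ).1) hy0
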